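/- Let $C_4'$ be the graph with vertices $0_j,u_j,0'_j,d_j$ ($j\in\mathbb Z$) and edges $\{0_j,u_j\},\{u_j,0'_j\},\{0'_j,d_j\},\{d_j,0_j\}$ (the $j$-th copy $C_4^{(j)}$ of the 4-cycle) and $\{0_j,0'_{j+1}\}$ (bridges), and let $A$ be its set of arcs; an arc $e=(v,w)$ has origin $o(e)=v$, terminus $t(e)=w$ and inverse $\bar e=(w,v)$. The Grover walk on $\ell^2(A)$ is given by $(U\psi)(f)=\sum_{e:\,o(e)=t(f)}\bigl(\tfrac{2}{\deg o(e)}-\delta_{e,\bar f}\bigr)\psi(e)$. Let $\Psi_0\in\ell^2(A)$ with $\|\Psi_0\|=1$, let $\Psi_t=U^t\Psi_0$, and let $X_t$ be the label of the copy in which the walker is found at time $t$, that is, $\mathbb P(X_t=j)=\sum_{e:\,o(e)\in C_4^{(j)}}|\Psi_t(e)|^2$. Localization means that $\limsup_{t\to\infty}\mathbb P(X_t=j)>0$ for some $j\in\mathbb Z$. For a path $p=(e_1,\dots,e_n)$ put $w^{(m)}(p)=\sum_{r=1}^n e^{2\pi i m r/n}\delta_{e_r}$, let $c_j=((0'_j,u_j),(u_j,0_j),(0_j,d_j),(d_j,0'_j))$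 with inverse cycle $\bar c_j$ (the inverse arcs in reverse order), let $(j,\Gamma)$ be the span of $w^{(m)}(c_j)-w^{(m)}(\bar c_j)$ for $m=1,2,3,4$, and let $\Pi_{(j,\Gamma)}$ be the orthogonal projection onto it. (1) Localization occurs if and only if $\Psi_0\notin\bigl(\bigoplus_{j\in\mathbb Z}(j,\Gamma)\bigr)^{\perp}$. (2) Put $\Delta=\sum_{j\in\mathbb Z}\|\Pi_{(j,\Gamma)}\Psi_0\|^2$, which is finite. There is an integrable function $f\ge 0$ with $\Delta+\int_{\mathbb R} f(y)\,dy=1$ such that $X_t/t$ converges weakly to the law $\Delta\,\delta_0(dy)+f(y)\,dy$, that is, for every real $x\neq 0$ $$\lim_{t\to\infty}\mathbb P\Bigl(\frac{X_t}{t}\le x\Bigr)=\Delta\,\mathbf 1_{\{x\ge 0\}}+\int_{-\infty}^x f(y)\,dy ;$$ this holds for $x=0$ too if $\Pi_{(j,\Gamma)}\Psi_0=0$ for all $j>0$. Here $f=c_1f_1+c_2f_2$ with real constants $c_1,c_2$ and integrable functions $f_1,f_2$ that vanish outside $(-1/\sqrt{10},1/\sqrt{10})$ and $(-2/7,2/7)$,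 respectively. If $\Psi_0$ has finite support, then $f_1$ and $f_2$ can be chosen so that, in addition, they are continuous on these open intervals and the closures of $\{f_1\ne0\}$ and $\{f_2\neq 0\}$ are $[-1/\sqrt{10},1/\sqrt{10}]$ and $[-2/7,2/7]$. -/

import Mathlib

open Filter Topology MeasureTheory

noncomputable section

/-! ### The Grover walk on a locally finite graph -/

namespace GroverWalk

variable {V : Type*} [DecidableEq V] (G : SimpleGraph V) [G.LocallyFinite]

/-- One step `ψ ↦ U ψ` of the Grover walk.  Arcs are the darts of `G`: the arc `e = (u, v)` has
origin `e.fst = u`, terminus `e.snd = v` and inverse arc `e.symm`.  The matrix element of `U` from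
`e` to `f` is `2 / deg (o e) - δ_{e, f⁻¹}` if `o e = t f` and `0` otherwise, so the value of `U ψ`
at `f` is a finite sum over the arcs `e` which leave the terminus of `f`. -/
def step (ψ : G.Dart → ℂ) : G.Dart → ℂ := fun f =>
  ∑ w : G.neighborSet f.snd,
    (2 / (G.degree f.snd : ℂ) -
        (if G.dartOfNeighborSet f.snd w = f.symm then 1 else 0)) *
      ψ (G.dartOfNeighborSet f.snd w)

/-- The amplitude `Ψ_t = U ^ t Ψ_0` at time `t`. -/
def state (Ψ₀ : G.Dart → ℂ) (t : ℕ) : G.Dart → ℂ := (step G)^[t] Ψ₀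

/-- The finding probability `μ_t(v)`: the sum of `|Ψ_t(e)|²` over the arcs `e` with origin `v`. -/
def vertexProb (Ψ₀ : G.Dart → ℂ) (t : ℕ) (v : V) : ℝ :=
  ∑ w : G.neighborSet v, ‖state G Ψ₀ t (G.dartOfNeighborSet v w)‖ ^ 2

end GroverWalk

/-! ### The periodic graph `C₄'` -/

/-- The vertices `0, u, 0', d` of the 4-cycle. -/
inductive CycleVertex : Type
  | zero
  | up
  | zeroPrime
  | down
  deriving DecidableEq

instance CycleVertex.instFintype : Fintype CycleVertex where
  elems := {.zero, .up, .zeroPrime, .down}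
  complete := by intro v; cases v <;> decide

namespace PeriodicC4

open CycleVertex

/-- The edges of `C₄'`, each listed in one direction.  In every copy: `0 u`, `u 0'`, `0' d`, `d 0`;
and the bridges `0_j 0'_{j+1}`. -/
def Bond (p q : ℤ × CycleVertex) : Prop :=
  (q.1 = p.1 ∧
    ((p.2 = zero ∧ q.2 = up) ∨ (p.2 = up ∧ q.2 = zeroPrime) ∨
      (p.2 = zeroPrime ∧ q.2 = down) ∨ (p.2 = down ∧ q.2 = zero))) ∨
  (q.1 = p.1 + 1 ∧ p.2 = zero ∧ q.2 = zeroPrime)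

/-- The graph `C₄'`: copies of the 4-cycle labelled by `j : ℤ`, where `(j, v)` is the vertex `v`
of copy `j`, consecutive copies being joined by one bridge. -/
def graph : SimpleGraph (ℤ × CycleVertex) := SimpleGraph.fromRel Bond

theorem neighborSet_finite (p : ℤ × CycleVertex) : (graph.neighborSet p).Finite := by
  refine ((Set.finite_Icc (p.1 - 1) (p.1 + 1)).prod
    (Set.finite_univ (α := CycleVertex))).subset ?_
  rintro q hq
  rw [SimpleGraph.mem_neighborSet, graph, SimpleGraph.fromRel_adj] at hq
  simp only [Set.mem_prod, Set.mem_Icc, Set.mem_univ, and_true]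
  rcases hq.2 with (h | h) | (h | h) <;> omega

instance instLocallyFinite : graph.LocallyFinite := fun p => (neighborSet_finite p).fintype

/-- The Hilbert space `ℓ²(A(C₄'))`. -/
abbrev StateSpace : Type := lp (fun _ : graph.Dart => ℂ) 2

/-! ### Position of the walker and localization -/

/-- `P(X_t = j)`, where `X_t` is the label of the copy in which the walker is found at time `t`. -/
def copyProb (Ψ₀ : StateSpace) (t : ℕ) (j : ℤ) : ℝ :=
  ∑ v : CycleVertex, GroverWalk.vertexProb graph Ψ₀ t (j, v)

/-- `P(X_t / t ≤ x)`. -/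
def scaledCDF (Ψ₀ : StateSpace) (t : ℕ) (x : ℝ) : ℝ :=
  ∑' j : ℤ, if (j : ℝ) / (t : ℝ) ≤ x then copyProb Ψ₀ t j else 0

/-- Localization: `limsup_t P(X_t = j) > 0` for some `j`. -/
def Localizes (Ψ₀ : StateSpace) : Prop :=
  ∃ j : ℤ, 0 < limsup (fun t : ℕ => copyProb Ψ₀ t j) atTop

/-! ### The periodic homological eigenspace -/

/-- `w^{(m)}(p) = ∑_{r=1}^n exp(2 π i m r / n) δ_{e_r}` for a path `p = (e_1, …, e_n)`. -/
def pathWave (m : ℕ) {n : ℕ} (p : Fin n → graph.Dart) : StateSpace :=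
  ∑ r : Fin n,
    Complex.exp (2 * Real.pi * Complex.I * m * ((r : ℕ) + 1) / n) • lp.single 2 (p r) (1 : ℂ)

/-- The inverse path `(e_n⁻¹, …, e_1⁻¹)`. -/
def revPath {n : ℕ} (p : Fin n → graph.Dart) : Fin n → graph.Dart := fun r => (p r.rev).symm

/-- The closed cycle `c_j = ((0', u), (u, 0), (0, d), (d, 0'))` in copy `j`. -/
def cycle (j : ℤ) : Fin 4 → graph.Dart :=
  ![⟨((j, zeroPrime), (j, up)), by simp [graph, Bond]⟩,
    ⟨((j, up), (j, zero)), by simp [graph, Bond]⟩,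
    ⟨((j, zero), (j, down)), by simp [graph, Bond]⟩,
    ⟨((j, down), (j, zeroPrime)), by simp [graph, Bond]⟩]

/-- `(j, Γ_m)`: the line spanned by `w^{(m)}(c_j) - w^{(m)}(c_j⁻¹)`. -/
def homLine (j : ℤ) (m : ℕ) : Submodule ℂ StateSpace :=
  Submodule.span ℂ {pathWave m (cycle j) - pathWave m (revPath (cycle j))}

/-- `(j, Γ)`: the span of `(j, Γ_1), …, (j, Γ_4)`. -/
def homSpace (j : ℤ) : Submodule ℂ StateSpace := ⨆ m : Fin 4, homLine j ((m : ℕ) + 1)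

instance instFiniteDimensionalHomLine (j : ℤ) (m : ℕ) : FiniteDimensional ℂ (homLine j m) := by
  unfold homLine; infer_instance

instance instFiniteDimensionalHomSpace (j : ℤ) : FiniteDimensional ℂ (homSpace j) := by
  unfold homSpace; infer_instance

/-- The periodic homological eigenspace `⨁_j (j, Γ)` (Hilbert space direct sum inside
`ℓ²(A(C₄'))`; the summands have disjoint supports). -/
def periodicHomSpace : Submodule ℂ StateSpace := (⨆ j : ℤ, homSpace j).topologicalClosure

/-- `‖Π_{(j, Γ)} Ψ₀‖²`. -/
def homWeight (Ψ₀ : StateSpace) (j : ℤ) : ℝ := ‖(homSpace j).starProjection Ψ₀‖ ^ 2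

end PeriodicC4

end

open Filter Topology MeasureTheory

noncomputable section

/-! The exchange of `u` and `d` in all copies commutes with the walk and splits it in two. An odd
state vanishes on the bridges, and a step merely permutes its components inside each copy, up to
sign (`sum_norm_sq_antiPart_step`). The odd states of copy j are exactly (j, Γ)
(`homSpace_eq_span`), so their weight stays in copy j for ever. This weight is the source of
localization and of the atom at 0.

The even states form a walk on a line of cells with six arcs each (`symPart_step`). Over a
quasi-momentum k the simple random walk on the vertices has three even eigenvalues cos θ, the roots
of 9 cos³ θ - 7 cos θ = 2 cos k, and each of them gives two eigenvalues exp(±iθ) of the quantum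
walk. The group velocity y = dθ/dk ranges over |y| < 1/√10 on the two outer branches and over |y| <
2/7 on the middle one. The velocity itself serves as coordinate: x = 9 cos² θ satisfies y² (3x - 7)²
= (x - 1)(x - 4), a curve uniformized by p² = 9 - 80 y². The normalized Bloch waves, as functions of
y, define an isometry `spectral`, and the limit density of the even part is the squared norm of its
value at y.

Convergence is proved by moments. Let X be the position and U the evolution. Taking the commutator
of X with the dispersion relation of U gives X U^t D = t U^t N + O(1), where the symbol of N is y
times that of D (`norm_position_evolOp_pow_le`, `bloch_velocityNum`). Since D has dense range
(`exists_velocityDenom_near`) and the speed is finite, induction yields (X/t)^n U^t ≈ U^t y^n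
(`exists_velocityPow_near`). Weierstrass approximation and a sandwich argument give the distribution
functions for finitely supported states (`tendsto_velocityMean_Iic`), and density gives them for all
states (`tendsto_velocityMean_spectral`).

The limit of the even part has no atom, so that part leaves every copy (`tendsto_cell_zero`), which
settles localization. For finite support the Bloch transform is analytic in y, so a band density
vanishes either identically or on no subinterval (`tsupport_finiteBandDensity`). -/

/-! ### Bloch waves of the symmetric sector -/

namespace LineWalk

/-- The cell components of the (left) Bloch eigenvector of the line walk with quasi-momentum phase
`ω`, inverse phase `v`, vertex eigenvalue `l` and inverse eigenvalue `ζ`. -/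
def coef (l ω v ζ : ℂ) : Fin 6 → ℂ :=
  ![(√2 : ℝ) * ((3 * l ^ 2 - 1) - ζ * ((3 * l + ω) / 2)),
    (√2 : ℝ) * ((3 * l + ω) / 2 - ζ * (1 + ω * l)),
    (√2 : ℝ) * ((1 + ω * l) - ζ * ((3 * l + ω) / 2)),
    (√2 : ℝ) * ((3 * l + ω) / 2 - ζ * (3 * l ^ 2 - 1)),
    (1 + ω * l) - ζ * ω * (3 * l ^ 2 - 1),
    (3 * l ^ 2 - 1) - ζ * v * (1 + ω * l)]

theorem sqrt_two_mul_self : ((√2 : ℝ) : ℂ) * ((√2 : ℝ) : ℂ) = 2 := by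
  rw [← Complex.ofReal_mul, Real.mul_self_sqrt (by norm_num)]; norm_num

theorem conj_coef {l : ℝ} {ω v ζ ξ : ℂ} (hω : starRingEnd ℂ ω = v) (hv : starRingEnd ℂ v = ω)
    (hζ : starRingEnd ℂ ζ = ξ) (i : Fin 6) :
    starRingEnd ℂ (coef l ω v ζ i) = coef l v ω ξ i := by
  fin_cases i <;> simp [coef, hω, hv, hζ, Complex.conj_ofNat]

/-- The vertex inner product of two Bloch waves. -/
def vertexForm (l₁ l₂ ω v : ℂ) : ℂ :=
  3 * (3 * l₁ ^ 2 - 1) * (3 * l₂ ^ 2 - 1) + 3 * (1 + v * l₁) * (1 + ω * l₂) +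
    (3 * l₁ + v) * (3 * l₂ + ω)

/-- Each `coef` has the form f(origin) - ζ f(terminus), where f is the Bloch eigenfunction of the
random walk with values 3l² - 1 at 0', 1 + ωl at 0 and (3l + ω)/2 at u and d. Summing the products
over the arcs, the eigenvalue equation of the second function reduces everything to the
degree-weighted inner product `vertexForm`. -/
theorem sum_coef_mul_coef {l₁ l₂ ω v ξ ζ : ℂ} (hωv : ω * v = 1)
    (h₂ : 9 * l₂ ^ 3 - 7 * l₂ = ω + v) :
    ∑ i, coef l₁ v ω ξ i * coef l₂ ω v ζ i =
      (1 + ξ * ζ - (ξ + ζ) * l₂) * vertexForm l₁ l₂ ω v := by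
  have hr := sqrt_two_mul_self
  simp only [Fin.sum_univ_six, coef, vertexForm, Matrix.cons_val]
  generalize ((√2 : ℝ) : ℂ) = r at hr
  linear_combination (ξ + ζ) * (3 * l₁ ^ 2 - 1) * h₂ +
    (ξ * ζ * ((3 * l₁ ^ 2 - 1) * (3 * l₂ ^ 2 - 1) + (1 + v * l₁) * (1 + ω * l₂)) -
      (ξ + ζ) * (3 * l₁ ^ 2 - 1) * l₂) * hωv +
    (((3 * l₁ ^ 2 - 1) - ξ * ((3 * l₁ + v) / 2)) * ((3 * l₂ ^ 2 - 1) - ζ * ((3 * l₂ + ω) / 2)) +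
     ((3 * l₁ + v) / 2 - ξ * (1 + v * l₁)) * ((3 * l₂ + ω) / 2 - ζ * (1 + ω * l₂)) +
     ((1 + v * l₁) - ξ * ((3 * l₁ + v) / 2)) * ((1 + ω * l₂) - ζ * ((3 * l₂ + ω) / 2)) +
     ((3 * l₁ + v) / 2 - ξ * (3 * l₁ ^ 2 - 1)) * ((3 * l₂ + ω) / 2 - ζ * (3 * l₂ ^ 2 - 1))) * hr

/-- Orthogonality of eigenfunctions of the reversible random walk with different eigenvalues. -/
theorem vertexForm_eq_zero {l₁ l₂ ω v : ℂ} (hωv : ω * v = 1) (h₁ : 9 * l₁ ^ 3 - 7 * l₁ = ω + v)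
    (h₂ : 9 * l₂ ^ 3 - 7 * l₂ = ω + v) (hne : l₁ ≠ l₂) : vertexForm l₁ l₂ ω v = 0 := by
  -- Vieta's relations: the cubic has no quadratic term, so its third root is -(l₁ + l₂).
  have e : 9 * (l₁ ^ 2 + l₁ * l₂ + l₂ ^ 2) = 7 := by
    have := sub_ne_zero.2 hne
    apply mul_left_cancel₀ this
    linear_combination h₁ - h₂
  have h : ω + v = -9 * (l₁ * l₂) * (l₁ + l₂) := by
    linear_combination l₁ * e - h₁
  unfold vertexForm
  linear_combination 3 * (l₁ + l₂) * h - (1 + 3 * (l₁ * l₂)) * e + (3 * (l₁ * l₂) + 1) * hωv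

theorem vertexForm_self {l ω v : ℂ} (hωv : ω * v = 1) (h : 9 * l ^ 3 - 7 * l = ω + v) :
    vertexForm l l ω v = (3 * l ^ 2 - 1) * (27 * l ^ 2 - 7) := by
  unfold vertexForm
  linear_combination (3 * l ^ 2 + 1) * hωv - 6 * l * h

/-- The eigenvector equations for the columns of the evolution. -/
theorem coef_intertwine {l ω v ζ z : ℂ} (hωv : ω * v = 1) (h : 9 * l ^ 3 - 7 * l = ω + v)
    (hz : z * ζ = 1) (hl : z + ζ = 2 * l) :
    (1 / 3 * coef l ω v ζ 3 + 2 * (√2 : ℝ) / 3 * (v * coef l ω v ζ 4) = z * coef l ω v ζ 0) ∧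
    (coef l ω v ζ 0 = z * coef l ω v ζ 1) ∧
    (1 / 3 * coef l ω v ζ 1 + 2 * (√2 : ℝ) / 3 * (ω * coef l ω v ζ 5) = z * coef l ω v ζ 2) ∧
    (coef l ω v ζ 2 = z * coef l ω v ζ 3) ∧
    (2 * (√2 : ℝ) / 3 * coef l ω v ζ 1 - 1 / 3 * (ω * coef l ω v ζ 5) = z * coef l ω v ζ 4) ∧
    (2 * (√2 : ℝ) / 3 * coef l ω v ζ 3 - 1 / 3 * (v * coef l ω v ζ 4) = z * coef l ω v ζ 5) := by
  have hr := sqrt_two_mul_self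
  simp only [coef, Matrix.cons_val]
  generalize ((√2 : ℝ) : ℂ) = r at hr
  obtain rfl : z = 2 * l - ζ := by linear_combination hl
  refine ⟨?_, ?_, ?_, ?_, ?_, ?_⟩
  · linear_combination (exp := 1) r * (((3 * l + ω) / 2) * hz - 2 / 3 * h +
      (2 / 3 * l - 2 / 3 * ζ * (3 * l ^ 2 - 1)) * hωv)
  · linear_combination r * ((1 + ω * l)) * hz
  · linear_combination r * (((3 * l + ω) / 2) * hz - 2 / 3 * ζ * (1 + ω * l) * hωv)
  · linear_combination r * ((3 * l ^ 2 - 1)) * hz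
  · linear_combination (ω * (3 * l ^ 2 - 1)) * hz + 1 / 3 * ζ * (1 + ω * l) * hωv +
      2 / 3 * ((3 * l + ω) / 2 - ζ * (1 + ω * l)) * hr
  · linear_combination (v * (1 + ω * l)) * hz + 1 / 3 * ζ * (3 * l ^ 2 - 1) * hωv +
      2 / 3 * ((3 * l + ω) / 2 - ζ * (3 * l ^ 2 - 1)) * hr - 2 / 3 * h + 2 / 3 * l * hωv

/-- The eigenvectors of the fibre over a quasi-momentum with three distinct vertex eigenvalues
resolve the identity. -/
theorem sum_conj_coef_mul_coef (l : Fin 3 → ℝ) (s : Fin 3 → ℝ) (ω : ℂ) (hω : ‖ω‖ = 1)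
    (hl : ∀ a, ((9 * l a ^ 3 - 7 * l a : ℝ) : ℂ) = ω + ω⁻¹) (hinj : Function.Injective l)
    (hs : ∀ a, l a ^ 2 + s a ^ 2 = 1) (hs0 : ∀ a, s a ≠ 0)
    (hN : ∀ a, 0 < (3 * l a ^ 2 - 1) * (27 * l a ^ 2 - 7)) (i j : Fin 6) :
    ∑ a, ((2 * ((3 * l a ^ 2 - 1) * (27 * l a ^ 2 - 7)) * s a ^ 2 : ℝ) : ℂ)⁻¹ *
      (starRingEnd ℂ (coef (l a) ω ω⁻¹ (l a - s a * Complex.I) i) *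
          coef (l a) ω ω⁻¹ (l a - s a * Complex.I) j +
        starRingEnd ℂ (coef (l a) ω ω⁻¹ (l a + s a * Complex.I) i) *
          coef (l a) ω ω⁻¹ (l a + s a * Complex.I) j) = if i = j then 1 else 0 := by
  classical
  have hω0 : ω ≠ 0 := by rintro rfl; simp at hω
  have hωv : ω * ω⁻¹ = 1 := mul_inv_cancel₀ hω0
  have hcω : starRingEnd ℂ ω = ω⁻¹ := by
    rw [Complex.inv_def, Complex.normSq_eq_norm_sq, hω]; simp
  have hcv : starRingEnd ℂ ω⁻¹ = ω := by rw [map_inv₀, hcω, inv_inv]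
  set N : Fin 3 → ℝ := fun a => 2 * ((3 * l a ^ 2 - 1) * (27 * l a ^ 2 - 7)) * s a ^ 2 with hNdef
  have hNpos : ∀ a, 0 < N a := fun a => by have := hN a; have := hs0 a; positivity
  set ζ : Fin 3 × Bool → ℂ := fun a => bif a.2 then l a.1 - s a.1 * Complex.I
    else l a.1 + s a.1 * Complex.I with hζ
  set c : Fin 3 × Bool → Fin 6 → ℂ := fun a => coef (l a.1) ω ω⁻¹ (ζ a) with hc
  set A : Matrix (Fin 3 × Bool) (Fin 6) ℂ :=
    Matrix.of fun a i => ((N a.1 : ℝ) : ℂ)⁻¹ * c a i with hA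
  set B : Matrix (Fin 6) (Fin 3 × Bool) ℂ := Matrix.of fun i a => starRingEnd ℂ (c a i) with hB
  have hcl : ∀ a, (9 * (l a : ℂ) ^ 3 - 7 * (l a : ℂ)) = ω + ω⁻¹ := fun a => by
    rw [← hl a]; push_cast; ring
  have hsq : ∀ a, (l a : ℂ) ^ 2 + (s a : ℂ) ^ 2 = 1 := fun a => by exact_mod_cast hs a
  -- Orthonormality of the six eigenvectors of the fibre. For the same l, the prefactor 1 + ξζ - (ξ
  -- + ζ)l equals 2s² for equal inverse eigenvalues and 0 for conjugate ones.
  have hAB : A * B = 1 := by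
    ext a b
    rw [Matrix.mul_apply]
    have e1 : ∑ i, A a i * B i b = ((N a.1 : ℝ) : ℂ)⁻¹ *
        ((1 + starRingEnd ℂ (ζ b) * ζ a - (starRingEnd ℂ (ζ b) + ζ a) * l a.1) *
          vertexForm (l b.1) (l a.1) ω ω⁻¹) := by
      rw [← sum_coef_mul_coef hωv (hcl a.1), Finset.mul_sum]
      refine Finset.sum_congr rfl fun i _ => ?_
      simp only [hA, hB, hc, Matrix.of_apply]
      rw [conj_coef hcω hcv rfl]; ring
    rw [e1, Matrix.one_apply]
    obtain ⟨a, x⟩ := a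
    obtain ⟨b, y⟩ := b
    by_cases hab : b = a
    · subst hab
      rw [vertexForm_self hωv (hcl b)]
      have hb := hsq b
      have hne : ((N b : ℝ) : ℂ) ≠ 0 := by exact_mod_cast (hNpos b).ne'
      by_cases hxy : x = y
      · subst hxy
        have : (1 + starRingEnd ℂ (ζ (b, x)) * ζ (b, x) -
            (starRingEnd ℂ (ζ (b, x)) + ζ (b, x)) * l b) = 2 * (s b : ℂ) ^ 2 := by
          cases x <;> simp [hζ] <;> linear_combination (-1 : ℂ) * hb +
            (-(s b : ℂ) ^ 2) * Complex.I_sq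
        rw [this, if_pos rfl, inv_mul_eq_iff_eq_mul₀ hne]
        simp only [hNdef]; push_cast; ring
      · have : (1 + starRingEnd ℂ (ζ (b, y)) * ζ (b, x) -
            (starRingEnd ℂ (ζ (b, y)) + ζ (b, x)) * l b) = 0 := by
          cases x <;> cases y <;> simp [hζ] at hxy ⊢ <;> linear_combination (-1 : ℂ) * hb +
            ((s b : ℂ) ^ 2) * Complex.I_sq
        rw [this, if_neg (by simpa using hxy)]; simp
    · rw [vertexForm_eq_zero hωv (hcl b) (hcl a)
        (fun h => hab (hinj (by exact_mod_cast h))), if_neg (by simp [Ne.symm hab])]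
      simp
  -- Six eigenvectors in six dimensions: orthonormality already implies completeness.
  have hBA : B * A = 1 := (Matrix.mul_eq_one_comm_of_card_eq _ _ _ (by simp)).1 hAB
  have := congrFun (congrFun hBA i) j
  rw [Matrix.one_apply, Matrix.mul_apply, Fintype.sum_prod_type] at this
  rw [← this]
  refine Finset.sum_congr rfl fun a _ => ?_
  simp only [Fintype.sum_bool, hA, hB, hc, hζ, Matrix.of_apply, cond_true, cond_false, hNdef]
  ring


/-! ### The two bands, parametrized by the group velocity. -/

/-- The sign attached to a Boolean. -/
def sg (b : Bool) : ℝ := bif b then 1 else -1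

/-- The maximal speed in a band. -/
def edge (b : Bool) : ℝ := bif b then 1 / √10 else 2 / 7

/-- The rational uniformizer of the velocity curve of a band. -/
def bandParam (b : Bool) (y : ℝ) : ℝ := sg b * √(9 - 80 * y ^ 2)

/-- `9 λ²` as a function of the velocity. -/
def bandX (b : Bool) (y : ℝ) : ℝ := (7 * bandParam b y + 11) / (3 * bandParam b y - 1)

/-- `|sin θ|` as a function of the velocity. -/
def bandSin (b : Bool) (y : ℝ) : ℝ := √(1 - bandX b y / 9)

/-- The vertex eigenvalue `cos θ` as a function of the velocity. -/
def vertexEig (b ε : Bool) (y : ℝ) : ℝ := sg ε * (√(bandX b y) / 3)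

/-- The cosine of the quasi-momentum as a function of the velocity. -/
def cosMom (b ε : Bool) (y : ℝ) : ℝ := sg ε * (√(bandX b y) * (bandX b y - 7) / 6)

/-- The sine of the quasi-momentum as a function of the velocity. -/
def sinMom (b : Bool) (y : ℝ) : ℝ := y * (3 * bandX b y - 7) * bandSin b y / 2

/-- The absolute derivative of the quasi-momentum with respect to the velocity. -/
def momDensity (b : Bool) (y : ℝ) : ℝ :=
  |3 * bandX b y - 7| ^ 3 / (3 * √(bandX b y) * (bandX b y + 11) * bandSin b y)

@[simp] theorem sg_true : sg true = 1 := rfl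
@[simp] theorem sg_false : sg false = -1 := rfl

theorem sg_mul_self (b : Bool) : sg b * sg b = 1 := by cases b <;> simp

theorem sg_sq (b : Bool) : sg b ^ 2 = 1 := by cases b <;> simp

theorem abs_sg (b : Bool) : |sg b| = 1 := by cases b <;> simp

theorem edge_pos (b : Bool) : 0 < edge b := by
  cases b <;> simp [edge]

theorem edge_true_sq : edge true ^ 2 = 1 / 10 := by
  simp only [edge, cond_true, div_pow, one_pow]; rw [Real.sq_sqrt (by norm_num)]

theorem edge_lt_one (b : Bool) : edge b < 1 := by
  cases b
  · norm_num [edge]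
  · have := edge_true_sq; nlinarith [edge_pos true]

theorem sq_le_of_mem_Icc {a y : ℝ} (hy : y ∈ Set.Icc (-a) a) : y ^ 2 ≤ a ^ 2 :=
  sq_le_sq' hy.1 hy.2

theorem sq_lt_of_mem_Ioo {a y : ℝ} (hy : y ∈ Set.Ioo (-a) a) : y ^ 2 < a ^ 2 :=
  sq_lt_sq' hy.1 hy.2

theorem radicand_pos {b : Bool} {y : ℝ} (hy : y ∈ Set.Icc (-edge b) (edge b)) :
    0 < 9 - 80 * y ^ 2 := by
  have h := sq_le_of_mem_Icc hy
  cases b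
  · norm_num [edge] at h; linarith
  · rw [edge_true_sq] at h; linarith

theorem bandParam_sq {b : Bool} {y : ℝ} (hy : y ∈ Set.Icc (-edge b) (edge b)) :
    bandParam b y ^ 2 = 9 - 80 * y ^ 2 := by
  rw [bandParam, mul_pow, sg_sq, one_mul, Real.sq_sqrt (radicand_pos hy).le]

theorem bandParam_true_mem {y : ℝ} (hy : y ∈ Set.Icc (-edge true) (edge true)) :
    bandParam true y ∈ Set.Icc 1 3 := by
  have h := sq_le_of_mem_Icc hy
  rw [edge_true_sq] at h
  rw [bandParam, sg_true, one_mul]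
  refine ⟨Real.one_le_sqrt.2 (by linarith), Real.sqrt_le_iff.2 ⟨by norm_num, by nlinarith⟩⟩

theorem bandParam_true_gt {y : ℝ} (hy : y ∈ Set.Ioo (-edge true) (edge true)) :
    1 < bandParam true y := by
  have h := sq_lt_of_mem_Ioo hy
  rw [edge_true_sq] at h
  rw [bandParam, sg_true, one_mul, Real.lt_sqrt (by norm_num)]
  linarith

theorem bandParam_false_mem {y : ℝ} (hy : y ∈ Set.Icc (-edge false) (edge false)) :
    bandParam false y ∈ Set.Icc (-3) (-(11 / 7)) := by
  have h := sq_le_of_mem_Icc hy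
  norm_num [edge] at h
  rw [bandParam, sg_false, neg_one_mul, Set.mem_Icc, neg_le_neg_iff, neg_le_neg_iff]
  refine ⟨Real.sqrt_le_iff.2 ⟨by norm_num, by nlinarith⟩,
    Real.le_sqrt_of_sq_le (by linarith)⟩

theorem bandParam_false_lt {y : ℝ} (hy : y ∈ Set.Ioo (-edge false) (edge false)) :
    bandParam false y < -(11 / 7) := by
  have h := sq_lt_of_mem_Ioo hy
  norm_num [edge] at h
  rw [bandParam, sg_false, neg_one_mul, neg_lt_neg_iff, Real.lt_sqrt (by norm_num)]
  linarith

theorem three_mul_bandParam_ne {b : Bool} {y : ℝ} (hy : y ∈ Set.Icc (-edge b) (edge b)) :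
    3 * bandParam b y - 1 ≠ 0 := by
  cases b
  · have := (bandParam_false_mem hy).2; intro h; linarith
  · have := (bandParam_true_mem hy).1; intro h; linarith

/-- As a quadratic in x this relation has discriminant 9 - 80y², the square of `bandParam`. The sign
of the root selects the band: x ∈ [4, 9) for `true`, x ∈ (0, 1] for `false` on the open intervals.
-/
theorem bandX_eq {b : Bool} {y : ℝ} (hy : y ∈ Set.Icc (-edge b) (edge b)) :
    y ^ 2 * (3 * bandX b y - 7) ^ 2 = (bandX b y - 1) * (bandX b y - 4) := by
  have h := bandParam_sq hy
  have h0 := three_mul_bandParam_ne hy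
  rw [bandX]
  field_simp
  linear_combination (20 : ℝ) * h

theorem bandX_true_mem {y : ℝ} (hy : y ∈ Set.Ioo (-edge true) (edge true)) :
    bandX true y ∈ Set.Ico 4 9 := by
  have h1 := bandParam_true_gt hy
  have h3 := (bandParam_true_mem (Set.Ioo_subset_Icc_self hy)).2
  have h0 : 0 < 3 * bandParam true y - 1 := by linarith
  rw [bandX, Set.mem_Ico, le_div_iff₀ h0, div_lt_iff₀ h0]
  constructor <;> linarith

theorem bandX_false_mem {y : ℝ} (hy : y ∈ Set.Ioo (-edge false) (edge false)) :
    bandX false y ∈ Set.Ioc 0 1 := by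
  have h1 := bandParam_false_lt hy
  have h3 := (bandParam_false_mem (Set.Ioo_subset_Icc_self hy)).1
  have h0 : 3 * bandParam false y - 1 < 0 := by linarith
  rw [bandX, Set.mem_Ioc, div_le_iff_of_neg h0, lt_div_iff_of_neg h0]
  constructor <;> linarith

theorem bandX_pos {b : Bool} {y : ℝ} (hy : y ∈ Set.Ioo (-edge b) (edge b)) : 0 < bandX b y := by
  cases b
  · exact (bandX_false_mem hy).1
  · linarith [(bandX_true_mem hy).1]

theorem bandX_lt {b : Bool} {y : ℝ} (hy : y ∈ Set.Ioo (-edge b) (edge b)) : bandX b y < 9 := by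
  cases b
  · linarith [(bandX_false_mem hy).2]
  · exact (bandX_true_mem hy).2

theorem bandX_ne {b : Bool} {y : ℝ} (hy : y ∈ Set.Ioo (-edge b) (edge b)) :
    3 * bandX b y - 7 ≠ 0 := by
  cases b
  · have := (bandX_false_mem hy).2; intro h; linarith
  · have := (bandX_true_mem hy).1; intro h; linarith

theorem bandX_norm_pos {b : Bool} {y : ℝ} (hy : y ∈ Set.Ioo (-edge b) (edge b)) :
    0 < (bandX b y - 3) * (3 * bandX b y - 7) := by
  cases b
  · have := (bandX_false_mem hy).2; nlinarith
  · have := (bandX_true_mem hy).1; nlinarith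

theorem bandSin_pos {b : Bool} {y : ℝ} (hy : y ∈ Set.Ioo (-edge b) (edge b)) :
    0 < bandSin b y := Real.sqrt_pos.2 (by linarith [bandX_lt hy])

theorem bandSin_sq {b : Bool} {y : ℝ} (hy : y ∈ Set.Ioo (-edge b) (edge b)) :
    bandSin b y ^ 2 = 1 - bandX b y / 9 := Real.sq_sqrt (by linarith [bandX_lt hy])

theorem vertexEig_sq {b : Bool} (ε : Bool) {y : ℝ} (hy : y ∈ Set.Ioo (-edge b) (edge b)) :
    vertexEig b ε y ^ 2 = bandX b y / 9 := by
  rw [vertexEig, mul_pow, sg_sq, div_pow, Real.sq_sqrt (bandX_pos hy).le]; norm_num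

theorem vertexEig_sq_add {b : Bool} (ε : Bool) {y : ℝ} (hy : y ∈ Set.Ioo (-edge b) (edge b)) :
    vertexEig b ε y ^ 2 + bandSin b y ^ 2 = 1 := by
  rw [vertexEig_sq ε hy, bandSin_sq hy]; ring

theorem vertexEig_cubic {b : Bool} (ε : Bool) {y : ℝ} (hy : y ∈ Set.Ioo (-edge b) (edge b)) :
    9 * vertexEig b ε y ^ 3 - 7 * vertexEig b ε y = 2 * cosMom b ε y := by
  rw [pow_succ, vertexEig_sq ε hy, vertexEig, cosMom]; ring

/-- `sinMom` is what differentiating 9 cos³ θ - 7 cos θ = 2 cos k prescribes when dθ/dk = y. The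
identity then rests on 36 - x(x - 7)² = (9 - x)(x - 1)(x - 4). -/
theorem cosMom_sq_add {b : Bool} (ε : Bool) {y : ℝ} (hy : y ∈ Set.Ioo (-edge b) (edge b)) :
    cosMom b ε y ^ 2 + sinMom b y ^ 2 = 1 := by
  have h1 := bandX_eq (Set.Ioo_subset_Icc_self hy)
  have h2 := bandSin_sq hy
  have h3 := Real.sq_sqrt (bandX_pos hy).le
  have h4 := sg_sq ε
  rw [cosMom, sinMom]
  generalize √(bandX b y) = r at *
  linear_combination (r ^ 2 * (bandX b y - 7) ^ 2 / 36) * h4 + ((bandX b y - 7) ^ 2 / 36) * h3 +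
    (y ^ 2 * (3 * bandX b y - 7) ^ 2 / 4) * h2 + ((1 - bandX b y / 9) / 4) * h1

theorem bandParam_neg (b : Bool) (y : ℝ) : bandParam b (-y) = bandParam b y := by
  simp [bandParam]

theorem bandX_neg (b : Bool) (y : ℝ) : bandX b (-y) = bandX b y := by
  simp [bandX, bandParam_neg]

theorem bandSin_neg (b : Bool) (y : ℝ) : bandSin b (-y) = bandSin b y := by
  simp [bandSin, bandX_neg]

theorem vertexEig_neg (b ε : Bool) (y : ℝ) : vertexEig b ε (-y) = vertexEig b ε y := by
  simp [vertexEig, bandX_neg]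

theorem cosMom_neg (b ε : Bool) (y : ℝ) : cosMom b ε (-y) = cosMom b ε y := by
  simp [cosMom, bandX_neg]

theorem sinMom_neg (b : Bool) (y : ℝ) : sinMom b (-y) = -sinMom b y := by
  simp [sinMom, bandX_neg, bandSin_neg]; ring

theorem momDensity_neg (b : Bool) (y : ℝ) : momDensity b (-y) = momDensity b y := by
  simp [momDensity, bandX_neg, bandSin_neg]

theorem momDensity_pos {b : Bool} {y : ℝ} (hy : y ∈ Set.Ioo (-edge b) (edge b)) :
    0 < momDensity b y := by
  have h1 := bandX_pos hy
  have h2 := bandSin_pos hy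
  have h3 := bandX_ne hy
  have h4 := Real.sqrt_pos.2 h1
  rw [momDensity]
  positivity

/-! ### The quasi-momentum as a function of the velocity -/

theorem continuousOn_bandX (b : Bool) : ContinuousOn (bandX b) (Set.Icc (-edge b) (edge b)) := by
  have : Continuous (bandParam b) := by unfold bandParam; fun_prop
  exact ContinuousOn.div (by fun_prop) (by fun_prop) fun y hy => three_mul_bandParam_ne hy

theorem hasDerivAt_bandX {b : Bool} {y : ℝ} (hy : y ∈ Set.Ioo (-edge b) (edge b)) :
    HasDerivAt (bandX b) (2 * y * (3 * bandX b y - 7) ^ 3 / (bandX b y + 11)) y := by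
  have hy' := Set.Ioo_subset_Icc_self hy
  have h0 := three_mul_bandParam_ne hy'
  have hr := radicand_pos hy'
  have hs := Real.sqrt_pos.2 hr
  have hp : HasDerivAt (bandParam b) (-80 * y / bandParam b y) y := by
    have h1 : HasDerivAt (fun y : ℝ => 9 - 80 * y ^ 2) (-(80 * (2 * y))) y := by
      simpa using ((hasDerivAt_pow 2 y).const_mul 80).const_sub 9
    have h2 := (h1.sqrt hr.ne').const_mul (sg b)
    refine h2.congr_deriv ?_
    rw [bandParam]
    have hsg := sg_mul_self b
    have hsg0 : sg b ≠ 0 := by intro h; simp [h] at hsg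
    field_simp
    linear_combination (-y) * hsg
  have hp0 : bandParam b y ≠ 0 := by
    cases b
    · linarith [(bandParam_false_mem hy').2]
    · linarith [(bandParam_true_mem hy').1]
  have h11 : bandX b y + 11 ≠ 0 := by linarith [bandX_pos hy]
  refine (((hp.const_mul 7).add_const 11).div ((hp.const_mul 3).sub_const 1) h0).congr_deriv ?_
  -- Both factors of the claimed derivative are monomials in p and 3p - 1, which reduces the claim
  -- to the chain rule through p.
  have e1 : bandX b y + 11 = 40 * bandParam b y / (3 * bandParam b y - 1) := by
    rw [eq_div_iff h0, bandX, add_mul, div_mul_cancel₀ _ h0]; ring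
  have e2 : 3 * bandX b y - 7 = 40 / (3 * bandParam b y - 1) := by
    rw [bandX]; field_simp; ring
  rw [e1, e2]
  field_simp
  ring

theorem hasDerivAt_cosMom {b : Bool} (ε : Bool) {y : ℝ} (hy : y ∈ Set.Ioo (-edge b) (edge b)) :
    HasDerivAt (cosMom b ε)
      (sg ε * (y * (3 * bandX b y - 7) ^ 4 / (6 * √(bandX b y) * (bandX b y + 11)))) y := by
  have h := hasDerivAt_bandX hy
  have hx := bandX_pos hy
  have hq := Real.sqrt_pos.2 hx
  have h11 : bandX b y + 11 ≠ 0 := by linarith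
  refine ((((h.sqrt hx.ne').mul (h.sub_const 7)).div_const 6).const_mul (sg ε)).congr_deriv ?_
  have h3 := Real.sq_sqrt hx.le
  field_simp
  rw [h3]; ring

/-- The quasi-momentum in `(0, π)` as a function of a positive velocity. -/
def mom (b ε : Bool) (y : ℝ) : ℝ := Real.arccos (cosMom b ε y)

theorem Ioo_zero_edge_subset (b : Bool) :
    Set.Ioo 0 (edge b) ⊆ Set.Ioo (-edge b) (edge b) := fun _ hy =>
  ⟨by linarith [hy.1, edge_pos b], hy.2⟩

theorem sinMom_ne_zero {b : Bool} {y : ℝ} (hy : y ∈ Set.Ioo 0 (edge b)) : sinMom b y ≠ 0 := by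
  have h := Ioo_zero_edge_subset b hy
  have h1 := bandX_ne h
  have h2 := bandSin_pos h
  have h3 := hy.1
  unfold sinMom
  positivity

theorem hasDerivAt_mom {b : Bool} (ε : Bool) {y : ℝ} (hy : y ∈ Set.Ioo 0 (edge b)) :
    HasDerivAt (mom b ε) (-sg ε * momDensity b y) y := by
  have h := Ioo_zero_edge_subset b hy
  have hs := sinMom_ne_zero hy
  have hcs := cosMom_sq_add ε h
  have hlt : cosMom b ε y ^ 2 < 1 := by have := sq_pos_of_ne_zero hs; linarith
  have h1 : cosMom b ε y ≠ -1 := by intro h; norm_num [h] at hlt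
  have h2 : cosMom b ε y ≠ 1 := by intro h; norm_num [h] at hlt
  refine ((Real.hasDerivAt_arccos h1 h2).comp y (hasDerivAt_cosMom ε h)).congr_deriv ?_
  have e : √(1 - cosMom b ε y ^ 2) = |sinMom b y| := by
    rw [← Real.sqrt_sq_eq_abs]; congr 1; linarith
  have hx := bandX_pos h
  have hq := Real.sqrt_pos.2 hx
  have h3 := abs_pos.2 (bandX_ne h)
  have h4 := bandSin_pos h
  have h5 := hy.1
  rw [e, sinMom, abs_div, abs_mul, abs_mul, abs_of_pos h5, abs_of_pos h4, momDensity,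
    show (3 * bandX b y - 7) ^ 4 = |3 * bandX b y - 7| ^ 4 by
      rw [← abs_pow, abs_of_nonneg (Even.pow_nonneg (by decide) _)]]
  norm_num
  field_simp
  ring

theorem continuousOn_mom (b ε : Bool) : ContinuousOn (mom b ε) (Set.Icc 0 (edge b)) := by
  have h : ContinuousOn (bandX b) (Set.Icc 0 (edge b)) :=
    (continuousOn_bandX b).mono (Set.Icc_subset_Icc_left (by linarith [edge_pos b]))
  refine Real.continuous_arccos.comp_continuousOn ?_
  unfold cosMom
  fun_prop

theorem bandX_zero (b : Bool) : bandX b 0 = bif b then 4 else 1 := by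
  have h : √(9 : ℝ) = 3 := by rw [show (9 : ℝ) = 3 ^ 2 by norm_num]; exact Real.sqrt_sq (by norm_num)
  cases b <;> norm_num [bandX, bandParam, h]

theorem bandX_edge (b : Bool) : bandX b (edge b) = bif b then 9 else 0 := by
  cases b
  · have h : √(121 / 49 : ℝ) = 11 / 7 := by
      rw [show (121 / 49 : ℝ) = (11 / 7) ^ 2 by norm_num]; exact Real.sqrt_sq (by norm_num)
    norm_num [bandX, bandParam, edge, h]
  · norm_num [bandX, bandParam, edge_true_sq]

theorem mom_zero (b ε : Bool) : mom b ε 0 = bif ε then Real.pi else 0 := by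
  have h4 : √(4 : ℝ) = 2 := by
    rw [show (4 : ℝ) = 2 ^ 2 by norm_num]; exact Real.sqrt_sq (by norm_num)
  cases b <;> cases ε <;> norm_num [mom, cosMom, bandX_zero, h4]

theorem mom_edge (b ε : Bool) :
    mom b ε (edge b) = bif b then (bif ε then 0 else Real.pi) else Real.pi / 2 := by
  have h9 : √(9 : ℝ) = 3 := by
    rw [show (9 : ℝ) = 3 ^ 2 by norm_num]; exact Real.sqrt_sq (by norm_num)
  cases b <;> cases ε <;> norm_num [mom, cosMom, bandX_edge, h9]

theorem deriv_mom_sign {b : Bool} (ε : Bool) {y : ℝ} (hy : y ∈ Set.Ioo 0 (edge b)) :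
    sg ε * deriv (mom b ε) y < 0 := by
  rw [(hasDerivAt_mom ε hy).deriv, neg_mul, mul_neg, ← mul_assoc, sg_mul_self, one_mul, neg_lt_zero]
  exact momDensity_pos (Ioo_zero_edge_subset b hy)

theorem strictAntiOn_mom (b : Bool) : StrictAntiOn (mom b true) (Set.Icc 0 (edge b)) :=
  strictAntiOn_of_deriv_neg (convex_Icc _ _) (continuousOn_mom b true) fun y hy => by
    rw [interior_Icc] at hy; simpa using deriv_mom_sign true hy

theorem strictMonoOn_mom (b : Bool) : StrictMonoOn (mom b false) (Set.Icc 0 (edge b)) :=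
  strictMonoOn_of_deriv_pos (convex_Icc _ _) (continuousOn_mom b false) fun y hy => by
    rw [interior_Icc] at hy; simpa using deriv_mom_sign false hy

theorem injOn_mom (b ε : Bool) : Set.InjOn (mom b ε) (Set.Ioo 0 (edge b)) := by
  cases ε
  · exact (strictMonoOn_mom b).injOn.mono Set.Ioo_subset_Icc_self
  · exact (strictAntiOn_mom b).injOn.mono Set.Ioo_subset_Icc_self

theorem image_mom_true (b : Bool) :
    mom b true '' Set.Ioo 0 (edge b) = Set.Ioo (mom b true (edge b)) Real.pi := by
  have h0 : mom b true 0 = Real.pi := mom_zero b true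
  have hm := strictAntiOn_mom b
  have he := (edge_pos b).le
  rw [← h0]
  refine Set.Subset.antisymm ?_ (intermediate_value_Ioo' he (continuousOn_mom b true))
  rintro _ ⟨y, hy, rfl⟩
  exact ⟨hm (Set.Ioo_subset_Icc_self hy) (Set.right_mem_Icc.2 he) hy.2,
    hm (Set.left_mem_Icc.2 he) (Set.Ioo_subset_Icc_self hy) hy.1⟩

theorem image_mom_false (b : Bool) :
    mom b false '' Set.Ioo 0 (edge b) = Set.Ioo 0 (mom b false (edge b)) := by
  have h0 : mom b false 0 = 0 := mom_zero b false
  have hm := strictMonoOn_mom b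
  have he := (edge_pos b).le
  conv_rhs => rw [← h0]
  refine Set.Subset.antisymm ?_ (intermediate_value_Ioo he (continuousOn_mom b false))
  rintro _ ⟨y, hy, rfl⟩
  exact ⟨hm (Set.left_mem_Icc.2 he) (Set.Ioo_subset_Icc_self hy) hy.1,
    hm (Set.Ioo_subset_Icc_self hy) (Set.right_mem_Icc.2 he) hy.2⟩

/-- The range of the quasi-momentum on a half sheet. -/
def momRange (b ε : Bool) : Set ℝ :=
  bif b then Set.Ioo 0 Real.pi
  else bif ε then Set.Ioo (Real.pi / 2) Real.pi else Set.Ioo 0 (Real.pi / 2)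

/-- On the outer band x reaches 9 at the edge, so k sweeps all of (0, π). On the inner band x
reaches 0, where cos k = 0, so each sign of cos θ covers only one half of (0, π). Hence almost every
k carries exactly three vertex eigenvalues. -/
theorem image_mom (b ε : Bool) : mom b ε '' Set.Ioo 0 (edge b) = momRange b ε := by
  cases ε
  · rw [image_mom_false, mom_edge]; cases b <;> rfl
  · rw [image_mom_true, mom_edge]; cases b <;> rfl


/-! ### Sheets of the spectrum and their normalized Bloch waves. -/

/-- A sheet `(b, ε, η)` of the spectrum: the band, the sign of `cos θ` and the sign of `sin θ`. -/
abbrev Sheet : Type := Bool × Bool × Bool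

/-- The quasi-momentum phase on a sheet, as a function of the velocity. -/
def blochPhase (σ : Sheet) (y : ℝ) : ℂ :=
  (cosMom σ.1 σ.2.1 y : ℂ) + ((sg σ.2.2 * sinMom σ.1 y : ℝ) : ℂ) * Complex.I

/-- The inverse eigenvalue on a sheet, as a function of the velocity. -/
def invEig (σ : Sheet) (y : ℝ) : ℂ :=
  (vertexEig σ.1 σ.2.1 y : ℂ) - ((sg σ.2.2 * bandSin σ.1 y : ℝ) : ℂ) * Complex.I

/-- The eigenvalue on a sheet, as a function of the velocity. -/
def eig (σ : Sheet) (y : ℝ) : ℂ :=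
  (vertexEig σ.1 σ.2.1 y : ℂ) + ((sg σ.2.2 * bandSin σ.1 y : ℝ) : ℂ) * Complex.I

/-- The unnormalized amplitude of the Bloch wave of a sheet at a site. -/
def amp (e : ℤ × Fin 6) (σ : Sheet) (y : ℝ) : ℂ :=
  blochPhase σ y ^ e.1 *
    coef (vertexEig σ.1 σ.2.1 y) (blochPhase σ y) (blochPhase σ y)⁻¹ (invEig σ y) e.2

/-- The squared norm of the cell components of a Bloch wave. -/
def ampNorm (b : Bool) (y : ℝ) : ℝ :=
  2 * ((bandX b y - 3) * (3 * bandX b y - 7) / 3) * bandSin b y ^ 2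

/-- The spectral weight of a band. -/
def bandWeight (b : Bool) (y : ℝ) : ℝ := momDensity b y / (2 * Real.pi * ampNorm b y)

/-- The values at `y` of the normalized spectral wave of a site. -/
def wave (e : ℤ × Fin 6) (y : ℝ) : EuclideanSpace ℂ Sheet :=
  WithLp.toLp 2 fun σ => if y ∈ Set.Ioo (-edge σ.1) (edge σ.1) then
    ((√(bandWeight σ.1 y) : ℝ) : ℂ) * amp e σ y else 0

section Regularity

variable {b : Bool} {y : ℝ} {n : WithTop ℕ∞}

theorem contDiffAt_bandX (hy : y ∈ Set.Ioo (-edge b) (edge b)) : ContDiffAt ℝ n (bandX b) y := by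
  have hy' := Set.Ioo_subset_Icc_self hy
  have h1 : ContDiffAt ℝ n (fun y : ℝ => 9 - 80 * y ^ 2) y := by fun_prop
  have h2 : ContDiffAt ℝ n (bandParam b) y :=
    contDiffAt_const.mul (h1.sqrt (radicand_pos hy').ne')
  exact ((contDiffAt_const.mul h2).add contDiffAt_const).div
    ((contDiffAt_const.mul h2).sub contDiffAt_const) (three_mul_bandParam_ne hy')

theorem contDiffAt_sqrt_bandX (hy : y ∈ Set.Ioo (-edge b) (edge b)) :
    ContDiffAt ℝ n (fun y => √(bandX b y)) y := (contDiffAt_bandX hy).sqrt (bandX_pos hy).ne'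

theorem contDiffAt_bandSin (hy : y ∈ Set.Ioo (-edge b) (edge b)) :
    ContDiffAt ℝ n (bandSin b) y :=
  (contDiffAt_const.sub ((contDiffAt_bandX hy).div_const 9)).sqrt (by linarith [bandX_lt hy])

theorem contDiffAt_vertexEig (ε : Bool) (hy : y ∈ Set.Ioo (-edge b) (edge b)) :
    ContDiffAt ℝ n (vertexEig b ε) y :=
  contDiffAt_const.mul ((contDiffAt_sqrt_bandX hy).div_const 3)

theorem contDiffAt_cosMom (ε : Bool) (hy : y ∈ Set.Ioo (-edge b) (edge b)) :
    ContDiffAt ℝ n (cosMom b ε) y :=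
  contDiffAt_const.mul (((contDiffAt_sqrt_bandX hy).mul
    ((contDiffAt_bandX hy).sub contDiffAt_const)).div_const 6)

theorem contDiffAt_sinMom (hy : y ∈ Set.Ioo (-edge b) (edge b)) :
    ContDiffAt ℝ n (sinMom b) y :=
  ((contDiffAt_id.mul ((contDiffAt_const.mul (contDiffAt_bandX hy)).sub contDiffAt_const)).mul
    (contDiffAt_bandSin hy)).div_const 2

theorem ContDiffAt.complex_ofReal {f : ℝ → ℝ} (hf : ContDiffAt ℝ n f y) :
    ContDiffAt ℝ n (fun y => (f y : ℂ)) y :=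
  Complex.ofRealCLM.contDiff.contDiffAt.comp y hf

end Regularity

section Bloch

variable {σ : Sheet} {y : ℝ}

theorem norm_blochPhase (hy : y ∈ Set.Ioo (-edge σ.1) (edge σ.1)) : ‖blochPhase σ y‖ = 1 := by
  rw [blochPhase, Complex.norm_add_mul_I, mul_pow, sg_sq, one_mul, cosMom_sq_add _ hy,
    Real.sqrt_one]

theorem blochPhase_ne_zero (hy : y ∈ Set.Ioo (-edge σ.1) (edge σ.1)) : blochPhase σ y ≠ 0 := by
  rw [← norm_pos_iff, norm_blochPhase hy]; exact one_pos

theorem inv_eq_conj_of_norm_one {ω : ℂ} (h : ‖ω‖ = 1) : ω⁻¹ = starRingEnd ℂ ω := by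
  rw [Complex.inv_def, Complex.normSq_eq_norm_sq, h]; simp

theorem blochPhase_inv (hy : y ∈ Set.Ioo (-edge σ.1) (edge σ.1)) :
    (blochPhase σ y)⁻¹ = (cosMom σ.1 σ.2.1 y : ℂ) -
      ((sg σ.2.2 * sinMom σ.1 y : ℝ) : ℂ) * Complex.I := by
  rw [inv_eq_conj_of_norm_one (norm_blochPhase hy), blochPhase]
  simp [sub_eq_add_neg]

theorem blochPhase_add_inv (hy : y ∈ Set.Ioo (-edge σ.1) (edge σ.1)) :
    blochPhase σ y + (blochPhase σ y)⁻¹ = 2 * (cosMom σ.1 σ.2.1 y : ℂ) := by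
  rw [blochPhase_inv hy, blochPhase]; ring

theorem vertexEig_cubic_complex (hy : y ∈ Set.Ioo (-edge σ.1) (edge σ.1)) :
    9 * (vertexEig σ.1 σ.2.1 y : ℂ) ^ 3 - 7 * (vertexEig σ.1 σ.2.1 y : ℂ) =
      blochPhase σ y + (blochPhase σ y)⁻¹ := by
  rw [blochPhase_add_inv hy]
  exact_mod_cast vertexEig_cubic σ.2.1 hy

theorem eig_mul_invEig (hy : y ∈ Set.Ioo (-edge σ.1) (edge σ.1)) :
    eig σ y * invEig σ y = 1 := by
  have h : (vertexEig σ.1 σ.2.1 y : ℂ) ^ 2 + (bandSin σ.1 y : ℂ) ^ 2 = 1 := by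
    exact_mod_cast vertexEig_sq_add σ.2.1 hy
  have h2 : ((sg σ.2.2 : ℝ) : ℂ) ^ 2 = 1 := by exact_mod_cast sg_sq σ.2.2
  rw [eig, invEig]; push_cast
  linear_combination h + (bandSin σ.1 y : ℂ) ^ 2 * h2 -
    ((sg σ.2.2 : ℝ) : ℂ) ^ 2 * (bandSin σ.1 y : ℂ) ^ 2 * Complex.I_sq

theorem eig_add_invEig (σ : Sheet) (y : ℝ) :
    eig σ y + invEig σ y = 2 * (vertexEig σ.1 σ.2.1 y : ℂ) := by
  rw [eig, invEig]; ring

theorem conj_invEig (σ : Sheet) (y : ℝ) : starRingEnd ℂ (invEig σ y) = eig σ y := by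
  simp [eig, invEig]

theorem ampNorm_pos (hy : y ∈ Set.Ioo (-edge σ.1) (edge σ.1)) : 0 < ampNorm σ.1 y := by
  have h1 := bandX_norm_pos hy
  have h2 := bandSin_pos hy
  unfold ampNorm; positivity

theorem bandWeight_pos (hy : y ∈ Set.Ioo (-edge σ.1) (edge σ.1)) : 0 < bandWeight σ.1 y := by
  have h1 := ampNorm_pos hy
  have h2 := momDensity_pos hy
  unfold bandWeight; positivity

theorem ampNorm_eq (hy : y ∈ Set.Ioo (-edge σ.1) (edge σ.1)) :
    ampNorm σ.1 y = 2 * ((3 * vertexEig σ.1 σ.2.1 y ^ 2 - 1) *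
      (27 * vertexEig σ.1 σ.2.1 y ^ 2 - 7)) * bandSin σ.1 y ^ 2 := by
  rw [vertexEig_sq _ hy, ampNorm]; ring

/-- `ampNorm` is the sum of the squared moduli of the six cell components, and the phase has modulus
one. -/
theorem norm_amp_sq_le (hy : y ∈ Set.Ioo (-edge σ.1) (edge σ.1)) (e : ℤ × Fin 6) :
    ‖amp e σ y‖ ^ 2 ≤ ampNorm σ.1 y := by
  have hω := norm_blochPhase hy
  have h0 := blochPhase_ne_zero hy
  have hc := inv_eq_conj_of_norm_one hω
  have hsum := sum_coef_mul_coef (l₁ := vertexEig σ.1 σ.2.1 y) (ξ := eig σ y) (ζ := invEig σ y)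
    (mul_inv_cancel₀ h0) (vertexEig_cubic_complex hy)
  rw [vertexForm_self (mul_inv_cancel₀ h0) (vertexEig_cubic_complex hy), eig_mul_invEig hy,
    eig_add_invEig] at hsum
  have e1 : ∀ i, coef (vertexEig σ.1 σ.2.1 y) (blochPhase σ y)⁻¹ (blochPhase σ y) (eig σ y) i *
      coef (vertexEig σ.1 σ.2.1 y) (blochPhase σ y) (blochPhase σ y)⁻¹ (invEig σ y) i =
      ((‖coef (vertexEig σ.1 σ.2.1 y) (blochPhase σ y) (blochPhase σ y)⁻¹ (invEig σ y) i‖ ^ 2 : ℝ)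
        : ℂ) := fun i => by
    rw [← conj_coef hc.symm (by rw [hc, Complex.conj_conj]) (conj_invEig σ y), ← Complex.normSq_eq_norm_sq,
      Complex.normSq_eq_conj_mul_self]
  simp_rw [e1] at hsum
  have hval : ∑ i, ‖coef (vertexEig σ.1 σ.2.1 y) (blochPhase σ y) (blochPhase σ y)⁻¹
      (invEig σ y) i‖ ^ 2 = ampNorm σ.1 y := by
    rw [ampNorm_eq hy]
    have h3 := vertexEig_sq_add σ.2.1 hy
    have : ((∑ i, ‖coef (vertexEig σ.1 σ.2.1 y) (blochPhase σ y) (blochPhase σ y)⁻¹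
      (invEig σ y) i‖ ^ 2 : ℝ) : ℂ) = ((2 * ((3 * vertexEig σ.1 σ.2.1 y ^ 2 - 1) *
      (27 * vertexEig σ.1 σ.2.1 y ^ 2 - 7)) * bandSin σ.1 y ^ 2 : ℝ) : ℂ) := by
      rw [Complex.ofReal_sum, hsum, show bandSin σ.1 y ^ 2 = 1 - vertexEig σ.1 σ.2.1 y ^ 2 by
        linarith]
      push_cast; ring
    exact_mod_cast this
  rw [amp, norm_mul, norm_zpow, hω, one_zpow, one_mul, ← hval]
  exact Finset.single_le_sum (f := fun i => ‖coef (vertexEig σ.1 σ.2.1 y) (blochPhase σ y)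
    (blochPhase σ y)⁻¹ (invEig σ y) i‖ ^ 2) (fun i _ => by positivity) (Finset.mem_univ e.2)

theorem contDiffAt_blochPhase {n : WithTop ℕ∞} (hy : y ∈ Set.Ioo (-edge σ.1) (edge σ.1)) :
    ContDiffAt ℝ n (blochPhase σ) y :=
  (ContDiffAt.complex_ofReal (contDiffAt_cosMom _ hy)).add
    ((ContDiffAt.complex_ofReal (contDiffAt_const.mul (contDiffAt_sinMom hy))).mul
      contDiffAt_const)

theorem contDiffAt_invEig {n : WithTop ℕ∞} (hy : y ∈ Set.Ioo (-edge σ.1) (edge σ.1)) :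
    ContDiffAt ℝ n (invEig σ) y :=
  (ContDiffAt.complex_ofReal (contDiffAt_vertexEig _ hy)).sub
    ((ContDiffAt.complex_ofReal (contDiffAt_const.mul (contDiffAt_bandSin hy))).mul
      contDiffAt_const)

theorem contDiffAt_amp {n : WithTop ℕ∞} (hy : y ∈ Set.Ioo (-edge σ.1) (edge σ.1))
    (e : ℤ × Fin 6) : ContDiffAt ℝ n (amp e σ) y := by
  have h1 := contDiffAt_blochPhase (n := n) hy
  have h2 := contDiffAt_invEig (n := n) hy
  have h3 := ContDiffAt.complex_ofReal (contDiffAt_vertexEig (n := n) σ.2.1 hy)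
  have h4 : ContDiffAt ℝ n (fun y => (blochPhase σ y)⁻¹) y := h1.inv (blochPhase_ne_zero hy)
  have hz : ContDiffAt ℝ n (fun y => blochPhase σ y ^ e.1) y := by
    rcases Int.eq_nat_or_neg e.1 with ⟨k, hk | hk⟩
    · simp only [hk, zpow_natCast]; exact h1.pow k
    · simp only [hk, zpow_neg, zpow_natCast, ← inv_pow]; exact h4.pow k
  refine hz.mul ?_
  obtain ⟨j, i⟩ := e
  fin_cases i <;> simp only [coef, Fin.zero_eta, Fin.mk_one, Fin.reduceFinMk, Matrix.cons_val] <;>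
    fun_prop

theorem continuousAt_momDensity {b : Bool} (hy : y ∈ Set.Ioo (-edge b) (edge b)) :
    ContinuousAt (momDensity b) y := by
  have hx := (contDiffAt_bandX (n := 0) hy).continuousAt
  have hs := (contDiffAt_bandSin (n := 0) hy).continuousAt
  have h0 := bandX_pos hy
  have h1 := Real.sqrt_pos.2 h0
  have h2 := bandSin_pos hy
  unfold momDensity
  exact ContinuousAt.div (by fun_prop) (by fun_prop) (by positivity)

theorem continuousAt_bandWeight (hy : y ∈ Set.Ioo (-edge σ.1) (edge σ.1)) :
    ContinuousAt (bandWeight σ.1) y := by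
  have h1 := continuousAt_momDensity hy
  have h2 := (contDiffAt_bandX (n := 0) hy).continuousAt
  have h3 := (contDiffAt_bandSin (n := 0) hy).continuousAt
  have h4 := ampNorm_pos hy
  have h5 : ContinuousAt (ampNorm σ.1) y := by unfold ampNorm; fun_prop
  unfold bandWeight
  exact h1.div (continuousAt_const.mul h5) (by positivity)

end Bloch


/-! ### Orthonormality of the spectral waves, by substitution of the quasi-momentum. -/

/-- The contribution of a sheet to the inner product of two spectral waves. -/
def sheetTerm (e e' : ℤ × Fin 6) (σ : Sheet) (y : ℝ) : ℂ :=
  (bandWeight σ.1 y : ℂ) * (starRingEnd ℂ (amp e σ y) * amp e' σ y)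

/-- The sum over both signs of `sin θ` of the products of Bloch waves of two sites. -/
def pairSum (e e' : ℤ × Fin 6) (l s : ℝ) (ω : ℂ) : ℂ :=
  starRingEnd ℂ (ω ^ e.1) * ω ^ e'.1 *
    (starRingEnd ℂ (coef l ω ω⁻¹ (l - s * Complex.I) e.2) *
        coef l ω ω⁻¹ (l - s * Complex.I) e'.2 +
      starRingEnd ℂ (coef l ω ω⁻¹ (l + s * Complex.I) e.2) *
        coef l ω ω⁻¹ (l + s * Complex.I) e'.2)

/-- The density is singular at the edge of the band, but it is the modulus of the derivative of an
injective function with bounded range. -/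
theorem integrableOn_momDensity (b : Bool) : IntegrableOn (momDensity b) (Set.Ioo 0 (edge b)) := by
  have h := (integrableOn_image_iff_integrableOn_abs_deriv_smul (f := mom b true)
    (s := Set.Ioo 0 (edge b)) measurableSet_Ioo
    (fun y hy => (hasDerivAt_mom true hy).hasDerivWithinAt) (injOn_mom b true)
    (fun _ => (1 : ℝ))).1 (by
      rw [image_mom]
      refine integrableOn_const ?_
      cases b <;> simp [momRange])
  refine h.congr_fun (fun y hy => ?_) measurableSet_Ioo
  have := momDensity_pos (Ioo_zero_edge_subset b hy)
  simp [abs_of_pos this]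

theorem intervalIntegrable_momDensity (b : Bool) :
    IntervalIntegrable (momDensity b) volume (-edge b) (edge b) := by
  have h : IntervalIntegrable (momDensity b) volume 0 (edge b) :=
    (intervalIntegrable_iff_integrableOn_Ioo_of_le (edge_pos b).le).2 (integrableOn_momDensity b)
  have h' := h.comp_sub_left 0
  simp only [zero_sub, momDensity_neg, sub_zero] at h'
  have h2 : IntervalIntegrable (momDensity b) volume 0 (-edge b) := by simpa using h'
  exact h2.symm.trans h

theorem continuousOn_sheetTerm (e e' : ℤ × Fin 6) (σ : Sheet) :
    ContinuousOn (sheetTerm e e' σ) (Set.Ioo (-edge σ.1) (edge σ.1)) := fun y hy => by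
  have h1 := (contDiffAt_amp (n := 0) hy e).continuousAt
  have h2 := (contDiffAt_amp (n := 0) hy e').continuousAt
  have h3 : ContinuousAt (fun y => (bandWeight σ.1 y : ℂ)) y :=
    Complex.continuous_ofReal.continuousAt.comp (continuousAt_bandWeight hy)
  have h4 : ContinuousAt (fun y => starRingEnd ℂ (amp e σ y)) y :=
    Complex.continuous_conj.continuousAt.comp h1
  exact (h3.mul (h4.mul h2)).continuousWithinAt

/-- The weight divides by `ampNorm`, which dominates the product of two amplitudes; only the
integrable Jacobian remains. -/
theorem norm_sheetTerm_le (e e' : ℤ × Fin 6) {σ : Sheet} {y : ℝ}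
    (hy : y ∈ Set.Ioo (-edge σ.1) (edge σ.1)) :
    ‖sheetTerm e e' σ y‖ ≤ momDensity σ.1 y / (2 * Real.pi) := by
  have h0 := bandWeight_pos hy
  have hA := ampNorm_pos hy
  have h1 := norm_amp_sq_le hy e
  have h2 := norm_amp_sq_le hy e'
  have h3 : ‖amp e σ y‖ * ‖amp e' σ y‖ ≤ ampNorm σ.1 y := by
    nlinarith [sq_nonneg (‖amp e σ y‖ - ‖amp e' σ y‖)]
  rw [sheetTerm, norm_mul, norm_mul, RCLike.norm_conj, Complex.norm_real, Real.norm_of_nonneg h0.le]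
  calc _ ≤ bandWeight σ.1 y * ampNorm σ.1 y := by gcongr
    _ = _ := by rw [bandWeight]; field_simp

theorem intervalIntegrable_sheetTerm (e e' : ℤ × Fin 6) (σ : Sheet) :
    IntervalIntegrable (sheetTerm e e' σ) volume (-edge σ.1) (edge σ.1) := by
  have he := edge_pos σ.1
  have hle : -edge σ.1 ≤ edge σ.1 := by linarith
  rw [intervalIntegrable_iff_integrableOn_Ioo_of_le hle]
  have hm := (intervalIntegrable_iff_integrableOn_Ioo_of_le hle).1
    (intervalIntegrable_momDensity σ.1)
  refine Integrable.mono' (hm.div_const (2 * Real.pi))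
    ((continuousOn_sheetTerm e e' σ).aestronglyMeasurable measurableSet_Ioo) ?_
  filter_upwards [ae_restrict_mem measurableSet_Ioo] with y hy using norm_sheetTerm_le e e' hy

theorem blochPhase_neg (b ε η : Bool) (y : ℝ) :
    blochPhase (b, ε, !η) (-y) = blochPhase (b, ε, η) y := by
  cases η <;> simp [blochPhase, cosMom_neg, sinMom_neg]

theorem bandWeight_neg (b : Bool) (y : ℝ) : bandWeight b (-y) = bandWeight b y := by
  simp [bandWeight, ampNorm, momDensity_neg, bandX_neg, bandSin_neg]

/-- Reversing the velocity together with the sign of sin θ keeps the quasi-momentum. The pair thus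
collects both walk eigenvalues over one vertex eigenvalue. -/
theorem sheetTerm_add (e e' : ℤ × Fin 6) (b ε η : Bool) (y : ℝ) :
    sheetTerm e e' (b, ε, η) y + sheetTerm e e' (b, ε, !η) (-y) =
      (bandWeight b y : ℂ) *
        pairSum e e' (vertexEig b ε y) (bandSin b y) (blochPhase (b, ε, η) y) := by
  simp only [sheetTerm, amp, blochPhase_neg, bandWeight_neg, vertexEig_neg, pairSum, map_mul]
  have h : ∀ η, invEig (b, ε, η) y = (vertexEig b ε y : ℂ) - ((sg η * bandSin b y : ℝ) : ℂ) *
    Complex.I := fun η => rfl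
  have h' : ∀ η, invEig (b, ε, η) (-y) = (vertexEig b ε y : ℂ) -
      ((sg η * bandSin b y : ℝ) : ℂ) * Complex.I := fun η => by
    simp [invEig, vertexEig_neg, bandSin_neg]
  rw [h, h']
  cases η <;> simp <;> ring

/-- For y > 0 the factor 3x - 7, and with it `sinMom`, is negative on the inner band, so which sheet
carries exp(ik) depends on the band. The unordered pair of phases does not. -/
theorem add_phases {b : Bool} (ε : Bool) {y : ℝ} (hy : y ∈ Set.Ioo 0 (edge b)) (g : ℂ → ℂ) :
    g (blochPhase (b, ε, true) y) + g (blochPhase (b, ε, false) y) =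
      g (Complex.exp (mom b ε y * Complex.I)) + g (Complex.exp (-(mom b ε y * Complex.I))) := by
  have h := Ioo_zero_edge_subset b hy
  have hc := cosMom_sq_add ε h
  have h1 : Real.cos (mom b ε y) = cosMom b ε y :=
    Real.cos_arccos (by nlinarith [sq_nonneg (sinMom b y)]) (by nlinarith [sq_nonneg (sinMom b y)])
  have h2 : Real.sin (mom b ε y) = |sinMom b y| := by
    rw [mom, Real.sin_arccos, ← Real.sqrt_sq_eq_abs]; congr 1; linarith
  have e1 : Complex.exp (mom b ε y * Complex.I) =
      (cosMom b ε y : ℂ) + (|sinMom b y| : ℝ) * Complex.I := by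
    rw [Complex.exp_mul_I, ← Complex.ofReal_cos, ← Complex.ofReal_sin, h1, h2]
  have e2 : Complex.exp (-(mom b ε y * Complex.I)) =
      (cosMom b ε y : ℂ) - (|sinMom b y| : ℝ) * Complex.I := by
    rw [← neg_mul, Complex.exp_mul_I, Complex.cos_neg, Complex.sin_neg, ← Complex.ofReal_cos,
      ← Complex.ofReal_sin, h1, h2]; ring
  rw [e1, e2]
  rcases abs_cases (sinMom b y) with ⟨ha, -⟩ | ⟨ha, -⟩ <;> rw [ha]
  · simp [blochPhase, sub_eq_add_neg]
  · rw [add_comm]; simp [blochPhase]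

/-- The velocity in a half sheet with a given quasi-momentum. -/
def velocity (b ε : Bool) (k : ℝ) : ℝ := Function.invFunOn (mom b ε) (Set.Ioo 0 (edge b)) k

theorem velocity_mem {b ε : Bool} {k : ℝ} (hk : k ∈ momRange b ε) :
    velocity b ε k ∈ Set.Ioo 0 (edge b) := by
  rw [← image_mom] at hk; exact Function.invFunOn_mem hk

theorem mom_velocity {b ε : Bool} {k : ℝ} (hk : k ∈ momRange b ε) :
    mom b ε (velocity b ε k) = k := by
  rw [← image_mom] at hk; exact Function.invFunOn_eq hk

/-- The contribution of a band to the inner product of two spectral waves, as a density in the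
quasi-momentum. -/
def fibreTerm (e e' : ℤ × Fin 6) (b ε : Bool) (k : ℝ) : ℂ :=
  (2 * Real.pi : ℂ)⁻¹ * (((ampNorm b (velocity b ε k) : ℝ) : ℂ)⁻¹ *
    (pairSum e e' (vertexEig b ε (velocity b ε k)) (bandSin b (velocity b ε k))
        (Complex.exp (k * Complex.I)) +
      pairSum e e' (vertexEig b ε (velocity b ε k)) (bandSin b (velocity b ε k))
        (Complex.exp (-(k * Complex.I)))))

/-- The integrand of the substitution k = `mom b ε y`: the Jacobian cancels the factor `momDensity`
of the spectral weight, and the four terms are the two signs of sin θ at the two momenta ±k. -/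
theorem fibreTerm_mom (e e' : ℤ × Fin 6) {b : Bool} (ε : Bool) {y : ℝ}
    (hy : y ∈ Set.Ioo 0 (edge b)) :
    |-sg ε * momDensity b y| • fibreTerm e e' b ε (mom b ε y) =
      (sheetTerm e e' (b, ε, true) y + sheetTerm e e' (b, ε, false) (-y)) +
      (sheetTerm e e' (b, ε, false) y + sheetTerm e e' (b, ε, true) (-y)) := by
  have h := Ioo_zero_edge_subset b hy
  have hv : velocity b ε (mom b ε y) = y := (injOn_mom b ε).leftInvOn_invFunOn hy
  have h1 := sheetTerm_add e e' b ε true y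
  have h2 := sheetTerm_add e e' b ε false y
  simp only [Bool.not_true, Bool.not_false] at h1 h2
  rw [h1, h2, ← mul_add, add_phases ε hy (pairSum e e' (vertexEig b ε y) (bandSin b y)),
    fibreTerm, hv, neg_mul, abs_neg, abs_mul, abs_sg, one_mul, abs_of_pos (momDensity_pos h),
    Complex.real_smul, bandWeight]
  push_cast
  field_simp

theorem integrableOn_comp_reflection {f g : ℝ → ℂ} {V : ℝ} (hV : 0 ≤ V)
    (hf : IntervalIntegrable f volume (-V) V) (hg : IntervalIntegrable g volume (-V) V) :
    IntervalIntegrable (fun y => f y + g (-y)) volume 0 V ∧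
    (∫ y in (-V)..V, f y) + ∫ y in (-V)..V, g y =
      (∫ y in (0 : ℝ)..V, (f y + g (-y))) + ∫ y in (0 : ℝ)..V, (g y + f (-y)) := by
  have s1 : Set.uIcc 0 V ⊆ Set.uIcc (-V) V := by
    rw [Set.uIcc_of_le hV, Set.uIcc_of_le (by linarith)]
    exact Set.Icc_subset_Icc_left (by linarith)
  have s2 : Set.uIcc (-V) 0 ⊆ Set.uIcc (-V) V := by
    rw [Set.uIcc_of_le (by linarith), Set.uIcc_of_le (by linarith)]
    exact Set.Icc_subset_Icc_right (by linarith)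
  have hneg : ∀ {u : ℝ → ℂ}, IntervalIntegrable u volume (-V) V →
      IntervalIntegrable (fun y => u (-y)) volume 0 V := fun {u} hu => by
    have := (hu.mono_set s2).comp_sub_left 0
    simp only [zero_sub, neg_neg, neg_zero] at this
    exact this.symm
  have hint : ∀ {u : ℝ → ℂ}, IntervalIntegrable u volume (-V) V →
      ∫ y in (-V)..V, u y = (∫ y in (0 : ℝ)..V, u y) + ∫ y in (0 : ℝ)..V, u (-y) := fun {u} hu => by
    rw [← intervalIntegral.integral_add_adjacent_intervals (hu.mono_set s2) (hu.mono_set s1),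
      intervalIntegral.integral_comp_neg]
    simp [add_comm]
  refine ⟨(hf.mono_set s1).add (hneg hg), ?_⟩
  rw [hint hf, hint hg, intervalIntegral.integral_add (hf.mono_set s1) (hneg hg),
    intervalIntegral.integral_add (hg.mono_set s1) (hneg hf)]
  ring

theorem integral_sheetTerm_add (e e' : ℤ × Fin 6) (b ε : Bool) :
    IntegrableOn (fibreTerm e e' b ε) (momRange b ε) ∧
    (∫ y in (-edge b)..edge b, sheetTerm e e' (b, ε, true) y) +
      ∫ y in (-edge b)..edge b, sheetTerm e e' (b, ε, false) y =
      ∫ k in momRange b ε, fibreTerm e e' b ε k := by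
  have he := (edge_pos b).le
  have ht := intervalIntegrable_sheetTerm e e' (b, ε, true)
  have hf := intervalIntegrable_sheetTerm e e' (b, ε, false)
  obtain ⟨i1, h1⟩ := integrableOn_comp_reflection he ht hf
  obtain ⟨i2, -⟩ := integrableOn_comp_reflection he hf ht
  have hder : ∀ y ∈ Set.Ioo 0 (edge b), HasDerivWithinAt (mom b ε) (-sg ε * momDensity b y)
      (Set.Ioo 0 (edge b)) y := fun y hy => (hasDerivAt_mom ε hy).hasDerivWithinAt
  have hcongr : Set.EqOn (fun y => |-sg ε * momDensity b y| • fibreTerm e e' b ε (mom b ε y))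
      (fun y => (sheetTerm e e' (b, ε, true) y + sheetTerm e e' (b, ε, false) (-y)) +
        (sheetTerm e e' (b, ε, false) y + sheetTerm e e' (b, ε, true) (-y)))
      (Set.Ioo 0 (edge b)) := fun y hy => fibreTerm_mom e e' ε hy
  constructor
  · rw [← image_mom, integrableOn_image_iff_integrableOn_abs_deriv_smul measurableSet_Ioo hder
      (injOn_mom b ε), integrableOn_congr_fun hcongr measurableSet_Ioo,
      ← intervalIntegrable_iff_integrableOn_Ioo_of_le he]
    exact i1.add i2
  · rw [h1, ← intervalIntegral.integral_add i1 i2, ← image_mom,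
      integral_image_eq_integral_abs_deriv_smul measurableSet_Ioo hder (injOn_mom b ε),
      setIntegral_congr_fun measurableSet_Ioo hcongr, intervalIntegral.integral_of_le he,
      integral_Ioc_eq_integral_Ioo]

/-- Completeness of the fibre eigenvectors, `sum_conj_coef_mul_coef`, at exp(ik) and exp(-ik). The
three branches over k are both signs of the outer band and the one sign of the inner band whose
range contains k. -/
theorem sum_fibreTerm (e e' : ℤ × Fin 6) (ε : Bool) {k : ℝ} (hk : k ∈ momRange false ε) :
    fibreTerm e e' true true k + fibreTerm e e' true false k + fibreTerm e e' false ε k =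
      if e.2 = e'.2 then (2 * Real.pi : ℂ)⁻¹ * (2 * Complex.cos ((e'.1 - e.1 : ℤ) * k)) else 0 := by
  have hk' : ∀ ε', k ∈ momRange true ε' := fun ε' => by
    have hp := Real.pi_pos
    cases ε <;> simp only [momRange, cond_true, cond_false, Set.mem_Ioo] at hk ⊢ <;>
      constructor <;> linarith
  set B : Fin 3 → Bool := ![true, true, false] with hB
  set E : Fin 3 → Bool := ![true, false, ε] with hE
  have hmem : ∀ a, k ∈ momRange (B a) (E a) := by
    intro a; fin_cases a
    · exact hk' true
    · exact hk' false
    · exact hk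
  set Y : Fin 3 → ℝ := fun a => velocity (B a) (E a) k with hY
  have hYm : ∀ a, Y a ∈ Set.Ioo (-edge (B a)) (edge (B a)) := fun a =>
    Ioo_zero_edge_subset _ (velocity_mem (hmem a))
  set l : Fin 3 → ℝ := fun a => vertexEig (B a) (E a) (Y a) with hl
  set s : Fin 3 → ℝ := fun a => bandSin (B a) (Y a) with hs
  have hcos : ∀ a, cosMom (B a) (E a) (Y a) = Real.cos k := fun a => by
    have h := mom_velocity (hmem a)
    rw [← h, mom, Real.cos_arccos]
    · nlinarith [cosMom_sq_add (E a) (hYm a), sq_nonneg (sinMom (B a) (Y a))]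
    · nlinarith [cosMom_sq_add (E a) (hYm a), sq_nonneg (sinMom (B a) (Y a))]
  have hcub : ∀ ω : ℂ, ω + ω⁻¹ = 2 * Complex.cos k → ∀ a,
      ((9 * l a ^ 3 - 7 * l a : ℝ) : ℂ) = ω + ω⁻¹ := fun ω hω a => by
    rw [hω, hl, vertexEig_cubic (E a) (hYm a), hcos a]; push_cast; rfl
  have l0 : 0 < l 0 ∧ 4 / 9 ≤ l 0 ^ 2 := by
    have hx := bandX_true_mem (hYm 0)
    have hsq := vertexEig_sq (E 0) (hYm 0)
    refine ⟨?_, ?_⟩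
    · have := Real.sqrt_pos.2 (bandX_pos (hYm 0))
      simp only [hl, vertexEig, hE, Matrix.cons_val, sg_true]; simp only [hB, Matrix.cons_val] at this
      simpa [hB] using this
    · simp only [hl]; rw [hsq]; have := hx.1; simp only [hB, Matrix.cons_val]; linarith
  have l1 : l 1 < 0 ∧ 4 / 9 ≤ l 1 ^ 2 := by
    have hx := bandX_true_mem (hYm 1)
    have hsq := vertexEig_sq (E 1) (hYm 1)
    refine ⟨?_, ?_⟩
    · have := Real.sqrt_pos.2 (bandX_pos (hYm 1))
      simp only [hl, vertexEig, hE, Matrix.cons_val, sg_false]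
      simp only [hB, Matrix.cons_val] at this ⊢
      linarith
    · simp only [hl]; rw [hsq]; have := hx.1; simp only [hB, Matrix.cons_val]; linarith
  have l2 : l 2 ^ 2 ≤ 1 / 9 := by
    have hx := bandX_false_mem (hYm 2)
    have hsq := vertexEig_sq (E 2) (hYm 2)
    simp only [hl]; rw [hsq]; have := hx.2; simp only [hB, Matrix.cons_val]; linarith
  -- The three eigenvalues are separated: one is at least 2/3, one at most -2/3, and one has modulus
  -- at most 1/3.
  have hinj : Function.Injective l := by
    intro a a' haa
    fin_cases a <;> fin_cases a' <;> first | rfl | (exfalso; simp at haa; nlinarith [l0.1, l0.2, l1.1, l1.2, l2])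
  have hsq : ∀ a, l a ^ 2 + s a ^ 2 = 1 := fun a => vertexEig_sq_add (E a) (hYm a)
  have hs0 : ∀ a, s a ≠ 0 := fun a => (bandSin_pos (hYm a)).ne'
  have hN : ∀ a, 0 < (3 * l a ^ 2 - 1) * (27 * l a ^ 2 - 7) := fun a => by
    have := bandX_norm_pos (hYm a)
    simp only [hl]; rw [vertexEig_sq _ (hYm a)]; nlinarith
  have hampN : ∀ a, ampNorm (B a) (Y a) =
      2 * ((3 * l a ^ 2 - 1) * (27 * l a ^ 2 - 7)) * s a ^ 2 := fun a =>
    ampNorm_eq (σ := (B a, E a, true)) (hYm a)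
  have key : ∀ ω : ℂ, ‖ω‖ = 1 → ω + ω⁻¹ = 2 * Complex.cos k →
      ∑ a, ((ampNorm (B a) (Y a) : ℝ) : ℂ)⁻¹ * pairSum e e' (l a) (s a) ω =
        starRingEnd ℂ (ω ^ e.1) * ω ^ e'.1 * if e.2 = e'.2 then 1 else 0 := fun ω h1 h2 => by
    rw [← sum_conj_coef_mul_coef l s ω h1 (hcub ω h2) hinj hsq hs0 hN e.2 e'.2, Finset.mul_sum]
    refine Finset.sum_congr rfl fun a _ => ?_
    rw [hampN, pairSum]; ring
  have n1 : ‖Complex.exp (k * Complex.I)‖ = 1 := Complex.norm_exp_ofReal_mul_I k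
  have n2 : ‖Complex.exp (-(k * Complex.I))‖ = 1 := by
    rw [Complex.exp_neg, norm_inv, n1, inv_one]
  have s1 : Complex.exp (k * Complex.I) + (Complex.exp (k * Complex.I))⁻¹ = 2 * Complex.cos k := by
    rw [← Complex.exp_neg, Complex.cos, neg_mul]; ring
  have s2 : Complex.exp (-(k * Complex.I)) + (Complex.exp (-(k * Complex.I)))⁻¹ =
      2 * Complex.cos k := by
    rw [← Complex.exp_neg, neg_neg, Complex.cos, neg_mul]; ring
  have e1 := key _ n1 s1
  have e2 := key _ n2 s2
  have hph : ∀ ω : ℂ, ‖ω‖ = 1 → starRingEnd ℂ (ω ^ e.1) * ω ^ e'.1 = ω ^ (e'.1 - e.1) := by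
    intro ω hω
    have h0 : ω ≠ 0 := by rintro rfl; simp at hω
    rw [map_zpow₀, ← inv_eq_conj_of_norm_one hω, inv_zpow', ← zpow_add₀ h0]; congr 1; ring
  rw [hph _ n1, ← Complex.exp_int_mul] at e1
  rw [hph _ n2, ← Complex.exp_int_mul] at e2
  have e3 : fibreTerm e e' true true k + fibreTerm e e' true false k + fibreTerm e e' false ε k =
      (2 * Real.pi : ℂ)⁻¹ * (∑ a, ((ampNorm (B a) (Y a) : ℝ) : ℂ)⁻¹ *
        pairSum e e' (l a) (s a) (Complex.exp (k * Complex.I)) +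
        ∑ a, ((ampNorm (B a) (Y a) : ℝ) : ℂ)⁻¹ *
        pairSum e e' (l a) (s a) (Complex.exp (-(k * Complex.I)))) := by
    simp only [Fin.sum_univ_three, fibreTerm, hB, hY, hl, hs, hE, Matrix.cons_val]
    ring
  rw [e3, e1, e2]
  split_ifs
  · rw [Complex.cos]; ring_nf
  · simp

theorem integral_cos_int (d : ℤ) :
    ∫ k in (0 : ℝ)..Real.pi, (2 * Real.pi : ℂ)⁻¹ * (2 * Complex.cos ((d : ℤ) * k)) =
      if d = 0 then 1 else 0 := by
  have hp : (Real.pi : ℂ) ≠ 0 := by exact_mod_cast Real.pi_ne_zero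
  split_ifs with h
  · subst h
    simp
  · have hd : (d : ℂ) ≠ 0 := by exact_mod_cast h
    simp only [intervalIntegral.integral_const_mul]
    rw [integral_cos_mul_complex hd]
    simp [Complex.sin_int_mul_pi]

/-- After the substitution, completeness in each fibre leaves the Fourier integral of cos((m' - m)k)
over (0, π), where m and m' are the cell labels. -/
theorem sum_integral_sheetTerm (e e' : ℤ × Fin 6) :
    ∑ σ : Sheet, ∫ y in (-edge σ.1)..edge σ.1, sheetTerm e e' σ y = if e = e' then 1 else 0 := by
  simp only [Fintype.sum_prod_type, Fintype.sum_bool]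
  obtain ⟨i1, h1⟩ := integral_sheetTerm_add e e' true true
  obtain ⟨i2, h2⟩ := integral_sheetTerm_add e e' true false
  obtain ⟨i3, h3⟩ := integral_sheetTerm_add e e' false true
  obtain ⟨i4, h4⟩ := integral_sheetTerm_add e e' false false
  rw [h1, h2, h3, h4]
  have hp := Real.pi_pos
  have hp2 : (0 : ℝ) ≤ Real.pi / 2 := by linarith
  have hp3 : Real.pi / 2 ≤ Real.pi := by linarith
  simp only [momRange, cond_true, cond_false] at i1 i2 i3 i4 ⊢
  simp only [← integral_Ioc_eq_integral_Ioo, ← intervalIntegral.integral_of_le hp.le,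
    ← intervalIntegral.integral_of_le hp2, ← intervalIntegral.integral_of_le hp3]
  rw [← intervalIntegrable_iff_integrableOn_Ioo_of_le hp.le] at i1 i2
  rw [← intervalIntegrable_iff_integrableOn_Ioo_of_le hp3] at i3
  rw [← intervalIntegrable_iff_integrableOn_Ioo_of_le hp2] at i4
  have sl : Set.uIcc 0 (Real.pi / 2) ⊆ Set.uIcc 0 Real.pi := by
    rw [Set.uIcc_of_le hp2, Set.uIcc_of_le hp.le]; exact Set.Icc_subset_Icc_right hp3
  have sr : Set.uIcc (Real.pi / 2) Real.pi ⊆ Set.uIcc 0 Real.pi := by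
    rw [Set.uIcc_of_le hp3, Set.uIcc_of_le hp.le]; exact Set.Icc_subset_Icc_left hp2
  have a1 := i1.mono_set sl
  have b1 := i1.mono_set sr
  have a2 := i2.mono_set sl
  have b2 := i2.mono_set sr
  -- The cut at π/2 is forced by the inner band, which changes its half sheet there.
  have hsplit : ((∫ k in (0 : ℝ)..Real.pi, fibreTerm e e' true true k) +
      ∫ k in (0 : ℝ)..Real.pi, fibreTerm e e' true false k) +
      ((∫ k in (Real.pi / 2)..Real.pi, fibreTerm e e' false true k) +
        ∫ k in (0 : ℝ)..(Real.pi / 2), fibreTerm e e' false false k) =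
      (∫ k in (0 : ℝ)..(Real.pi / 2), (fibreTerm e e' true true k + fibreTerm e e' true false k +
        fibreTerm e e' false false k)) +
      ∫ k in (Real.pi / 2)..Real.pi, (fibreTerm e e' true true k + fibreTerm e e' true false k +
        fibreTerm e e' false true k) := by
    rw [intervalIntegral.integral_add (a1.add a2) i4, intervalIntegral.integral_add a1 a2,
      intervalIntegral.integral_add (b1.add b2) i3, intervalIntegral.integral_add b1 b2,
      ← intervalIntegral.integral_add_adjacent_intervals a1 b1,
      ← intervalIntegral.integral_add_adjacent_intervals a2 b2]
    ring
  rw [hsplit]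
  set T : ℝ → ℂ := fun k => if e.2 = e'.2 then
    (2 * Real.pi : ℂ)⁻¹ * (2 * Complex.cos ((e'.1 - e.1 : ℤ) * k)) else 0 with hT
  have hTc : Continuous T := by
    simp only [hT]; split_ifs <;> fun_prop
  have c1 : ∫ k in (0 : ℝ)..(Real.pi / 2), (fibreTerm e e' true true k +
      fibreTerm e e' true false k + fibreTerm e e' false false k) =
      ∫ k in (0 : ℝ)..(Real.pi / 2), T k := by
    rw [intervalIntegral.integral_of_le hp2, intervalIntegral.integral_of_le hp2,
      integral_Ioc_eq_integral_Ioo, integral_Ioc_eq_integral_Ioo]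
    exact setIntegral_congr_fun measurableSet_Ioo fun k hk => sum_fibreTerm e e' false hk
  have c2 : ∫ k in (Real.pi / 2)..Real.pi, (fibreTerm e e' true true k +
      fibreTerm e e' true false k + fibreTerm e e' false true k) =
      ∫ k in (Real.pi / 2)..Real.pi, T k := by
    rw [intervalIntegral.integral_of_le hp3, intervalIntegral.integral_of_le hp3,
      integral_Ioc_eq_integral_Ioo, integral_Ioc_eq_integral_Ioo]
    exact setIntegral_congr_fun measurableSet_Ioo fun k hk => sum_fibreTerm e e' true hk
  rw [c1, c2, intervalIntegral.integral_add_adjacent_intervals (hTc.intervalIntegrable _ _)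
    (hTc.intervalIntegrable _ _)]
  obtain ⟨m, i⟩ := e
  obtain ⟨n, j⟩ := e'
  simp only [hT, Prod.mk.injEq]
  by_cases hij : i = j
  · simp only [hij, if_true, and_true]
    rw [integral_cos_int]
    simp [sub_eq_zero, eq_comm]
  · simp [hij]


/-! ### The spectral transform and multiplication by the velocity. -/

/-- The Hilbert space of the line walk. -/
abbrev LineSpace : Type := lp (fun _ : ℤ × Fin 6 => ℂ) 2

/-- The space of finitely supported states of the line walk. -/
abbrev FiniteState : Type := (ℤ × Fin 6) →₀ ℂ

/-- The spectral space. -/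
abbrev SpectralSpace : Type := Lp (EuclideanSpace ℂ Sheet) 2 (volume : Measure ℝ)

theorem wave_apply (e : ℤ × Fin 6) (y : ℝ) (σ : Sheet) :
    wave e y σ = (Set.Ioo (-edge σ.1) (edge σ.1)).indicator
      (fun y => ((√(bandWeight σ.1 y) : ℝ) : ℂ) * amp e σ y) y := by
  simp only [wave, Set.indicator_apply]

theorem inner_wave (e e' : ℤ × Fin 6) (y : ℝ) :
    inner ℂ (wave e y) (wave e' y) = ∑ σ : Sheet,
      (Set.Ioo (-edge σ.1) (edge σ.1)).indicator (sheetTerm e e' σ) y := by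
  rw [PiLp.inner_apply]
  refine Finset.sum_congr rfl fun σ _ => ?_
  rw [wave_apply, wave_apply]
  by_cases hy : y ∈ Set.Ioo (-edge σ.1) (edge σ.1)
  · simp only [Set.indicator_of_mem hy, sheetTerm, RCLike.inner_apply, map_mul, Complex.conj_ofReal]
    have h : ((√(bandWeight σ.1 y) : ℝ) : ℂ) * ((√(bandWeight σ.1 y) : ℝ) : ℂ) =
        (bandWeight σ.1 y : ℂ) := by
      rw [← Complex.ofReal_mul, Real.mul_self_sqrt (bandWeight_pos hy).le]
    rw [← h]; ring
  · simp [Set.indicator_of_notMem hy]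

theorem integrableOn_sheetTerm (e e' : ℤ × Fin 6) (σ : Sheet) :
    IntegrableOn (sheetTerm e e' σ) (Set.Ioo (-edge σ.1) (edge σ.1)) :=
  (intervalIntegrable_iff_integrableOn_Ioo_of_le (by linarith [edge_pos σ.1])).1
    (intervalIntegrable_sheetTerm e e' σ)

theorem integrable_inner_wave (e e' : ℤ × Fin 6) :
    Integrable fun y => inner ℂ (wave e y) (wave e' y) := by
  simp only [inner_wave]
  exact integrable_finsetSum _ fun σ _ =>
    (integrable_indicator_iff measurableSet_Ioo).2 (integrableOn_sheetTerm e e' σ)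

theorem integral_inner_wave (e e' : ℤ × Fin 6) :
    ∫ y, inner ℂ (wave e y) (wave e' y) = if e = e' then 1 else 0 := by
  simp only [inner_wave]
  rw [integral_finsetSum _ fun σ _ =>
    (integrable_indicator_iff measurableSet_Ioo).2 (integrableOn_sheetTerm e e' σ),
    ← sum_integral_sheetTerm]
  refine Finset.sum_congr rfl fun σ _ => ?_
  rw [integral_indicator measurableSet_Ioo,
    intervalIntegral.integral_of_le (by linarith [edge_pos σ.1]), integral_Ioc_eq_integral_Ioo]

theorem aestronglyMeasurable_wave (e : ℤ × Fin 6) :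
    AEStronglyMeasurable (wave e) (volume : Measure ℝ) := by
  have h : AEMeasurable (fun y => WithLp.ofLp (wave e y)) (volume : Measure ℝ) := by
    refine aemeasurable_pi_iff.2 fun σ => ?_
    simp only [wave_apply]
    refine AEStronglyMeasurable.aemeasurable
      ((aestronglyMeasurable_indicator_iff measurableSet_Ioo).2
        (ContinuousOn.aestronglyMeasurable (fun y hy => ?_) measurableSet_Ioo))
    have h1 := (contDiffAt_amp (n := 0) hy e).continuousAt
    have h2 : ContinuousAt (fun y => ((√(bandWeight σ.1 y) : ℝ) : ℂ)) y :=
      Complex.continuous_ofReal.continuousAt.comp (continuousAt_bandWeight hy).sqrt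
    exact (h2.mul h1).continuousWithinAt
  exact ((WithLp.measurable_toLp 2 (Sheet → ℂ)).comp_aemeasurable h).aestronglyMeasurable

theorem memLp_wave (e : ℤ × Fin 6) : MemLp (wave e) 2 (volume : Measure ℝ) := by
  rw [memLp_two_iff_integrable_sq_norm (aestronglyMeasurable_wave e)]
  have h := (integrable_inner_wave e e).re
  simpa only [inner_self_eq_norm_sq] using h

/-- The spectral wave of a site as an element of the spectral space. -/
def spectralWave (e : ℤ × Fin 6) : SpectralSpace := (memLp_wave e).toLp

theorem inner_spectralWave (e e' : ℤ × Fin 6) :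
    inner ℂ (spectralWave e) (spectralWave e') = if e = e' then 1 else 0 := by
  rw [L2.inner_def, ← integral_inner_wave]
  refine integral_congr_ae ?_
  filter_upwards [(memLp_wave e).coeFn_toLp, (memLp_wave e').coeFn_toLp] with y h1 h2
  rw [spectralWave, spectralWave, h1, h2]

theorem orthonormal_spectralWave : Orthonormal ℂ spectralWave :=
  orthonormal_iff_ite.2 inner_spectralWave

/-- The spectral transform, an isometry. -/
def spectral : LineSpace →ₗᵢ[ℂ] SpectralSpace :=
  orthonormal_spectralWave.orthogonalFamily.linearIsometry

theorem spectral_single (e : ℤ × Fin 6) : spectral (lp.single 2 e 1) = spectralWave e := by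
  rw [spectral, OrthogonalFamily.linearIsometry_apply_single]
  simp

/-- The inclusion of the finitely supported states. -/
def toLine : FiniteState →ₗ[ℂ] LineSpace :=
  Finsupp.linearCombination ℂ fun e => lp.single 2 e (1 : ℂ)

theorem toLine_apply (χ : FiniteState) (e : ℤ × Fin 6) : toLine χ e = χ e := by
  induction χ using Finsupp.induction_linear with
  | zero => simp
  | add f g hf hg => rw [map_add, lp.coeFn_add, Pi.add_apply, hf, hg, Finsupp.add_apply]
  | single e' a =>
    rw [toLine, Finsupp.linearCombination_single, lp.coeFn_smul, Pi.smul_apply, lp.single_apply,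
      Finsupp.single_apply]
    by_cases h : e' = e
    · subst h; simp
    · simp [h]

/-- The unnormalized Bloch transform of a finitely supported state. -/
def bloch (σ : Sheet) (y : ℝ) : FiniteState →ₗ[ℂ] ℂ :=
  Finsupp.linearCombination ℂ fun e => amp e σ y

/-- The spectral transform of a finitely supported state, as a function. -/
def waveSum (χ : FiniteState) (y : ℝ) : EuclideanSpace ℂ Sheet :=
  WithLp.toLp 2 fun σ => if y ∈ Set.Ioo (-edge σ.1) (edge σ.1) then
    ((√(bandWeight σ.1 y) : ℝ) : ℂ) * bloch σ y χ else 0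

theorem waveSum_apply (χ : FiniteState) (y : ℝ) (σ : Sheet) :
    waveSum χ y σ = if y ∈ Set.Ioo (-edge σ.1) (edge σ.1) then
      ((√(bandWeight σ.1 y) : ℝ) : ℂ) * bloch σ y χ else 0 := rfl

theorem waveSum_add (χ χ' : FiniteState) (y : ℝ) :
    waveSum (χ + χ') y = waveSum χ y + waveSum χ' y := by
  ext σ
  simp only [PiLp.add_apply, waveSum_apply, map_add]
  split_ifs <;> simp [mul_add]

theorem waveSum_smul (a : ℂ) (χ : FiniteState) (y : ℝ) :
    waveSum (a • χ) y = a • waveSum χ y := by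
  ext σ
  simp only [PiLp.smul_apply, waveSum_apply, map_smul, smul_eq_mul]
  split_ifs <;> ring

theorem waveSum_single (e : ℤ × Fin 6) (y : ℝ) : waveSum (Finsupp.single e 1) y = wave e y := by
  ext σ
  simp [waveSum_apply, wave, bloch]

theorem spectral_toLine (χ : FiniteState) : spectral (toLine χ) =ᵐ[volume] waveSum χ := by
  induction χ using Finsupp.induction_linear with
  | zero =>
    have h : waveSum 0 = 0 := by ext y σ; simp [waveSum_apply]
    rw [map_zero, map_zero, h]; exact Lp.coeFn_zero _ _ _
  | add f g hf hg =>
    rw [map_add, map_add]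
    filter_upwards [Lp.coeFn_add (spectral (toLine f)) (spectral (toLine g)), hf, hg] with y h h1 h2
    rw [h, Pi.add_apply, h1, h2, waveSum_add]
  | single e a =>
    rw [toLine, Finsupp.linearCombination_single, map_smul, spectral_single]
    filter_upwards [Lp.coeFn_smul a (spectralWave e), (memLp_wave e).coeFn_toLp] with y h h1
    rw [h, Pi.smul_apply, spectralWave, h1, ← waveSum_single, ← waveSum_smul]
    simp

theorem memLp_waveSum (χ : FiniteState) : MemLp (waveSum χ) 2 (volume : Measure ℝ) :=
  (memLp_congr_ae (spectral_toLine χ)).1 (Lp.memLp _)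

theorem waveSum_eq_zero {χ : FiniteState} {y : ℝ} (hy : 1 ≤ |y|) : waveSum χ y = 0 := by
  ext σ
  rw [waveSum_apply, if_neg]
  · rfl
  · intro h
    have := abs_lt.2 h
    linarith [edge_lt_one σ.1]

theorem memLp_pow_waveSum (n : ℕ) (χ : FiniteState) :
    MemLp (fun y : ℝ => ((y ^ n : ℝ) : ℂ) • waveSum χ y) 2 (volume : Measure ℝ) := by
  have hc : Continuous fun y : ℝ => ((y ^ n : ℝ) : ℂ) := by fun_prop
  refine (memLp_waveSum χ).mono (hc.aestronglyMeasurable.smul (memLp_waveSum χ).1) (Eventually.of_forall fun y => ?_)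
  rcases le_or_gt 1 |y| with h | h
  · simp [waveSum_eq_zero h]
  · rw [norm_smul, Complex.norm_real, norm_pow, Real.norm_eq_abs]
    exact mul_le_of_le_one_left (norm_nonneg _) (pow_le_one₀ (abs_nonneg y) h.le)

/-- The spectral transform of a finitely supported state multiplied by a power of the velocity. -/
def powWave (n : ℕ) (χ : FiniteState) : SpectralSpace := (memLp_pow_waveSum n χ).toLp

theorem powWave_zero (χ : FiniteState) : powWave 0 χ = spectral (toLine χ) := by
  refine Lp.ext ?_
  filter_upwards [(memLp_pow_waveSum 0 χ).coeFn_toLp, spectral_toLine χ] with y h1 h2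
  rw [powWave, h1, h2]; simp

/-- Multiplication by y is a contraction here, because both bands lie in |y| < 1. -/
theorem norm_powWave_succ_sub_le (n : ℕ) (χ χ' : FiniteState) :
    ‖powWave (n + 1) χ - powWave 1 χ'‖ ≤ ‖powWave n χ - powWave 0 χ'‖ := by
  refine Lp.norm_le_norm_of_ae_le ?_
  filter_upwards [Lp.coeFn_sub (powWave (n + 1) χ) (powWave 1 χ'),
    Lp.coeFn_sub (powWave n χ) (powWave 0 χ'), (memLp_pow_waveSum n χ).coeFn_toLp,
    (memLp_pow_waveSum (n + 1) χ).coeFn_toLp, (memLp_pow_waveSum 0 χ').coeFn_toLp,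
    (memLp_pow_waveSum 1 χ').coeFn_toLp] with y e1 e2 h1 h2 h3 h4
  rw [e1, e2, Pi.sub_apply, Pi.sub_apply]
  simp only [powWave]
  rw [h1, h2, h3, h4]
  rcases le_or_gt 1 |y| with h | h
  · simp [waveSum_eq_zero h]
  · have : ((y ^ (n + 1) : ℝ) : ℂ) • waveSum χ y - ((y ^ 1 : ℝ) : ℂ) • waveSum χ' y =
        (y : ℂ) • (((y ^ n : ℝ) : ℂ) • waveSum χ y - ((y ^ 0 : ℝ) : ℂ) • waveSum χ' y) := by
      rw [smul_sub, smul_smul, smul_smul]; push_cast; ring_nf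
    rw [this, norm_smul, Complex.norm_real, Real.norm_eq_abs]
    exact mul_le_of_le_one_left (norm_nonneg _) h.le

theorem inner_powWave (n : ℕ) (χ : FiniteState) :
    inner ℂ (spectral (toLine χ)) (powWave n χ) = ((∫ y : ℝ, y ^ n * ‖waveSum χ y‖ ^ 2 : ℝ) : ℂ) := by
  rw [L2.inner_def, ← integral_complex_ofReal]
  refine integral_congr_ae ?_
  filter_upwards [spectral_toLine χ, (memLp_pow_waveSum n χ).coeFn_toLp] with y h1 h2
  rw [h1, powWave, h2, inner_smul_right, inner_self_eq_norm_sq_to_K]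
  push_cast; rfl


/-! ### The line walk on square-summable states -/

/-- Arc reversal. -/
def rev (e : ℤ × Fin 6) : ℤ × Fin 6 :=
  ![(e.1, 3), (e.1, 2), (e.1, 1), (e.1, 0), (e.1 + 1, 5), (e.1 - 1, 4)] e.2

theorem rev_rev (e : ℤ × Fin 6) : rev (rev e) = e := by
  obtain ⟨j, i⟩ := e
  fin_cases i <;> simp [rev]

/-- Arc reversal as a permutation. -/
def revEquiv : Equiv.Perm (ℤ × Fin 6) := ⟨rev, rev, rev_rev, rev_rev⟩

/-- The local coins, acting in each cell. -/
def coin (ψ : ℤ × Fin 6 → ℂ) (e : ℤ × Fin 6) : ℂ :=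
  ![1 / 3 * ψ (e.1, 0) + 2 * (√2 : ℝ) / 3 * ψ (e.1, 5), ψ (e.1, 3),
    1 / 3 * ψ (e.1, 2) + 2 * (√2 : ℝ) / 3 * ψ (e.1, 4), ψ (e.1, 1),
    2 * (√2 : ℝ) / 3 * ψ (e.1, 2) - 1 / 3 * ψ (e.1, 4),
    2 * (√2 : ℝ) / 3 * ψ (e.1, 0) - 1 / 3 * ψ (e.1, 5)] e.2

/-- One step of the line walk. -/
def evolFun (ψ : ℤ × Fin 6 → ℂ) (e : ℤ × Fin 6) : ℂ := coin ψ (rev e)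

/-- The 2 × 2 coin is a reflection: (1/3)² + (2√2/3)² = 1. -/
theorem norm_sq_coin_pair (a b : ℂ) :
    ‖1 / 3 * a + 2 * (√2 : ℝ) / 3 * b‖ ^ 2 + ‖2 * (√2 : ℝ) / 3 * a - 1 / 3 * b‖ ^ 2 =
      ‖a‖ ^ 2 + ‖b‖ ^ 2 := by
  have h : √2 * √2 = 2 := Real.mul_self_sqrt (by norm_num)
  have e1 : (1 / 3 * a + 2 * (√2 : ℝ) / 3 * b) =
      ((1 / 3 : ℝ) : ℂ) * a + ((2 * √2 / 3 : ℝ) : ℂ) * b := by push_cast; ring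
  have e2 : (2 * (√2 : ℝ) / 3 * a - 1 / 3 * b) =
      ((2 * √2 / 3 : ℝ) : ℂ) * a - ((1 / 3 : ℝ) : ℂ) * b := by push_cast; ring
  rw [e1, e2]
  simp only [← Complex.normSq_eq_norm_sq, Complex.normSq_apply, Complex.add_re, Complex.add_im,
    Complex.sub_re, Complex.sub_im, Complex.re_ofReal_mul, Complex.im_ofReal_mul]
  linear_combination (4 / 9 * (a.re ^ 2 + a.im ^ 2 + b.re ^ 2 + b.im ^ 2)) * h

theorem sum_norm_sq_coin (ψ : ℤ × Fin 6 → ℂ) (j : ℤ) :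
    ∑ i, ‖coin ψ (j, i)‖ ^ 2 = ∑ i, ‖ψ (j, i)‖ ^ 2 := by
  have h1 := norm_sq_coin_pair (ψ (j, 0)) (ψ (j, 5))
  have h2 := norm_sq_coin_pair (ψ (j, 2)) (ψ (j, 4))
  simp only [Fin.sum_univ_six, coin, Matrix.cons_val]
  linarith

theorem summable_cells {ι : Type*} [Fintype ι] {f : ℤ × ι → ℝ} (hf : ∀ e, 0 ≤ f e) :
    Summable f ↔ Summable fun j => ∑ i, f (j, i) := by
  rw [summable_prod_of_nonneg hf]
  simp [tsum_fintype, Summable.of_finite]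

theorem tsum_cells {ι : Type*} [Fintype ι] {f : ℤ × ι → ℝ} (hf : Summable f) :
    ∑' e, f e = ∑' j, ∑ i, f (j, i) := by
  rw [hf.tsum_prod' fun _ => Summable.of_finite]
  simp [tsum_fintype]

theorem summable_norm_sq {ι : Type*} (ψ : lp (fun _ : ι => ℂ) 2) :
    Summable fun e => ‖ψ e‖ ^ 2 := by
  have h := (lp.memℓp ψ).summable (by norm_num)
  norm_num at h
  exact h

theorem norm_sq_eq_tsum {ι : Type*} (ψ : lp (fun _ : ι => ℂ) 2) :
    ‖ψ‖ ^ 2 = ∑' e, ‖ψ e‖ ^ 2 := by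
  have h := lp.norm_rpow_eq_tsum (p := 2) (by norm_num) ψ
  norm_num at h
  exact h

theorem memℓp_two {ι : Type*} {f : ι → ℂ} (h : Summable fun e => ‖f e‖ ^ 2) :
    Memℓp f 2 := by
  refine memℓp_gen ?_
  norm_num
  exact h

theorem summable_norm_sq_evolFun {ψ : ℤ × Fin 6 → ℂ} (h : Summable fun e => ‖ψ e‖ ^ 2) :
    Summable (fun e => ‖evolFun ψ e‖ ^ 2) ∧
      ∑' e, ‖evolFun ψ e‖ ^ 2 = ∑' e, ‖ψ e‖ ^ 2 := by
  have hc : Summable fun e => ‖coin ψ e‖ ^ 2 := by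
    rw [summable_cells fun e => by positivity] at h ⊢
    simpa only [sum_norm_sq_coin] using h
  refine ⟨(revEquiv.summable_iff (f := fun e => ‖coin ψ e‖ ^ 2)).2 hc, ?_⟩
  rw [show (fun e => ‖evolFun ψ e‖ ^ 2) = fun e => ‖coin ψ (revEquiv e)‖ ^ 2 from rfl,
    revEquiv.tsum_eq (fun e => ‖coin ψ e‖ ^ 2), tsum_cells hc, tsum_cells h]
  simp only [sum_norm_sq_coin]

theorem coin_add (ψ φ : ℤ × Fin 6 → ℂ) : coin (ψ + φ) = coin ψ + coin φ := by
  ext ⟨j, i⟩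
  fin_cases i <;> simp [coin] <;> ring

theorem coin_smul (a : ℂ) (ψ : ℤ × Fin 6 → ℂ) : coin (a • ψ) = a • coin ψ := by
  ext ⟨j, i⟩
  fin_cases i <;> simp [coin] <;> ring

/-- The unitary evolution of the line walk, as an isometry. -/
def lineEvol : LineSpace →ₗᵢ[ℂ] LineSpace where
  toFun ψ := ⟨evolFun ψ, memℓp_two (summable_norm_sq_evolFun (summable_norm_sq ψ)).1⟩
  map_add' ψ φ := by
    ext e; exact congrFun (coin_add ψ φ) (rev e)
  map_smul' a ψ := by
    ext e; exact congrFun (coin_smul a ψ) (rev e)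
  norm_map' ψ := by
    have h : ‖(⟨evolFun ψ, memℓp_two (summable_norm_sq_evolFun (summable_norm_sq ψ)).1⟩ :
        LineSpace)‖ ^ 2 = ‖ψ‖ ^ 2 := by
      rw [norm_sq_eq_tsum, norm_sq_eq_tsum]
      exact (summable_norm_sq_evolFun (summable_norm_sq ψ)).2
    exact (pow_left_inj₀ (norm_nonneg _) (norm_nonneg _) two_ne_zero).1 h

theorem lineEvol_apply (ψ : LineSpace) (e : ℤ × Fin 6) : lineEvol ψ e = evolFun ψ e := rfl

theorem norm_le_of_forall_le {ψ φ : LineSpace} {c : ℝ} (hc : 0 ≤ c)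
    (h : ∀ e, ‖ψ e‖ ≤ c * ‖φ e‖) : ‖ψ‖ ≤ c * ‖φ‖ := by
  refine (pow_le_pow_iff_left₀ (norm_nonneg _) (by positivity) two_ne_zero).1 ?_
  rw [mul_pow, norm_sq_eq_tsum, norm_sq_eq_tsum, ← tsum_mul_left]
  refine (summable_norm_sq ψ).tsum_le_tsum (fun e => ?_) ((summable_norm_sq φ).mul_left _)
  rw [← mul_pow]
  exact pow_le_pow_left₀ (norm_nonneg _) (h e) 2

/-! ### Operators on finitely supported states -/

/-- The image of a site under one step of the line walk. -/
def evolCol (e : ℤ × Fin 6) : FiniteState :=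
  ![(1 / 3 : ℂ) • Finsupp.single (e.1, 3) 1 + (2 * (√2 : ℝ) / 3 : ℂ) • Finsupp.single (e.1 - 1, 4) 1,
    Finsupp.single (e.1, 0) 1,
    (1 / 3 : ℂ) • Finsupp.single (e.1, 1) 1 + (2 * (√2 : ℝ) / 3 : ℂ) • Finsupp.single (e.1 + 1, 5) 1,
    Finsupp.single (e.1, 2) 1,
    (2 * (√2 : ℝ) / 3 : ℂ) • Finsupp.single (e.1, 1) 1 - (1 / 3 : ℂ) • Finsupp.single (e.1 + 1, 5) 1,
    (2 * (√2 : ℝ) / 3 : ℂ) • Finsupp.single (e.1, 3) 1 -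
      (1 / 3 : ℂ) • Finsupp.single (e.1 - 1, 4) 1] e.2

/-- The image of a site under one backward step of the line walk. -/
def evolInvCol (e : ℤ × Fin 6) : FiniteState :=
  ![Finsupp.single (e.1, 1) 1,
    (1 / 3 : ℂ) • Finsupp.single (e.1, 2) 1 + (2 * (√2 : ℝ) / 3 : ℂ) • Finsupp.single (e.1, 4) 1,
    Finsupp.single (e.1, 3) 1,
    (1 / 3 : ℂ) • Finsupp.single (e.1, 0) 1 + (2 * (√2 : ℝ) / 3 : ℂ) • Finsupp.single (e.1, 5) 1,
    (2 * (√2 : ℝ) / 3 : ℂ) • Finsupp.single (e.1 + 1, 0) 1 -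
      (1 / 3 : ℂ) • Finsupp.single (e.1 + 1, 5) 1,
    (2 * (√2 : ℝ) / 3 : ℂ) • Finsupp.single (e.1 - 1, 2) 1 -
      (1 / 3 : ℂ) • Finsupp.single (e.1 - 1, 4) 1] e.2

/-- The evolution on finitely supported states. -/
def evol : Module.End ℂ FiniteState := Finsupp.linearCombination ℂ evolCol

/-- The inverse evolution on finitely supported states. -/
def evolInv : Module.End ℂ FiniteState := Finsupp.linearCombination ℂ evolInvCol

/-- The translation by `d` cells. -/
def shift (d : ℤ) : Module.End ℂ FiniteState :=
  Finsupp.linearCombination ℂ fun e => Finsupp.single (e.1 + d, e.2) 1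

/-- The position operator. -/
def position : Module.End ℂ FiniteState :=
  Finsupp.linearCombination ℂ fun e => (e.1 : ℂ) • Finsupp.single e 1

/-- The displacement of the bridge arcs. -/
def displacement : Module.End ℂ FiniteState :=
  Finsupp.linearCombination ℂ fun e => (![0, 0, 0, 0, -1, 1] e.2 : ℂ) • Finsupp.single e 1

theorem position_apply (χ : FiniteState) (e : ℤ × Fin 6) : position χ e = e.1 * χ e := by
  induction χ using Finsupp.induction_linear with
  | zero => simp
  | add f g hf hg => simp only [map_add, Finsupp.add_apply, hf, hg]; ring
  | single e' a =>
    simp only [position, Finsupp.linearCombination_single, Finsupp.smul_apply,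
      Finsupp.single_apply, smul_eq_mul]
    split_ifs with h
    · subst h; ring
    · simp

theorem displacement_apply (χ : FiniteState) (e : ℤ × Fin 6) :
    displacement χ e = (![0, 0, 0, 0, -1, 1] e.2 : ℂ) * χ e := by
  induction χ using Finsupp.induction_linear with
  | zero => simp
  | add f g hf hg => simp only [map_add, Finsupp.add_apply, hf, hg]; ring
  | single e' a =>
    simp only [displacement, Finsupp.linearCombination_single, Finsupp.smul_apply,
      Finsupp.single_apply, smul_eq_mul]
    split_ifs with h
    · subst h; ring
    · simp

theorem evol_apply (χ : FiniteState) (e : ℤ × Fin 6) : evol χ e = evolFun χ e := by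
  induction χ using Finsupp.induction_linear with
  | zero => 
    have : coin (0 : ℤ × Fin 6 → ℂ) = 0 := by simpa using coin_smul 0 0
    simp [evolFun, this]
  | add f g hf hg =>
    rw [map_add, Finsupp.add_apply, hf, hg, evolFun, evolFun, evolFun, Finsupp.coe_add, coin_add]
    rfl
  | single e' a =>
    obtain ⟨j, i⟩ := e
    obtain ⟨m, k⟩ := e'
    have hl : ∀ n : ℤ, (m - 1 = n) = (m = n + 1) := fun n => by
      rw [eq_iff_iff]; constructor <;> intro h <;> omega
    have hr : ∀ n : ℤ, (m + 1 = n) = (m = n - 1) := fun n => by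
      rw [eq_iff_iff]; constructor <;> intro h <;> omega
    rw [evol, Finsupp.linearCombination_single, Finsupp.smul_apply, evolFun]
    fin_cases i <;> fin_cases k <;>
      simp [evolCol, coin, rev, Finsupp.single_apply, hl, hr, mul_comm]

theorem toLine_evol (χ : FiniteState) : toLine (evol χ) = lineEvol (toLine χ) := by
  ext e
  rw [toLine_apply, evol_apply, lineEvol_apply]
  congr 1
  ext e'
  rw [toLine_apply]

theorem finiteState_hom_ext {S T : Module.End ℂ FiniteState}
    (h : ∀ j i, S (Finsupp.single (j, i) 1) = T (Finsupp.single (j, i) 1)) : S = T := by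
  refine Finsupp.lhom_ext fun e a => ?_
  obtain ⟨j, i⟩ := e
  rw [show Finsupp.single (j, i) a = a • Finsupp.single (j, i) (1 : ℂ) by simp, map_smul, map_smul,
    h]

theorem evol_mul_evolInv : evol * evolInv = 1 := by
  have hr := sqrt_two_mul_self
  refine finiteState_hom_ext fun j i => ?_
  rw [Module.End.mul_apply, Module.End.one_apply, evolInv, Finsupp.linearCombination_single,
    one_smul]
  have key : ∀ e, evol (Finsupp.single e 1) = evolCol e := fun e => by
    rw [evol, Finsupp.linearCombination_single, one_smul]
  fin_cases i <;> simp only [evolInvCol, Fin.zero_eta, Fin.mk_one, Fin.reduceFinMk,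
    Matrix.cons_val, map_add, map_sub, map_smul, key, evolCol, add_sub_cancel_right,
    sub_add_cancel] <;> ext e <;>
    simp only [Finsupp.add_apply, Finsupp.sub_apply, Finsupp.smul_apply, smul_eq_mul]
  · linear_combination (4 / 9 * Finsupp.single (j, (1 : Fin 6)) (1 : ℂ) e) * hr
  · linear_combination (4 / 9 * Finsupp.single (j, (3 : Fin 6)) (1 : ℂ) e) * hr
  · linear_combination (4 / 9 * Finsupp.single (j, (4 : Fin 6)) (1 : ℂ) e) * hr
  · linear_combination (4 / 9 * Finsupp.single (j, (5 : Fin 6)) (1 : ℂ) e) * hr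

/-- A step changes the cell only on bridge arcs, and then by one. So the commutator is bounded
although the position is not. -/
theorem position_evol : position * evol - evol * position = displacement * evol := by
  refine finiteState_hom_ext fun j i => ?_
  have k1 : ∀ e, evol (Finsupp.single e 1) = evolCol e := fun e => by
    rw [evol, Finsupp.linearCombination_single, one_smul]
  have k2 : ∀ e : ℤ × Fin 6, position (Finsupp.single e 1) = (e.1 : ℂ) • Finsupp.single e 1 :=
    fun e => by rw [position, Finsupp.linearCombination_single, one_smul]
  have k3 : ∀ e : ℤ × Fin 6, displacement (Finsupp.single e 1) =
      (![0, 0, 0, 0, -1, 1] e.2 : ℂ) • Finsupp.single e 1 := fun e => by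
    rw [displacement, Finsupp.linearCombination_single, one_smul]
  rw [LinearMap.sub_apply, Module.End.mul_apply, Module.End.mul_apply, Module.End.mul_apply, k2,
    map_smul, k1]
  fin_cases i <;> simp only [evolCol, Fin.zero_eta, Fin.mk_one, Fin.reduceFinMk, Matrix.cons_val,
    map_add, map_sub, map_smul, k2, k3] <;> push_cast <;> module

theorem position_shift (d : ℤ) : position * shift d - shift d * position = (d : ℂ) • shift d := by
  refine finiteState_hom_ext fun j i => ?_
  have k2 : ∀ e : ℤ × Fin 6, position (Finsupp.single e 1) = (e.1 : ℂ) • Finsupp.single e 1 :=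
    fun e => by rw [position, Finsupp.linearCombination_single, one_smul]
  have k3 : ∀ e : ℤ × Fin 6, shift d (Finsupp.single e 1) = Finsupp.single (e.1 + d, e.2) 1 :=
    fun e => by rw [shift, Finsupp.linearCombination_single, one_smul]
  rw [LinearMap.sub_apply, Module.End.mul_apply, Module.End.mul_apply, LinearMap.smul_apply, k2,
    map_smul, k3, k2]
  push_cast; module

/-! ### Symbols -/

section Symbols

variable {σ : Sheet} {y : ℝ}

theorem bloch_single (e : ℤ × Fin 6) : bloch σ y (Finsupp.single e 1) = amp e σ y := by
  simp [bloch]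

/-- Injectivity of the isometry `spectral`. Through it, identities between translation-invariant
operators need only be checked on symbols. -/
theorem bloch_ext {χ χ' : FiniteState}
    (h : ∀ σ : Sheet, ∀ y ∈ Set.Ioo (-edge σ.1) (edge σ.1), bloch σ y χ = bloch σ y χ') :
    χ = χ' := by
  have hw : waveSum χ = waveSum χ' := by
    ext y σ
    simp only [waveSum_apply]
    split_ifs with hy
    · rw [h σ y hy]
    · rfl
  have hs : spectral (toLine χ) = spectral (toLine χ') :=
    Lp.ext ((spectral_toLine χ).trans (hw ▸ (spectral_toLine χ').symm))
  have ht := spectral.injective hs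
  ext e
  rw [← toLine_apply, ht, toLine_apply]

theorem bloch_evol (hy : y ∈ Set.Ioo (-edge σ.1) (edge σ.1)) (χ : FiniteState) :
    bloch σ y (evol χ) = eig σ y * bloch σ y χ := by
  suffices h : bloch σ y ∘ₗ evol = eig σ y • bloch σ y from LinearMap.congr_fun h χ
  refine Finsupp.lhom_ext fun e a => ?_
  rw [show Finsupp.single e a = a • Finsupp.single e (1 : ℂ) by simp, map_smul, map_smul]
  congr 1
  obtain ⟨j, i⟩ := e
  have h0 := blochPhase_ne_zero hy
  obtain ⟨h1, h2, h3, h4, h5, h6⟩ := coef_intertwine (mul_inv_cancel₀ h0)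
    (vertexEig_cubic_complex hy) (eig_mul_invEig hy) (eig_add_invEig σ y)
  rw [LinearMap.comp_apply, LinearMap.smul_apply, bloch_single, evol,
    Finsupp.linearCombination_single, one_smul, smul_eq_mul]
  have hm : blochPhase σ y ^ (j - 1) = blochPhase σ y ^ j * (blochPhase σ y)⁻¹ :=
    zpow_sub_one₀ h0 j
  have hp : blochPhase σ y ^ (j + 1) = blochPhase σ y ^ j * blochPhase σ y := zpow_add_one₀ h0 j
  fin_cases i <;> simp only [evolCol, Fin.zero_eta, Fin.mk_one, Fin.reduceFinMk, Matrix.cons_val,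
    map_add, map_sub, map_smul, bloch_single, amp, smul_eq_mul, hm, hp]
  · linear_combination (blochPhase σ y ^ j) * h1
  · linear_combination (blochPhase σ y ^ j) * h2
  · linear_combination (blochPhase σ y ^ j) * h3
  · linear_combination (blochPhase σ y ^ j) * h4
  · linear_combination (blochPhase σ y ^ j) * h5
  · linear_combination (blochPhase σ y ^ j) * h6

theorem bloch_evolInv (hy : y ∈ Set.Ioo (-edge σ.1) (edge σ.1)) (χ : FiniteState) :
    bloch σ y (evolInv χ) = invEig σ y * bloch σ y χ := by
  have h : evol (evolInv χ) = χ := LinearMap.congr_fun evol_mul_evolInv χ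
  have h2 := bloch_evol hy (evolInv χ)
  rw [h] at h2
  rw [h2]
  linear_combination (-(bloch σ y (evolInv χ))) * eig_mul_invEig hy

theorem bloch_shift (hy : y ∈ Set.Ioo (-edge σ.1) (edge σ.1)) (d : ℤ) (χ : FiniteState) :
    bloch σ y (shift d χ) = blochPhase σ y ^ d * bloch σ y χ := by
  suffices h : bloch σ y ∘ₗ shift d = (blochPhase σ y ^ d) • bloch σ y from LinearMap.congr_fun h χ
  refine Finsupp.lhom_ext fun e a => ?_
  rw [show Finsupp.single e a = a • Finsupp.single e (1 : ℂ) by simp, map_smul, map_smul]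
  congr 1
  rw [LinearMap.comp_apply, LinearMap.smul_apply, bloch_single, shift,
    Finsupp.linearCombination_single, one_smul, smul_eq_mul, bloch_single, amp, amp,
    zpow_add₀ (blochPhase_ne_zero hy)]
  ring

end Symbols


/-! ### Commutators with the position operator -/

section Ring

variable {R : Type*} [Ring R]

/-- The commutator `[x, a]`. -/
def comm (x a : R) : R := x * a - a * x

/-- The sum `∑_{s < t} u ^ s a u ^ (t - 1 - s)`. -/
def orbitSum (u a : R) : ℕ → R
  | 0 => 0
  | t + 1 => u * orbitSum u a t + a * u ^ t

theorem comm_mul (x a b : R) : comm x (a * b) = comm x a * b + a * comm x b := by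
  unfold comm; noncomm_ring

theorem comm_add (x a b : R) : comm x (a + b) = comm x a + comm x b := by
  unfold comm; noncomm_ring

theorem comm_sub (x a b : R) : comm x (a - b) = comm x a - comm x b := by
  unfold comm; noncomm_ring

theorem comm_one (x : R) : comm x 1 = 0 := by simp [comm]

theorem comm_natCast_mul (x a : R) (n : ℕ) : comm x (n * a) = n * comm x a := by
  have h := (Nat.cast_commute n x).eq
  unfold comm
  rw [mul_sub, ← mul_assoc, ← mul_assoc, ← mul_assoc, h]

theorem comm_ofNat_mul (x a : R) (n : ℕ) [n.AtLeastTwo] :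
    comm x (ofNat(n) * a) = ofNat(n) * comm x a := by
  exact_mod_cast comm_natCast_mul x a (OfNat.ofNat n)

/-- The Leibniz rule for the derivation [x, ·] applied to the power `u ^ t`. -/
theorem orbitSum_comm (u x : R) (t : ℕ) : orbitSum u (comm x u) t = comm x (u ^ t) := by
  induction t with
  | zero => simp [orbitSum, comm]
  | succ t ih => rw [orbitSum, ih, pow_succ', comm_mul, add_comm]

theorem orbitSum_add (u a b : R) (t : ℕ) :
    orbitSum u (a + b) t = orbitSum u a t + orbitSum u b t := by
  induction t with
  | zero => simp [orbitSum]
  | succ t ih => simp only [orbitSum, ih]; noncomm_ring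

theorem orbitSum_sub (u a b : R) (t : ℕ) :
    orbitSum u (a - b) t = orbitSum u a t - orbitSum u b t := by
  induction t with
  | zero => simp [orbitSum]
  | succ t ih => simp only [orbitSum, ih]; noncomm_ring

theorem orbitSum_mul_left {u c : R} (h : Commute u c) (a : R) (t : ℕ) :
    orbitSum u (c * a) t = c * orbitSum u a t := by
  induction t with
  | zero => simp [orbitSum]
  | succ t ih => rw [orbitSum, orbitSum, ih, ← mul_assoc, h.eq, mul_add, mul_assoc, mul_assoc]

theorem orbitSum_mul_right {u c : R} (h : Commute u c) (a : R) (t : ℕ) :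
    orbitSum u (a * c) t = orbitSum u a t * c := by
  induction t with
  | zero => simp [orbitSum]
  | succ t ih =>
    rw [orbitSum, orbitSum, ih, add_mul, mul_assoc, mul_assoc, mul_assoc, (h.pow_left t).eq]

/-- All t summands coincide; this is where the linear growth in time comes from. -/
theorem orbitSum_self {u c : R} (h : Commute u c) (t : ℕ) :
    orbitSum u (c * u) t = t * (c * u ^ t) := by
  induction t with
  | zero => simp [orbitSum]
  | succ t ih =>
    have h1 : u * (t * (c * u ^ t)) = t * (c * u ^ (t + 1)) := by
      rw [← mul_assoc, ← (Nat.cast_commute t u).eq, mul_assoc, ← mul_assoc u, h.eq, mul_assoc,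
        ← pow_succ']
    rw [orbitSum, ih, h1, mul_assoc c, ← pow_succ']
    push_cast; noncomm_ring

theorem orbitSum_comm_pow_succ (u x : R) (j t : ℕ) :
    orbitSum u (comm x (u ^ (j + 1))) t =
      comm x (u ^ t) * u ^ j + u * orbitSum u (comm x (u ^ j)) t := by
  rw [pow_succ', comm_mul, orbitSum_add, orbitSum_mul_right ((Commute.refl u).pow_right j),
    orbitSum_mul_left (Commute.refl u), orbitSum_comm]

/-- Two expansions of [x, u^(t+1)] are compared. `u` and [x, u^t] commute up to an error in which t
enters only through `u ^ t`. -/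
theorem mul_comm_pow (u x : R) (t : ℕ) :
    u * comm x (u ^ t) = comm x (u ^ t) * u + (u ^ t * comm x u - comm x u * u ^ t) := by
  have h1 : comm x (u ^ t * u) = comm x (u * u ^ t) := by rw [← pow_succ, ← pow_succ']
  rw [comm_mul, comm_mul] at h1
  rw [eq_sub_of_add_eq' h1.symm]; abel

/-- An element commuting with `u`, whose commutator with `x` also commutes with `u`, commutes with
`[x, u ^ t]`. -/
theorem commute_comm_pow {u x m : R} (hm : Commute m u) (hk : Commute (comm x m) u) (t : ℕ) :
    m * comm x (u ^ t) = comm x (u ^ t) * m := by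
  have h1 : comm x (m * u ^ t) = comm x (u ^ t * m) := by rw [(hm.pow_right t).eq]
  rw [comm_mul, comm_mul, (hk.pow_right t).eq] at h1
  rw [← add_right_inj (u ^ t * comm x m), h1]; abel

/-- The defect of `[x, u ^ t] (j + 1) u ^ j` as an orbit sum. -/
def orbitDefect (u x : R) (j t : ℕ) : R :=
  orbitSum u (comm x (u ^ (j + 1))) t - ((j + 1 : ℕ) : R) * (comm x (u ^ t) * u ^ j)

theorem orbitDefect_zero (u x : R) (t : ℕ) : orbitDefect u x 0 t = 0 := by
  simp [orbitDefect, orbitSum_comm]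

/-- The point of the recursion is that it contains no sum of t terms: for fixed j the defect is
assembled from a fixed number of products of powers of `u` with [x, u]. -/
theorem orbitDefect_succ (u x : R) (j t : ℕ) :
    orbitDefect u x (j + 1) t = u * orbitDefect u x j t +
      ((j + 1 : ℕ) : R) * ((u ^ t * comm x u - comm x u * u ^ t) * u ^ j) := by
  have h2 := mul_comm_pow u x t
  have h3 : u * (((j + 1 : ℕ) : R) * (comm x (u ^ t) * u ^ j)) =
      ((j + 1 : ℕ) : R) * (u * comm x (u ^ t) * u ^ j) := by
    rw [← mul_assoc, ← (Nat.cast_commute (j + 1) u).eq, mul_assoc, mul_assoc]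
  unfold orbitDefect
  rw [orbitSum_comm_pow_succ, mul_sub, h3, h2, pow_succ' u j]
  generalize comm x (u ^ t) = a
  generalize comm x u = b
  push_cast
  noncomm_ring

/-- Differentiating the relation `9 u ^ 6 - u ^ 4 - u ^ 2 + 9 = 8 m u ^ 3`, the commutator of `x` with
`u ^ t` becomes linear in `t` up to bounded terms. -/
theorem comm_pow_mul_of_dispersion {u x m k : R} (hm : Commute m u) (hk : Commute k u)
    (hmk : comm x m = k) (hd : 9 * u ^ 6 - u ^ 4 - u ^ 2 + 9 * 1 = 8 * (m * u ^ 3)) (t : ℕ) :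
    comm x (u ^ t) * (54 * u ^ 5 - 4 * u ^ 3 - 2 * u - 24 * (m * u ^ 2)) =
      (t : R) * (u ^ t * (8 * (k * u ^ 2))) -
        (9 * orbitDefect u x 5 t - orbitDefect u x 3 t - orbitDefect u x 1 t -
          8 * (m * orbitDefect u x 2 t)) := by
  -- The derivation [x, ·] differentiates the dispersion relation with respect to the
  -- quasi-momentum.
  have hdisp := congrArg (comm x) hd
  rw [comm_add, comm_sub, comm_sub, comm_ofNat_mul, comm_ofNat_mul, comm_one, mul_zero, add_zero,
    comm_ofNat_mul, comm_mul, hmk] at hdisp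
  -- The orbit sum turns each [x, u^(j+1)] into (j + 1) [x, u^t] u^j plus its defect, and the term
  -- in `k`, which commutes with `u`, into a multiple of t.
  have horb := congrArg (fun a => orbitSum u a t) hdisp
  simp only [orbitSum_sub] at horb
  have hk2 : Commute u (k * u ^ 2) := hk.symm.mul_right ((Commute.refl u).pow_right 2)
  rw [orbitSum_mul_left (Commute.ofNat_right u _), orbitSum_mul_left (Commute.ofNat_right u _),
    orbitSum_add, orbitSum_mul_left hm.symm, show k * u ^ 3 = k * u ^ 2 * u by
      rw [mul_assoc, ← pow_succ], orbitSum_self hk2] at horb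
  have hMc := commute_comm_pow (x := x) hm (by rw [hmk]; exact hk) t
  have e1 : u ^ t * (8 * (k * u ^ 2)) = 8 * (k * u ^ 2 * u ^ t) := by
    rw [← mul_assoc, (Commute.ofNat_right (u ^ t) _).eq, mul_assoc, (hk2.pow_left t).eq]
  have e2 : (t : R) * (8 * (k * u ^ 2 * u ^ t)) = 8 * (t * (k * u ^ 2 * u ^ t)) := by
    rw [← mul_assoc, (Commute.ofNat_right (t : R) _).eq, mul_assoc]
  have e3 : m * (((3 : ℕ) : R) * (comm x (u ^ t) * u ^ 2)) =
      ((3 : ℕ) : R) * (comm x (u ^ t) * (m * u ^ 2)) := by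
    rw [← mul_assoc, ← (Nat.cast_commute 3 m).eq, mul_assoc, ← mul_assoc m, hMc, mul_assoc]
  have hD : ∀ (n : ℕ) (a : R), comm x (u ^ t) * (n * a) = n * (comm x (u ^ t) * a) := fun n a => by
    rw [← mul_assoc, ← (Nat.cast_commute n _).eq, mul_assoc]
  have e54 := hD 54 (u ^ 5)
  have e4 := hD 4 (u ^ 3)
  have ee2 := hD 2 u
  have e24 := hD 24 (m * u ^ 2)
  unfold orbitDefect
  rw [mul_add] at horb
  rw [mul_sub m, e3, e1, e2, eq_sub_of_add_eq horb.symm]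
  push_cast at e54 e4 ee2 e24 ⊢
  rw [mul_sub, mul_sub, mul_sub, e54, e4, ee2, e24]
  simp only [pow_one]
  generalize comm x (u ^ t) * u ^ 5 = a5
  generalize comm x (u ^ t) * u ^ 3 = a3
  generalize comm x (u ^ t) * u = a1
  generalize comm x (u ^ t) * (m * u ^ 2) = a2
  noncomm_ring

end Ring

/-! ### Operators bounded uniformly in time, and ballistic motion. -/

/-- The ring of operators on finitely supported states. -/
def StateOp : Type := Module.End ℂ FiniteState

instance : Ring StateOp := inferInstanceAs (Ring (Module.End ℂ FiniteState))

namespace StateOp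

/-- The linear map given by an operator. -/
def app (T : StateOp) : FiniteState →ₗ[ℂ] FiniteState := T

variable (S T : StateOp) (χ : FiniteState)

theorem app_add : (S + T).app χ = S.app χ + T.app χ := rfl
theorem app_sub : (S - T).app χ = S.app χ - T.app χ := rfl
theorem app_mul : (S * T).app χ = S.app (T.app χ) := rfl
theorem app_zero : (0 : StateOp).app χ = 0 := rfl
theorem app_one : (1 : StateOp).app χ = χ := rfl
theorem app_natCast (n : ℕ) : (n : StateOp).app χ = (n : ℂ) • χ := by
  rw [Nat.cast_smul_eq_nsmul]; rfl
theorem app_ofNat (n : ℕ) [n.AtLeastTwo] :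
    (ofNat(n) : StateOp).app χ = (ofNat(n) : ℂ) • χ := by
  have h : (ofNat(n) : StateOp) = ((ofNat(n) : ℕ) : StateOp) := rfl
  rw [h, app_natCast, Nat.cast_ofNat]

variable {S T} in
theorem ext (h : ∀ χ, S.app χ = T.app χ) : S = T := LinearMap.ext h

end StateOp

/-- The family `T` of operators is bounded uniformly in time. -/
def UnifBdd (T : ℕ → StateOp) : Prop :=
  ∃ C : ℝ, 0 ≤ C ∧ ∀ t χ, ‖toLine ((T t).app χ)‖ ≤ C * ‖toLine χ‖

namespace UnifBdd

variable {S T : ℕ → StateOp}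

theorem add (hS : UnifBdd S) (hT : UnifBdd T) : UnifBdd fun t => S t + T t := by
  obtain ⟨C, hC, h⟩ := hS
  obtain ⟨D, hD, h'⟩ := hT
  refine ⟨C + D, by positivity, fun t χ => ?_⟩
  rw [StateOp.app_add, map_add, add_mul]
  exact (norm_add_le _ _).trans (add_le_add (h t χ) (h' t χ))

theorem sub (hS : UnifBdd S) (hT : UnifBdd T) : UnifBdd fun t => S t - T t := by
  obtain ⟨C, hC, h⟩ := hS
  obtain ⟨D, hD, h'⟩ := hT
  refine ⟨C + D, by positivity, fun t χ => ?_⟩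
  rw [StateOp.app_sub, map_sub, add_mul]
  exact (norm_sub_le _ _).trans (add_le_add (h t χ) (h' t χ))

theorem mul (hS : UnifBdd S) (hT : UnifBdd T) : UnifBdd fun t => S t * T t := by
  obtain ⟨C, hC, h⟩ := hS
  obtain ⟨D, hD, h'⟩ := hT
  refine ⟨C * D, by positivity, fun t χ => ?_⟩
  rw [StateOp.app_mul, mul_assoc]
  exact (h t _).trans (mul_le_mul_of_nonneg_left (h' t χ) hC)

theorem natCast (n : ℕ) : UnifBdd fun _ => (n : StateOp) := by
  refine ⟨n, by positivity, fun t χ => ?_⟩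
  rw [StateOp.app_natCast, map_smul, norm_smul, Complex.norm_natCast]

theorem ofNat (n : ℕ) [n.AtLeastTwo] : UnifBdd fun _ => (OfNat.ofNat n : StateOp) :=
  natCast (OfNat.ofNat n)

theorem zero : UnifBdd fun _ => 0 :=
  ⟨0, le_rfl, fun t χ => by rw [StateOp.app_zero, map_zero, norm_zero, zero_mul]⟩

end UnifBdd

/-- The evolution as an element of the operator ring. -/
def evolOp : StateOp := evol

theorem app_evolOp (χ : FiniteState) : evolOp.app χ = evol χ := rfl

theorem norm_toLine_evol (χ : FiniteState) : ‖toLine (evol χ)‖ = ‖toLine χ‖ := by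
  rw [toLine_evol, lineEvol.norm_map]

theorem toLine_evolOp_pow (t : ℕ) (χ : FiniteState) :
    toLine ((evolOp ^ t).app χ) = lineEvol^[t] (toLine χ) := by
  induction t generalizing χ with
  | zero => rfl
  | succ t ih => rw [pow_succ, StateOp.app_mul, ih, app_evolOp, toLine_evol,
      Function.iterate_succ_apply]

theorem norm_toLine_evolOp_pow (t : ℕ) (χ : FiniteState) :
    ‖toLine ((evolOp ^ t).app χ)‖ = ‖toLine χ‖ := by
  induction t with
  | zero => rfl
  | succ t ih => rw [pow_succ', StateOp.app_mul, app_evolOp, norm_toLine_evol, ih]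

theorem unifBdd_evolOp_pow (f : ℕ → ℕ) : UnifBdd fun t => evolOp ^ f t :=
  ⟨1, zero_le_one, fun t χ => by rw [norm_toLine_evolOp_pow, one_mul]⟩

/-- The position operator as an element of the operator ring. -/
def positionOp : StateOp := position

/-- The translations as elements of the operator ring. -/
def shiftOp (d : ℤ) : StateOp := shift d

/-- The sum of both unit translations. -/
def shiftSum : StateOp := shiftOp 1 + shiftOp (-1)

/-- The difference of both unit translations. -/
def shiftDiff : StateOp := shiftOp 1 - shiftOp (-1)

theorem comm_position_evol : comm positionOp evolOp = (show StateOp from displacement) * evolOp :=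
  StateOp.ext fun χ => LinearMap.congr_fun position_evol χ

theorem unifBdd_comm_position_evol : UnifBdd fun _ => comm positionOp evolOp := by
  rw [comm_position_evol]
  refine UnifBdd.mul ⟨1, zero_le_one, fun _ χ => norm_le_of_forall_le zero_le_one fun e => ?_⟩
    (by simpa using unifBdd_evolOp_pow fun _ => 1)
  rw [toLine_apply, toLine_apply]
  change ‖displacement χ e‖ ≤ _
  rw [displacement_apply, norm_mul]
  refine mul_le_mul_of_nonneg_right ?_ (norm_nonneg _)
  obtain ⟨j, i⟩ := e
  fin_cases i <;> simp

/-- Parseval for `spectral`: pointwise domination of symbols gives domination of norms. -/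
theorem norm_toLine_le_of_bloch {χ χ' : FiniteState}
    (h : ∀ σ : Sheet, ∀ y ∈ Set.Ioo (-edge σ.1) (edge σ.1), ‖bloch σ y χ‖ ≤ ‖bloch σ y χ'‖) :
    ‖toLine χ‖ ≤ ‖toLine χ'‖ := by
  rw [← spectral.norm_map, ← spectral.norm_map (toLine χ')]
  refine Lp.norm_le_norm_of_ae_le ?_
  filter_upwards [spectral_toLine χ, spectral_toLine χ'] with y h1 h2
  rw [h1, h2]
  refine (pow_le_pow_iff_left₀ (norm_nonneg _) (norm_nonneg _) two_ne_zero).1 ?_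
  rw [EuclideanSpace.norm_sq_eq, EuclideanSpace.norm_sq_eq]
  refine Finset.sum_le_sum fun σ _ => pow_le_pow_left₀ (norm_nonneg _) ?_ 2
  rw [waveSum_apply, waveSum_apply]
  split_ifs with hy
  · rw [norm_mul, norm_mul]
    exact mul_le_mul_of_nonneg_left (h σ y hy) (norm_nonneg _)
  · exact le_rfl

section Symbols

variable {σ : Sheet} {y : ℝ}

theorem bloch_evolOp_pow (hy : y ∈ Set.Ioo (-edge σ.1) (edge σ.1)) (n : ℕ) (χ : FiniteState) :
    bloch σ y ((evolOp ^ n).app χ) = eig σ y ^ n * bloch σ y χ := by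
  induction n with
  | zero => rw [pow_zero, pow_zero, one_mul]; rfl
  | succ n ih => rw [pow_succ', StateOp.app_mul, app_evolOp, bloch_evol hy, ih]; ring

theorem bloch_shiftOp (hy : y ∈ Set.Ioo (-edge σ.1) (edge σ.1)) (d : ℤ) (χ : FiniteState) :
    bloch σ y ((shiftOp d).app χ) = blochPhase σ y ^ d * bloch σ y χ := bloch_shift hy d χ

theorem bloch_shiftSum (hy : y ∈ Set.Ioo (-edge σ.1) (edge σ.1)) (χ : FiniteState) :
    bloch σ y (shiftSum.app χ) = (blochPhase σ y + (blochPhase σ y)⁻¹) * bloch σ y χ := by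
  rw [shiftSum, StateOp.app_add, map_add, bloch_shiftOp hy, bloch_shiftOp hy, zpow_one,
    zpow_neg_one]
  ring

theorem bloch_shiftDiff (hy : y ∈ Set.Ioo (-edge σ.1) (edge σ.1)) (χ : FiniteState) :
    bloch σ y (shiftDiff.app χ) = (blochPhase σ y - (blochPhase σ y)⁻¹) * bloch σ y χ := by
  rw [shiftDiff, StateOp.app_sub, map_sub, bloch_shiftOp hy, bloch_shiftOp hy, zpow_one,
    zpow_neg_one]
  ring

/-- The cubic 9l³ - 7l = ω + ω⁻¹ with l = (z + z⁻¹)/2, multiplied by 8z³. -/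
theorem eig_dispersion (hy : y ∈ Set.Ioo (-edge σ.1) (edge σ.1)) :
    9 * eig σ y ^ 6 - eig σ y ^ 4 - eig σ y ^ 2 + 9 =
      8 * ((blochPhase σ y + (blochPhase σ y)⁻¹) * eig σ y ^ 3) := by
  have h1 := eig_mul_invEig hy
  have h2 := eig_add_invEig σ y
  rw [← vertexEig_cubic_complex hy]
  have hl : (vertexEig σ.1 σ.2.1 y : ℂ) = (eig σ y + invEig σ y) / 2 := by rw [h2]; ring
  rw [hl]
  generalize eig σ y = z at *
  generalize invEig σ y = ζ at *
  linear_combination (-27 * z ^ 4 - z ^ 2 * (27 * (z * ζ) - 1) -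
    9 * (1 + z * ζ + (z * ζ) ^ 2)) * h1

end Symbols

theorem unifBdd_shiftOp (d : ℤ) : UnifBdd fun _ => shiftOp d := by
  refine ⟨1, zero_le_one, fun _ χ => ?_⟩
  rw [one_mul]
  refine norm_toLine_le_of_bloch fun σ y hy => ?_
  rw [bloch_shiftOp hy, norm_mul, norm_zpow, norm_blochPhase hy, one_zpow, one_mul]

theorem dispersion :
    9 * evolOp ^ 6 - evolOp ^ 4 - evolOp ^ 2 + 9 * 1 = 8 * (shiftSum * evolOp ^ 3) := by
  refine StateOp.ext fun χ => bloch_ext fun σ y hy => ?_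
  simp only [StateOp.app_add, StateOp.app_sub, StateOp.app_mul, StateOp.app_ofNat, StateOp.app_one,
    map_add, map_sub, map_smul, bloch_evolOp_pow hy, bloch_shiftSum hy, smul_eq_mul]
  linear_combination (bloch σ y χ) * eig_dispersion hy

theorem commute_shiftOp (d : ℤ) : Commute (shiftOp d) evolOp := by
  refine StateOp.ext fun χ => bloch_ext fun σ y hy => ?_
  simp only [StateOp.app_mul, app_evolOp, bloch_evol hy, bloch_shiftOp hy]
  ring

theorem comm_position_shiftOp (d : ℤ) (χ : FiniteState) :
    (comm positionOp (shiftOp d)).app χ = (d : ℂ) • (shiftOp d).app χ :=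
  LinearMap.congr_fun (position_shift d) χ

theorem comm_position_shiftSum : comm positionOp shiftSum = shiftDiff := by
  refine StateOp.ext fun χ => ?_
  rw [shiftSum, comm_add, StateOp.app_add, comm_position_shiftOp, comm_position_shiftOp, shiftDiff,
    StateOp.app_sub]
  push_cast
  module

theorem unifBdd_orbitDefect (j : ℕ) : UnifBdd fun t => orbitDefect evolOp positionOp j t := by
  induction j with
  | zero => simpa only [orbitDefect_zero] using UnifBdd.zero
  | succ j ih =>
    have hone : UnifBdd fun _ => evolOp := by simpa using unifBdd_evolOp_pow fun _ => 1
    have hc := unifBdd_comm_position_evol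
    have hU : UnifBdd fun t => evolOp ^ t := unifBdd_evolOp_pow fun t => t
    simpa only [orbitDefect_succ] using (hone.mul ih).add ((UnifBdd.natCast (j + 1)).mul
      (((hU.mul hc).sub (hc.mul hU)).mul (unifBdd_evolOp_pow fun _ => j)))

/-- The derivative of the dispersion relation. -/
def velocityDenom : StateOp :=
  54 * evolOp ^ 5 - 4 * evolOp ^ 3 - 2 * evolOp - 24 * (shiftSum * evolOp ^ 2)

/-- The velocity multiplied by its denominator. -/
def velocityNum : StateOp := 8 * (shiftDiff * evolOp ^ 2)

/-- On the range of `velocityDenom`, the position at time `t` is ballistic up to a bounded error. -/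
theorem norm_position_evolOp_pow_le (χ : FiniteState) : ∃ C : ℝ, 0 ≤ C ∧ ∀ t : ℕ,
    ‖toLine (position ((evolOp ^ t).app (velocityDenom.app χ)) -
      (t : ℂ) • (evolOp ^ t).app (velocityNum.app χ))‖ ≤ C := by
  have hM : Commute shiftSum evolOp := (commute_shiftOp 1).add_left (commute_shiftOp (-1))
  have hK : Commute shiftDiff evolOp := (commute_shiftOp 1).sub_left (commute_shiftOp (-1))
  have hMb : UnifBdd fun _ => shiftSum := (unifBdd_shiftOp 1).add (unifBdd_shiftOp (-1))
  obtain ⟨C, hC, h⟩ := ((((UnifBdd.ofNat 9).mul (unifBdd_orbitDefect 5)).sub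
    (unifBdd_orbitDefect 3)).sub (unifBdd_orbitDefect 1)).sub
    ((UnifBdd.ofNat 8).mul (hMb.mul (unifBdd_orbitDefect 2)))
  refine ⟨‖toLine (position (velocityDenom.app χ))‖ + C * ‖toLine χ‖, by positivity, fun t => ?_⟩
  have key := comm_pow_mul_of_dispersion hM hK comm_position_shiftSum dispersion t
  rw [← velocityDenom, ← velocityNum] at key
  set E := 9 * orbitDefect evolOp positionOp 5 t - orbitDefect evolOp positionOp 3 t -
    orbitDefect evolOp positionOp 1 t - 8 * (shiftSum * orbitDefect evolOp positionOp 2 t) with hE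
  have h2 := congrArg (fun T : StateOp => T.app χ) key
  simp only [comm, StateOp.app_mul, StateOp.app_sub, StateOp.app_natCast] at h2
  -- The commutator differs from the position at time t by U^t applied to the position at time 0,
  -- whose norm does not depend on t.
  have h3 : position ((evolOp ^ t).app (velocityDenom.app χ)) -
      (t : ℂ) • (evolOp ^ t).app (velocityNum.app χ) =
      (evolOp ^ t).app (position (velocityDenom.app χ)) - E.app χ := by
    change position _ - (evolOp ^ t).app (position _) = _ at h2
    rw [sub_eq_iff_eq_add.1 h2]; abel
  rw [h3, map_sub]
  refine (norm_sub_le _ _).trans (add_le_add ?_ (h t χ))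
  rw [norm_toLine_evolOp_pow]


/-! ### Density of the range of the velocity denominator -/

section Symbols

variable {σ : Sheet} {y : ℝ}

/-- The real factor of the symbol of the velocity denominator. -/
def denomFactor (b : Bool) (y : ℝ) : ℝ := bandSin b y * (3 * bandX b y - 7)

/-- The symbol of the velocity denominator. -/
def denomSymbol (σ : Sheet) (y : ℝ) : ℂ :=
  8 * Complex.I * eig σ y ^ 2 * ((sg σ.2.2 * denomFactor σ.1 y : ℝ) : ℂ)

/-- The z-derivative of the dispersion polynomial is 4z²(z - z⁻¹)(27l² - 7), and z - z⁻¹ = 2i sin θ.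
It has no zero inside an open band. -/
theorem bloch_velocityDenom (hy : y ∈ Set.Ioo (-edge σ.1) (edge σ.1)) (χ : FiniteState) :
    bloch σ y (velocityDenom.app χ) = denomSymbol σ y * bloch σ y χ := by
  have h1 : evolOp.app χ = (evolOp ^ 1).app χ := by rw [pow_one]
  simp only [velocityDenom, StateOp.app_sub, StateOp.app_mul, StateOp.app_ofNat, h1, map_sub,
    map_smul, bloch_evolOp_pow hy, bloch_shiftSum hy, smul_eq_mul]
  have h2 := eig_mul_invEig hy
  have h3 := eig_add_invEig σ y
  have h4 : eig σ y - invEig σ y = 2 * ((sg σ.2.2 * bandSin σ.1 y : ℝ) : ℂ) * Complex.I := by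
    rw [eig, invEig]; ring
  have h5 : (bandX σ.1 y : ℂ) = 9 * (vertexEig σ.1 σ.2.1 y : ℂ) ^ 2 := by
    have := vertexEig_sq σ.2.1 hy
    rw [← Complex.ofReal_pow, this]; push_cast; ring
  have hl : (vertexEig σ.1 σ.2.1 y : ℂ) = (eig σ y + invEig σ y) / 2 := by rw [h3]; ring
  have hb : denomSymbol σ y = 4 * eig σ y ^ 2 * (eig σ y - invEig σ y) *
      (3 * (9 * ((eig σ y + invEig σ y) / 2) ^ 2) - 7) := by
    rw [h4, ← hl, ← h5, denomSymbol, denomFactor]; push_cast; ring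
  rw [hb, ← vertexEig_cubic_complex hy, hl]
  generalize eig σ y = z at *
  generalize invEig σ y = ζ at *
  have key : 54 * z ^ 5 - 4 * z ^ 3 - 2 * z -
      24 * ((9 * ((z + ζ) / 2) ^ 3 - 7 * ((z + ζ) / 2)) * z ^ 2) -
      4 * z ^ 2 * (z - ζ) * (3 * (9 * ((z + ζ) / 2) ^ 2) - 7) = 0 := by
    linear_combination (-108 * z ^ 3 - 54 * z ^ 2 * ζ + 2 * z) * h2
  linear_combination (bloch σ y χ) * key

/-- This is where the coordinate y is recognized as the group velocity: the imaginary part of the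
phase is `sinMom`, which is y(3x - 7)|sin θ|/2 up to the sign of the sheet. -/
theorem bloch_velocityNum (hy : y ∈ Set.Ioo (-edge σ.1) (edge σ.1)) (χ : FiniteState) :
    bloch σ y (velocityNum.app χ) = y * (denomSymbol σ y * bloch σ y χ) := by
  simp only [velocityNum, StateOp.app_mul, StateOp.app_ofNat, map_smul, bloch_evolOp_pow hy,
    bloch_shiftDiff hy, smul_eq_mul]
  rw [blochPhase_inv hy, blochPhase, denomSymbol, denomFactor, sinMom]
  push_cast
  ring

theorem denomFactor_ne_zero {b : Bool} (hy : y ∈ Set.Ioo (-edge b) (edge b)) :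
    denomFactor b y ≠ 0 :=
  mul_ne_zero (bandSin_pos hy).ne' (bandX_ne hy)

theorem denomFactor_sq_lt {b : Bool} (hy : y ∈ Set.Ioo (-edge b) (edge b)) :
    denomFactor b y ^ 2 ≤ 400 := by
  have h1 := bandX_pos hy
  have h2 := bandX_lt hy
  rw [denomFactor, mul_pow, bandSin_sq hy]
  have h3 : (3 * bandX b y - 7) ^ 2 ≤ 400 := by nlinarith
  nlinarith [sq_nonneg (3 * bandX b y - 7)]

end Symbols

/-- Iterates of the contraction whose limit shows that `velocityDenom` has dense range. -/
def residual (χ : FiniteState) : ℕ → FiniteState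
  | 0 => χ
  | n + 1 => residual χ n + (1 / 25600 : ℂ) • velocityDenom.app
      (velocityDenom.app (evolInv (evolInv (evolInv (evolInv (residual χ n))))))

/-- Four inverse steps cancel the factor z⁴ in the square of the denominator symbol, so one
iteration multiplies by 1 - 64d²/25600, where d is `denomFactor`. The constant is 64 · 400, and d² ≤
400 because 3x - 7 lies between -7 and 20. -/
theorem bloch_residual {σ : Sheet} {y : ℝ} (hy : y ∈ Set.Ioo (-edge σ.1) (edge σ.1))
    (χ : FiniteState) (n : ℕ) : bloch σ y (residual χ n) =
      (((1 - denomFactor σ.1 y ^ 2 / 400) ^ n : ℝ) : ℂ) * bloch σ y χ := by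
  induction n with
  | zero => simp [residual]
  | succ n ih =>
    simp only [residual, map_add, map_smul, bloch_velocityDenom hy, bloch_evolInv hy, ih,
      smul_eq_mul, denomSymbol]
    have h2 := eig_mul_invEig hy
    have hs : ((sg σ.2.2 : ℝ) : ℂ) ^ 2 = 1 := by exact_mod_cast sg_sq σ.2.2
    have h4 : eig σ y ^ 4 * invEig σ y ^ 4 = 1 := by rw [← mul_pow, h2, one_pow]
    push_cast
    generalize bloch σ y χ = w
    generalize (denomFactor σ.1 y : ℂ) = d
    rw [pow_succ (1 - d ^ 2 / 400) n]
    generalize (1 - d ^ 2 / 400) ^ n = r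
    generalize ((sg σ.2.2 : ℝ) : ℂ) = s at *
    linear_combination (r * w * d ^ 2 / 400 * s ^ 2 * eig σ y ^ 4 * invEig σ y ^ 4) *
      Complex.I_sq - (r * w * d ^ 2 / 400 * s ^ 2) * h4 - (r * w * d ^ 2 / 400) * hs

theorem residual_mem (χ : FiniteState) (n : ℕ) :
    ∃ χ', χ - residual χ n = velocityDenom.app χ' := by
  induction n with
  | zero => exact ⟨0, by simp [residual]⟩
  | succ n ih =>
    obtain ⟨χ', h⟩ := ih
    refine ⟨χ' - (1 / 25600 : ℂ) • velocityDenom.app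
      (evolInv (evolInv (evolInv (evolInv (residual χ n))))), ?_⟩
    rw [map_sub, ← h, map_smul, residual]
    abel

theorem norm_toLine_sq_eq_integral (χ : FiniteState) :
    ‖toLine χ‖ ^ 2 = ∫ y : ℝ, ‖waveSum χ y‖ ^ 2 := by
  have h := inner_powWave 0 χ
  rw [powWave_zero, inner_self_eq_norm_sq_to_K, spectral.norm_map] at h
  simp only [pow_zero, one_mul] at h
  exact Complex.ofReal_injective (by simpa using h)

theorem norm_waveSum_sq (χ : FiniteState) (y : ℝ) :
    ‖waveSum χ y‖ ^ 2 = ∑ σ, ‖waveSum χ y σ‖ ^ 2 := EuclideanSpace.norm_sq_eq _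

theorem waveSum_residual (χ : FiniteState) (n : ℕ) (y : ℝ) (σ : Sheet) :
    waveSum (residual χ n) y σ =
      (((1 - denomFactor σ.1 y ^ 2 / 400) ^ n : ℝ) : ℂ) * waveSum χ y σ := by
  rw [waveSum_apply, waveSum_apply]
  split_ifs with hy
  · rw [bloch_residual hy]; ring
  · simp

theorem integrable_norm_waveSum_sq (χ : FiniteState) :
    Integrable fun y : ℝ => ‖waveSum χ y‖ ^ 2 :=
  (memLp_two_iff_integrable_sq_norm (memLp_waveSum χ).1).1 (memLp_waveSum χ)

/-- On the open bands the contraction factor lies in [0, 1), though not uniformly away from 1.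
Dominated convergence suffices. -/
theorem tendsto_norm_residual (χ : FiniteState) :
    Tendsto (fun n => ‖toLine (residual χ n)‖ ^ 2) atTop (𝓝 0) := by
  simp only [norm_toLine_sq_eq_integral]
  rw [show (0 : ℝ) = ∫ _ : ℝ, (0 : ℝ) by simp]
  have hfac : ∀ (σ : Sheet) (y : ℝ), y ∈ Set.Ioo (-edge σ.1) (edge σ.1) →
      0 ≤ 1 - denomFactor σ.1 y ^ 2 / 400 ∧ 1 - denomFactor σ.1 y ^ 2 / 400 < 1 := fun σ y hy => by
    have h1 := denomFactor_sq_lt hy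
    have h2 := denomFactor_ne_zero hy
    have h3 : 0 < denomFactor σ.1 y ^ 2 := by positivity
    constructor <;> linarith
  refine tendsto_integral_of_dominated_convergence (fun y => ‖waveSum χ y‖ ^ 2)
    (fun n => (integrable_norm_waveSum_sq _).1) (integrable_norm_waveSum_sq χ)
    (fun n => Eventually.of_forall fun y => ?_) (Eventually.of_forall fun y => ?_)
  · rw [Real.norm_of_nonneg (by positivity), norm_waveSum_sq, norm_waveSum_sq]
    refine Finset.sum_le_sum fun σ _ => pow_le_pow_left₀ (norm_nonneg _) ?_ 2
    rw [waveSum_residual]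
    by_cases hy : y ∈ Set.Ioo (-edge σ.1) (edge σ.1)
    · obtain ⟨h1, h2⟩ := hfac σ y hy
      rw [norm_mul, Complex.norm_real, norm_pow, Real.norm_of_nonneg h1]
      exact mul_le_of_le_one_left (norm_nonneg _) (pow_le_one₀ h1 h2.le)
    · simp [waveSum_apply, hy]
  · simp only [norm_waveSum_sq]
    rw [show (0 : ℝ) = ∑ σ : Sheet, (0 : ℝ) by simp]
    refine tendsto_finsetSum _ fun σ _ => ?_
    simp only [waveSum_residual]
    by_cases hy : y ∈ Set.Ioo (-edge σ.1) (edge σ.1)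
    · obtain ⟨h1, h2⟩ := hfac σ y hy
      have h3 := tendsto_pow_atTop_nhds_zero_of_lt_one h1 h2
      have h4 := ((Complex.continuous_ofReal.tendsto 0).comp h3).mul_const (waveSum χ y σ)
      have h5 := (h4.norm).pow 2
      simpa using h5
    · simp [waveSum_apply, hy]

theorem exists_velocityDenom_near (χ : FiniteState) {ε : ℝ} (hε : 0 < ε) :
    ∃ χ', ‖toLine (χ - velocityDenom.app χ')‖ ≤ ε := by
  obtain ⟨n, hn⟩ := ((tendsto_norm_residual χ).eventually
    (gt_mem_nhds (show 0 < ε ^ 2 by positivity))).exists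
  obtain ⟨χ', h⟩ := residual_mem χ n
  refine ⟨χ', ?_⟩
  rw [← h, sub_sub_cancel]
  exact (pow_lt_pow_iff_left₀ (norm_nonneg _) hε.le two_ne_zero).1 hn |>.le

/-! ### Finite speed of propagation -/

/-- The state vanishes outside the cells of label at most `r` in absolute value. -/
def SpreadWithin (r : ℝ) (χ : FiniteState) : Prop := ∀ e, χ e ≠ 0 → |(e.1 : ℝ)| ≤ r

theorem exists_spreadWithin (χ : FiniteState) : ∃ r, 0 ≤ r ∧ SpreadWithin r χ := by
  refine ⟨∑ e ∈ χ.support, |(e.1 : ℝ)|, by positivity, fun e he => ?_⟩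
  exact Finset.single_le_sum (f := fun e : ℤ × Fin 6 => |(e.1 : ℝ)|) (fun _ _ => abs_nonneg _)
    (Finsupp.mem_support_iff.2 he)

namespace SpreadWithin

variable {r : ℝ} {χ χ' : FiniteState}

theorem eq_zero (h : SpreadWithin r χ) {e : ℤ × Fin 6} (he : r < |(e.1 : ℝ)|) : χ e = 0 := by
  by_contra h0
  exact absurd (h e h0) (not_le.2 he)

theorem sub (h : SpreadWithin r χ) (h' : SpreadWithin r χ') : SpreadWithin r (χ - χ') := by
  intro e he
  by_contra h0
  rw [not_le] at h0
  rw [Finsupp.sub_apply, h.eq_zero h0, h'.eq_zero h0, sub_zero] at he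
  exact he rfl

theorem mono {s : ℝ} (h : SpreadWithin r χ) (hs : r ≤ s) : SpreadWithin s χ :=
  fun e he => (h e he).trans hs

theorem smul (h : SpreadWithin r χ) (a : ℂ) : SpreadWithin r (a • χ) := fun e he =>
  h e fun h0 => he (by simp [h0])

theorem position (h : SpreadWithin r χ) : SpreadWithin r (position χ) := fun e he =>
  h e fun h0 => he (by rw [position_apply, h0, mul_zero])

/-- The coins act inside a cell, and arc reversal moves the label by at most one. -/
theorem evol (h : SpreadWithin r χ) : SpreadWithin (r + 1) (evol χ) := by
  intro e he
  by_contra h0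
  rw [not_le] at h0
  apply he
  rw [evol_apply, evolFun]
  have hr : r < |((rev e).1 : ℝ)| := by
    have h1 : |((rev e).1 : ℝ) - e.1| ≤ 1 := by
      obtain ⟨j, i⟩ := e
      fin_cases i <;> simp [rev]
    have h2 := abs_sub_abs_le_abs_sub (e.1 : ℝ) ((rev e).1)
    rw [abs_sub_comm] at h2
    linarith
  have hz : ∀ i, χ ((rev e).1, i) = 0 := fun i => h.eq_zero hr
  simp only [coin, hz]
  generalize (rev e).2 = i
  fin_cases i <;> simp

theorem evolOp_pow (h : SpreadWithin r χ) (t : ℕ) : SpreadWithin (r + t) ((evolOp ^ t).app χ) := by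
  induction t with
  | zero => rw [Nat.cast_zero, add_zero]; exact h
  | succ t ih =>
    rw [pow_succ', StateOp.app_mul, app_evolOp]
    push_cast
    rw [← add_assoc]
    exact ih.evol

theorem norm_toLine_position_le (h : SpreadWithin r χ) (hr : 0 ≤ r) :
    ‖toLine (LineWalk.position χ)‖ ≤ r * ‖toLine χ‖ := by
  refine norm_le_of_forall_le hr fun e => ?_
  rw [toLine_apply, toLine_apply, position_apply, norm_mul]
  by_cases h0 : χ e = 0
  · simp [h0]
  · refine mul_le_mul_of_nonneg_right ?_ (norm_nonneg _)
    simpa using h e h0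

end SpreadWithin

/-! ### Convergence of the moments -/

/-- The state at time `t` multiplied by the `n`-th power of the velocity. -/
def velocityPow (χ : FiniteState) (t : ℕ) : ℕ → FiniteState
  | 0 => (evolOp ^ t).app χ
  | n + 1 => (t : ℂ)⁻¹ • position (velocityPow χ t n)

theorem velocityPow_apply (χ : FiniteState) (t n : ℕ) (e : ℤ × Fin 6) :
    velocityPow χ t n e = ((((e.1 : ℝ) / t) ^ n : ℝ) : ℂ) * (evolOp ^ t).app χ e := by
  induction n with
  | zero => simp [velocityPow]
  | succ n ih =>
    rw [velocityPow, Finsupp.smul_apply, position_apply, ih]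
    push_cast
    rw [smul_eq_mul, pow_succ]; ring

theorem spreadWithin_velocityPow {r : ℝ} {χ : FiniteState} (h : SpreadWithin r χ) (t n : ℕ) :
    SpreadWithin (r + t) (velocityPow χ t n) := by
  induction n with
  | zero => exact h.evolOp_pow t
  | succ n ih => exact ih.position.smul _

theorem powWave_velocity (χ : FiniteState) :
    powWave 0 (velocityNum.app χ) = powWave 1 (velocityDenom.app χ) := by
  refine MemLp.toLp_congr _ _ (Eventually.of_forall fun y => ?_)
  ext σ
  simp only [PiLp.smul_apply, waveSum_apply, smul_eq_mul]
  split_ifs with hy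
  · rw [bloch_velocityNum hy, bloch_velocityDenom hy]; push_cast; ring
  · simp

theorem norm_powWave_zero_sub (χ χ' : FiniteState) :
    ‖powWave 0 χ - powWave 0 χ'‖ = ‖toLine (χ - χ')‖ := by
  rw [powWave_zero, powWave_zero, ← map_sub, ← map_sub, spectral.norm_map]

/-- One fixed state χ stands for y^n η, approximately: it describes the n-th power of the rescaled
position at all large times and has nearly the right spectral transform. The two estimates run
through the induction together. -/
theorem exists_velocityPow_near (η : FiniteState) (n : ℕ) {ε : ℝ} (hε : 0 < ε) :
    ∃ χ, (∀ᶠ t : ℕ in atTop, ‖toLine (velocityPow η t n - (evolOp ^ t).app χ)‖ ≤ ε) ∧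
      ‖powWave 0 χ - powWave n η‖ ≤ ε := by
  induction n generalizing ε with
  | zero => exact ⟨η, Eventually.of_forall fun t => by simp [velocityPow, hε.le], by simp [hε.le]⟩
  | succ n ih =>
    obtain ⟨χ, h1, h2⟩ := ih (show 0 < ε / 6 by positivity)
    obtain ⟨χ', h3⟩ := exists_velocityDenom_near χ (show 0 < ε / 6 by positivity)
    obtain ⟨C, hC, h4⟩ := norm_position_evolOp_pow_le χ'
    obtain ⟨r₁, hr₁, hs₁⟩ := exists_spreadWithin η
    obtain ⟨r₂, hr₂, hs₂⟩ := exists_spreadWithin χ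
    obtain ⟨r₃, hr₃, hs₃⟩ := exists_spreadWithin (velocityDenom.app χ')
    -- χ ≈ Dχ', and the symbol of N is y times that of D, so Nχ' is approximately y times χ.
    refine ⟨velocityNum.app χ', ?_, ?_⟩
    · filter_upwards [h1, eventually_ge_atTop 1, eventually_ge_atTop ⌈r₁ + r₂ + r₃⌉₊,
        eventually_ge_atTop ⌈3 * C / ε⌉₊] with t ht h1t hrt hCt
      have hrt' : r₁ + r₂ + r₃ ≤ t := Nat.ceil_le.1 hrt
      have hCt' : 3 * C / ε ≤ t := Nat.ceil_le.1 hCt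
      have ht0 : (0 : ℝ) < t := by exact_mod_cast h1t
      set a := velocityPow η t n - (evolOp ^ t).app χ with ha
      set b := (evolOp ^ t).app (χ - velocityDenom.app χ') with hb
      set c := LineWalk.position ((evolOp ^ t).app (velocityDenom.app χ')) -
        (t : ℂ) • (evolOp ^ t).app (velocityNum.app χ') with hc
      -- For t ≥ r₁ + r₂ + r₃ all states live in cells with label at most 2t in modulus, so there
      -- the position operator costs at most 2t, which the division by t absorbs.
      have hsa : SpreadWithin (2 * t) a :=
        ((spreadWithin_velocityPow hs₁ t n).mono (by linarith)).sub
          ((hs₂.evolOp_pow t).mono (by linarith))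
      have hsb : SpreadWithin (2 * t) b := by
        rw [hb, map_sub]
        exact ((hs₂.evolOp_pow t).mono (by linarith)).sub ((hs₃.evolOp_pow t).mono (by linarith))
      have hb' : ‖toLine b‖ ≤ ε / 6 := by rw [hb, norm_toLine_evolOp_pow]; exact h3
      -- Three errors: the induction hypothesis, the approximation of χ by Dχ', and the ballistic
      -- remainder. They contribute at most 2(ε/6), 2(ε/6) and ε/3.
      have hdec : velocityPow η t (n + 1) - (evolOp ^ t).app (velocityNum.app χ') =
          (t : ℂ)⁻¹ • (LineWalk.position a + LineWalk.position b + c) := by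
        have h0 : (t : ℂ)⁻¹ * t = 1 := inv_mul_cancel₀ (by exact_mod_cast ht0.ne')
        rw [velocityPow, ha, hb, hc, map_sub, map_sub, map_sub]
        rw [show LineWalk.position (velocityPow η t n) - LineWalk.position ((evolOp ^ t).app χ) +
          (LineWalk.position ((evolOp ^ t).app χ) -
            LineWalk.position ((evolOp ^ t).app (velocityDenom.app χ'))) +
          (LineWalk.position ((evolOp ^ t).app (velocityDenom.app χ')) -
            (t : ℂ) • (evolOp ^ t).app (velocityNum.app χ')) =
          LineWalk.position (velocityPow η t n) -
            (t : ℂ) • (evolOp ^ t).app (velocityNum.app χ') by abel, smul_sub, smul_smul, h0,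
          one_smul]
      rw [hdec, map_smul, norm_smul, norm_inv, Complex.norm_natCast, inv_mul_le_iff₀ ht0, map_add,
        map_add]
      refine (norm_add₃_le).trans ?_
      have e1 := hsa.norm_toLine_position_le (by positivity)
      have e2 := hsb.norm_toLine_position_le (by positivity)
      have e3 : C ≤ t * (ε / 3) := by
        rw [div_le_iff₀ hε] at hCt'; linarith
      have e4 : 2 * t * ‖toLine a‖ ≤ 2 * t * (ε / 6) := mul_le_mul_of_nonneg_left ht (by positivity)
      have e5 : 2 * t * ‖toLine b‖ ≤ 2 * t * (ε / 6) := mul_le_mul_of_nonneg_left hb' (by positivity)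
      linarith [h4 t]
    · rw [powWave_velocity, norm_sub_rev]
      refine (norm_powWave_succ_sub_le n _ _).trans ?_
      rw [norm_sub_rev]
      refine (norm_sub_le_norm_sub_add_norm_sub _ (powWave 0 χ) _).trans ?_
      rw [norm_powWave_zero_sub, ← neg_sub χ, map_neg, norm_neg]
      linarith

theorem tendsto_inner_velocityPow (η : FiniteState) (n : ℕ) :
    Tendsto (fun t : ℕ => inner ℂ (toLine ((evolOp ^ t).app η)) (toLine (velocityPow η t n))) atTop
      (𝓝 (inner ℂ (spectral (toLine η)) (powWave n η))) := by
  rw [Metric.tendsto_atTop']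
  intro ε hε
  set δ := ε / (2 * ‖toLine η‖ + 1) with hδ
  have hpos : 0 < 2 * ‖toLine η‖ + 1 := by positivity
  obtain ⟨χ, h1, h2⟩ := exists_velocityPow_near η n (show 0 < δ by positivity)
  obtain ⟨N, hN⟩ := eventually_atTop.1 h1
  refine ⟨N, fun t ht => ?_⟩
  -- The evolution is isometric, so after replacing the power of the position by χ the inner product
  -- no longer depends on t.
  have hiso : inner ℂ (toLine ((evolOp ^ t).app η)) (toLine ((evolOp ^ t).app χ)) =
      inner ℂ (spectral (toLine η)) (powWave 0 χ) := by
    rw [powWave_zero, spectral.inner_map_map, toLine_evolOp_pow, toLine_evolOp_pow]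
    generalize toLine η = ψ
    generalize toLine χ = φ
    clear h1 h2 hN ht hδ
    induction t generalizing ψ φ with
    | zero => rfl
    | succ t ih => rw [Function.iterate_succ_apply, Function.iterate_succ_apply, ih,
        lineEvol.inner_map_map]
  have e : inner ℂ (toLine ((evolOp ^ t).app η)) (toLine (velocityPow η t n)) -
      inner ℂ (spectral (toLine η)) (powWave n η) =
      inner ℂ (toLine ((evolOp ^ t).app η))
        (toLine (velocityPow η t n - (evolOp ^ t).app χ)) +
      inner ℂ (spectral (toLine η)) (powWave 0 χ - powWave n η) := by
    rw [map_sub, inner_sub_right, inner_sub_right, hiso]; ring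
  rw [dist_eq_norm, e]
  refine (norm_add_le _ _).trans_lt ?_
  have e1 := norm_inner_le_norm (𝕜 := ℂ) (toLine ((evolOp ^ t).app η))
    (toLine (velocityPow η t n - (evolOp ^ t).app χ))
  have e2 := norm_inner_le_norm (𝕜 := ℂ) (spectral (toLine η)) (powWave 0 χ - powWave n η)
  rw [norm_toLine_evolOp_pow] at e1
  rw [spectral.norm_map] at e2
  have e3 := mul_le_mul_of_nonneg_left (hN t ht.le) (norm_nonneg (toLine η))
  have e4 := mul_le_mul_of_nonneg_left h2 (norm_nonneg (toLine η))
  have e5 : δ * (2 * ‖toLine η‖ + 1) = ε := div_mul_cancel₀ ε hpos.ne'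
  have e6 : 0 < δ := by positivity
  nlinarith

/-- The average of a function of the velocity at time `t`. -/
def velocityMean (g : ℝ → ℝ) (ψ : LineSpace) (t : ℕ) : ℝ :=
  ∑' e : ℤ × Fin 6, g ((e.1 : ℝ) / t) * ‖(lineEvol^[t] ψ) e‖ ^ 2

/-- The n-th moment of the rescaled position is the inner product of U^t η with (X/t)^n U^t η. -/
theorem tendsto_velocityMean_pow (η : FiniteState) (n : ℕ) :
    Tendsto (velocityMean (fun y => y ^ n) (toLine η)) atTop
      (𝓝 (∫ y : ℝ, y ^ n * ‖waveSum η y‖ ^ 2)) := by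
  have h := tendsto_inner_velocityPow η n
  rw [inner_powWave] at h
  have h2 := (Complex.continuous_re.tendsto _).comp h
  rw [Complex.ofReal_re] at h2
  refine h2.congr fun t => ?_
  have e : inner ℂ (toLine ((evolOp ^ t).app η)) (toLine (velocityPow η t n)) =
      ((velocityMean (fun y => y ^ n) (toLine η) t : ℝ) : ℂ) := by
    rw [lp.inner_eq_tsum, velocityMean, Complex.ofReal_tsum]
    refine tsum_congr fun e => ?_
    rw [← toLine_evolOp_pow, toLine_apply, toLine_apply, velocityPow_apply, RCLike.inner_apply]
    push_cast
    rw [mul_assoc, Complex.mul_conj']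
  rw [Function.comp_apply, e, Complex.ofReal_re]


/-! ### Weak convergence for finitely supported states -/

section FiniteState

variable (η : FiniteState)

theorem iterate_lineEvol_toLine (t : ℕ) (e : ℤ × Fin 6) :
    (lineEvol^[t] (toLine η)) e = (evolOp ^ t).app η e := by
  rw [← toLine_evolOp_pow, toLine_apply]

theorem summable_velocityMean_toLine (g : ℝ → ℝ) (t : ℕ) :
    Summable fun e : ℤ × Fin 6 => g ((e.1 : ℝ) / t) * ‖(lineEvol^[t] (toLine η)) e‖ ^ 2 := by
  refine summable_of_hasFiniteSupport (((evolOp ^ t).app η).support.finite_toSet.subset ?_)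
  intro e he
  rw [Finset.mem_coe, Finsupp.mem_support_iff, ← iterate_lineEvol_toLine]
  intro h
  simp [h] at he

theorem norm_iterate_lineEvol (ψ : LineSpace) (t : ℕ) : ‖lineEvol^[t] ψ‖ = ‖ψ‖ := by
  induction t generalizing ψ with
  | zero => rfl
  | succ t ih => rw [Function.iterate_succ_apply, ih, lineEvol.norm_map]

theorem velocityMean_add (f g : ℝ → ℝ) (t : ℕ) :
    velocityMean (fun y => f y + g y) (toLine η) t =
      velocityMean f (toLine η) t + velocityMean g (toLine η) t := by
  simp only [velocityMean, add_mul]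
  exact (summable_velocityMean_toLine η f t).tsum_add (summable_velocityMean_toLine η g t)

theorem velocityMean_const_mul (c : ℝ) (f : ℝ → ℝ) (ψ : LineSpace) (t : ℕ) :
    velocityMean (fun y => c * f y) ψ t = c * velocityMean f ψ t := by
  simp only [velocityMean, mul_assoc, tsum_mul_left]

theorem velocityMean_mono {f g : ℝ → ℝ} (h : ∀ y, f y ≤ g y) (t : ℕ) :
    velocityMean f (toLine η) t ≤ velocityMean g (toLine η) t :=
  (summable_velocityMean_toLine η f t).tsum_le_tsum
    (fun e => mul_le_mul_of_nonneg_right (h _) (by positivity))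
    (summable_velocityMean_toLine η g t)

theorem integrable_mul_norm_waveSum_sq {g : ℝ → ℝ} (hg : Continuous g) :
    Integrable fun y : ℝ => g y * ‖waveSum η y‖ ^ 2 := by
  obtain ⟨C, hC⟩ := (isCompact_Icc (a := (-1 : ℝ)) (b := 1)).exists_bound_of_continuousOn
    hg.continuousOn
  refine ((integrable_norm_waveSum_sq η).const_mul C).mono
    (hg.aestronglyMeasurable.mul (integrable_norm_waveSum_sq η).1) (Eventually.of_forall fun y => ?_)
  rw [norm_mul, norm_mul]
  rcases le_or_gt 1 |y| with h | h
  · simp [waveSum_eq_zero h]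
  · refine mul_le_mul_of_nonneg_right ((hC y ?_).trans (le_abs_self C)) (norm_nonneg _)
    exact ⟨(abs_lt.1 h).1.le, (abs_lt.1 h).2.le⟩

theorem tendsto_velocityMean_polynomial (p : Polynomial ℝ) :
    Tendsto (velocityMean (fun y => p.eval y) (toLine η)) atTop
      (𝓝 (∫ y : ℝ, p.eval y * ‖waveSum η y‖ ^ 2)) := by
  induction p using Polynomial.induction_on' with
  | add p q hp hq =>
    simp only [Polynomial.eval_add, add_mul]
    rw [integral_add (integrable_mul_norm_waveSum_sq η p.continuous)
      (integrable_mul_norm_waveSum_sq η q.continuous)]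
    exact (hp.add hq).congr fun t => (velocityMean_add η _ _ t).symm
  | monomial n a =>
    simp only [Polynomial.eval_monomial, mul_assoc]
    rw [integral_const_mul]
    exact ((tendsto_velocityMean_pow η n).const_mul a).congr fun t =>
      (velocityMean_const_mul a _ _ t).symm

theorem tendsto_velocityMean_continuous {g : ℝ → ℝ} (hg : Continuous g) :
    Tendsto (velocityMean g (toLine η)) atTop (𝓝 (∫ y : ℝ, g y * ‖waveSum η y‖ ^ 2)) := by
  rw [Metric.tendsto_atTop']
  intro ε hε
  have hN : 0 < 2 * ‖toLine η‖ ^ 2 + 1 := by positivity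
  -- At times t ≥ r the rescaled position lies in [-2, 2], and the limit law lives in |y| < 1;
  -- approximation on this interval controls both.
  obtain ⟨p, hp⟩ := exists_polynomial_near_of_continuousOn (-2) 2 g hg.continuousOn
    (ε / (2 * ‖toLine η‖ ^ 2 + 1) / 2) (by positivity)
  set δ := ε / (2 * ‖toLine η‖ ^ 2 + 1) / 2 with hδ
  have hδε : δ * (2 * (2 * ‖toLine η‖ ^ 2 + 1)) = ε := by rw [hδ]; field_simp
  obtain ⟨N, hN'⟩ := (Metric.tendsto_atTop'.1 (tendsto_velocityMean_polynomial η p)) (ε / 2)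
    (by positivity)
  obtain ⟨r, hr, hs⟩ := exists_spreadWithin η
  refine ⟨max N ⌈r⌉₊, fun t ht => ?_⟩
  have htN : N < t := (le_max_left _ _).trans_lt ht
  have htr : r ≤ t := (Nat.ceil_le.1 ((le_max_right _ _).trans ht.le))
  have ht0 : (0 : ℝ) < t := by exact_mod_cast (Nat.zero_le N).trans_lt htN
  have hi : |(∫ y : ℝ, g y * ‖waveSum η y‖ ^ 2) - ∫ y : ℝ, p.eval y * ‖waveSum η y‖ ^ 2| ≤
      δ * ‖toLine η‖ ^ 2 := by
    rw [← integral_sub (integrable_mul_norm_waveSum_sq η hg)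
      (integrable_mul_norm_waveSum_sq η p.continuous), norm_toLine_sq_eq_integral,
      ← integral_const_mul, ← Real.norm_eq_abs]
    refine norm_integral_le_of_norm_le ((integrable_norm_waveSum_sq η).const_mul δ)
      (Eventually.of_forall fun y => ?_)
    rcases le_or_gt 1 |y| with h | h
    · simp [waveSum_eq_zero h]
    · have := hp y ⟨by linarith [(abs_lt.1 h).1], by linarith [(abs_lt.1 h).2]⟩
      rw [← sub_mul, norm_mul, norm_pow, norm_norm, Real.norm_eq_abs, abs_sub_comm]
      exact mul_le_mul_of_nonneg_right this.le (by positivity)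
  have hm : |velocityMean g (toLine η) t - velocityMean (fun y => p.eval y) (toLine η) t| ≤
      δ * ‖toLine η‖ ^ 2 := by
    have hsum := (summable_norm_sq (lineEvol^[t] (toLine η))).mul_left δ
    rw [velocityMean, velocityMean, ← (summable_velocityMean_toLine η g t).tsum_sub
      (summable_velocityMean_toLine η (fun y => p.eval y) t), ← norm_iterate_lineEvol (toLine η) t,
      norm_sq_eq_tsum, ← tsum_mul_left, ← Real.norm_eq_abs]
    refine tsum_of_norm_bounded hsum.hasSum fun e => ?_
    rw [← sub_mul, norm_mul, norm_pow, norm_norm]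
    by_cases h0 : (evolOp ^ t).app η e = 0
    · simp [iterate_lineEvol_toLine, h0]
    · have h1 := hs.evolOp_pow t e h0
      have h2 : |(e.1 : ℝ) / t| ≤ 2 := by
        rw [abs_div, abs_of_pos ht0, div_le_iff₀ ht0]; linarith
      have := hp _ (abs_le.1 h2)
      rw [Real.norm_eq_abs, abs_sub_comm]
      exact mul_le_mul_of_nonneg_right this.le (by positivity)
  have h3 := hN' t htN
  rw [Real.dist_eq] at h3 ⊢
  have hδ0 : 0 < δ := by positivity
  rw [abs_lt] at h3 ⊢
  rw [abs_le] at hi hm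
  constructor <;> linarith [hi.1, hi.2, hm.1, hm.2, h3.1, h3.2]

theorem tendsto_clamp_upper (x y : ℝ) :
    Tendsto (fun n : ℕ => max 0 (min 1 (1 + (n + 1 : ℝ) * (x - y)))) atTop
      (𝓝 ((Set.Iic x).indicator 1 y)) := by
  by_cases h : y ≤ x
  · rw [Set.indicator_of_mem (by exact h)]
    refine tendsto_const_nhds.congr fun n => ?_
    have : 0 ≤ (n + 1 : ℝ) * (x - y) := mul_nonneg (by positivity) (by linarith)
    rw [min_eq_left (by linarith), max_eq_right zero_le_one, Pi.one_apply]
  · rw [Set.indicator_of_notMem (by exact h)]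
    rw [not_le] at h
    refine tendsto_const_nhds.congr' ?_
    filter_upwards [eventually_ge_atTop ⌈1 / (y - x)⌉₊] with n hn
    have h1 : 1 / (y - x) ≤ n := Nat.ceil_le.1 hn
    rw [div_le_iff₀ (by linarith)] at h1
    have : 1 + (n + 1 : ℝ) * (x - y) ≤ 0 := by linarith
    rw [min_eq_right (by linarith), max_eq_left this]

/-- At y = x the lower ramps stay at 0 while the indicator is 1. A single point is harmless because
the limit law has a density. -/
theorem tendsto_clamp_lower {x y : ℝ} (hxy : y ≠ x) :
    Tendsto (fun n : ℕ => max 0 (min 1 ((n + 1 : ℝ) * (x - y)))) atTop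
      (𝓝 ((Set.Iic x).indicator 1 y)) := by
  by_cases h : y ≤ x
  · rw [Set.indicator_of_mem (by exact h)]
    have h' := lt_of_le_of_ne h hxy
    refine tendsto_const_nhds.congr' ?_
    filter_upwards [eventually_ge_atTop ⌈1 / (x - y)⌉₊] with n hn
    have h1 : 1 / (x - y) ≤ n := Nat.ceil_le.1 hn
    rw [div_le_iff₀ (by linarith)] at h1
    rw [min_eq_left (by linarith), max_eq_right zero_le_one, Pi.one_apply]
  · rw [Set.indicator_of_notMem (by exact h)]
    rw [not_le] at h
    refine tendsto_const_nhds.congr fun n => ?_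
    have : (n + 1 : ℝ) * (x - y) ≤ 0 := mul_nonpos_of_nonneg_of_nonpos (by positivity) (by linarith)
    rw [min_eq_right (by linarith), max_eq_left this]

theorem tendsto_integral_clamp {g : ℕ → ℝ → ℝ} (hg : ∀ n, Continuous (g n))
    (h0 : ∀ n y, 0 ≤ g n y) (h1 : ∀ n y, g n y ≤ 1) {x : ℝ}
    (h : ∀ y, y ≠ x → Tendsto (fun n => g n y) atTop (𝓝 ((Set.Iic x).indicator 1 y))) :
    Tendsto (fun n => ∫ y, g n y * ‖waveSum η y‖ ^ 2) atTop
      (𝓝 (∫ y in Set.Iic x, ‖waveSum η y‖ ^ 2)) := by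
  rw [← integral_indicator measurableSet_Iic]
  refine tendsto_integral_of_dominated_convergence (fun y => ‖waveSum η y‖ ^ 2)
    (fun n => (integrable_mul_norm_waveSum_sq η (hg n)).1) (integrable_norm_waveSum_sq η)
    (fun n => Eventually.of_forall fun y => ?_) ?_
  · rw [Real.norm_of_nonneg (mul_nonneg (h0 n y) (by positivity))]
    exact mul_le_of_le_one_left (by positivity) (h1 n y)
  · have hx : ∀ᵐ y : ℝ, y ≠ x := by simp [ae_iff]
    filter_upwards [hx] with y hy
    have := (h y hy).mul_const (‖waveSum η y‖ ^ 2)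
    have e : (Set.Iic x).indicator (fun y => ‖waveSum η y‖ ^ 2) y =
        (Set.Iic x).indicator 1 y * ‖waveSum η y‖ ^ 2 := by
      by_cases hx : y ∈ Set.Iic x <;> simp [hx]
    rwa [e]

/-- The indicator is squeezed between continuous ramps whose limiting integrals have the same limit.
-/
theorem tendsto_velocityMean_Iic (x : ℝ) :
    Tendsto (velocityMean ((Set.Iic x).indicator 1) (toLine η)) atTop
      (𝓝 (∫ y in Set.Iic x, ‖waveSum η y‖ ^ 2)) := by
  have cu : ∀ n : ℕ, Continuous fun y : ℝ => max 0 (min 1 (1 + (n + 1 : ℝ) * (x - y))) :=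
    fun n => by fun_prop
  have cl : ∀ n : ℕ, Continuous fun y : ℝ => max 0 (min 1 ((n + 1 : ℝ) * (x - y))) :=
    fun n => by fun_prop
  have hu := tendsto_integral_clamp η cu (fun n y => le_max_left _ _)
    (fun n y => max_le zero_le_one (min_le_left _ _)) fun y _ => tendsto_clamp_upper x y
  have hl := tendsto_integral_clamp η cl (fun n y => le_max_left _ _)
    (fun n y => max_le zero_le_one (min_le_left _ _)) fun y hy => tendsto_clamp_lower hy
  rw [tendsto_order] at hu hl ⊢
  constructor
  · intro a ha
    obtain ⟨n, hn⟩ := (hl.1 a ha).exists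
    filter_upwards [(tendsto_order.1 (tendsto_velocityMean_continuous η (cl n))).1 a hn] with t ht
    refine ht.trans_le (velocityMean_mono η (fun y => ?_) t)
    by_cases h : y ≤ x
    · rw [Set.indicator_of_mem (by exact h)]
      exact max_le zero_le_one (min_le_left _ _)
    · rw [Set.indicator_of_notMem (by exact h)]
      exact max_le le_rfl ((min_le_right _ _).trans
        (mul_nonpos_of_nonneg_of_nonpos (by positivity) (by linarith)))
  · intro a ha
    obtain ⟨n, hn⟩ := (hu.2 a ha).exists
    filter_upwards [(tendsto_order.1 (tendsto_velocityMean_continuous η (cu n))).2 a hn] with t ht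
    refine (velocityMean_mono η (fun y => ?_) t).trans_lt ht
    by_cases h : y ≤ x
    · rw [Set.indicator_of_mem (by exact h)]
      refine le_max_of_le_right (le_min le_rfl ?_)
      have : 0 ≤ (n + 1 : ℝ) * (x - y) := mul_nonneg (by positivity) (by linarith)
      simpa using this
    · rw [Set.indicator_of_notMem (by exact h)]
      exact le_max_left _ _

end FiniteState

/-! ### Weak convergence for all states -/

/-- The restriction of a state to a set of sites. -/
def restrictTo (S : Set (ℤ × Fin 6)) (ψ : LineSpace) : LineSpace :=
  ⟨S.indicator ψ, memℓp_two ((summable_norm_sq ψ).of_nonneg_of_le (fun _ => by positivity)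
    fun e => pow_le_pow_left₀ (norm_nonneg _) (norm_indicator_le_norm_self _ _) 2)⟩

theorem restrictTo_apply (S : Set (ℤ × Fin 6)) (ψ : LineSpace) (e : ℤ × Fin 6) :
    restrictTo S ψ e = S.indicator ψ e := rfl

theorem restrictTo_sub (S : Set (ℤ × Fin 6)) (ψ φ : LineSpace) :
    restrictTo S (ψ - φ) = restrictTo S ψ - restrictTo S φ := by
  ext e
  rw [lp.coeFn_sub, Pi.sub_apply]
  simp only [restrictTo_apply, lp.coeFn_sub]
  by_cases h : e ∈ S <;> simp [h]

theorem norm_restrictTo_le (S : Set (ℤ × Fin 6)) (ψ : LineSpace) : ‖restrictTo S ψ‖ ≤ ‖ψ‖ := by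
  rw [← one_mul ‖ψ‖]
  refine norm_le_of_forall_le zero_le_one fun e => ?_
  rw [one_mul]
  exact norm_indicator_le_norm_self _ _

theorem velocityMean_indicator (T : Set ℝ) (ψ : LineSpace) (t : ℕ) :
    velocityMean (T.indicator 1) ψ t =
      ‖restrictTo {e | (e.1 : ℝ) / t ∈ T} (lineEvol^[t] ψ)‖ ^ 2 := by
  rw [norm_sq_eq_tsum, velocityMean]
  refine tsum_congr fun e => ?_
  rw [restrictTo_apply]
  by_cases h : (e.1 : ℝ) / t ∈ T
  · rw [Set.indicator_of_mem h, Set.indicator_of_mem (by exact h), Pi.one_apply, one_mul]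
  · rw [Set.indicator_of_notMem h, Set.indicator_of_notMem (by exact h)]; simp

theorem summable_velocityMean_indicator (T : Set ℝ) (ψ : LineSpace) (t : ℕ) :
    Summable fun e : ℤ × Fin 6 =>
      T.indicator (1 : ℝ → ℝ) ((e.1 : ℝ) / t) * ‖(lineEvol^[t] ψ) e‖ ^ 2 := by
  refine (summable_norm_sq (lineEvol^[t] ψ)).of_nonneg_of_le (fun e => ?_) fun e => ?_
  · exact mul_nonneg (Set.indicator_nonneg (fun _ _ => zero_le_one) _) (by positivity)
  · refine mul_le_of_le_one_left (by positivity) ?_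
    exact Set.indicator_le_self' (fun _ _ => zero_le_one) _

theorem iterate_lineEvol_sub (ψ φ : LineSpace) (t : ℕ) :
    lineEvol^[t] (ψ - φ) = lineEvol^[t] ψ - lineEvol^[t] φ := by
  induction t generalizing ψ φ with
  | zero => rfl
  | succ t ih => simp only [Function.iterate_succ_apply, map_sub, ih]

theorem exists_toLine_near (ψ : LineSpace) {ε : ℝ} (hε : 0 < ε) :
    ∃ η, ‖ψ - toLine η‖ < ε := by
  have h := lp.hasSum_single (p := 2) (by norm_num) ψ
  obtain ⟨s, hs⟩ := (Metric.tendsto_nhds.1 h ε hε).exists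
  refine ⟨∑ e ∈ s, Finsupp.single e (ψ e), ?_⟩
  rw [dist_comm, dist_eq_norm] at hs
  have e : toLine (∑ e ∈ s, Finsupp.single e (ψ e)) = ∑ e ∈ s, lp.single 2 e (ψ e) := by
    rw [map_sum]
    refine Finset.sum_congr rfl fun e _ => ?_
    rw [toLine, Finsupp.linearCombination_single, ← lp.single_smul, smul_eq_mul, mul_one]
  rw [e]
  exact hs

/-- The norm of a spectral function on a set of velocities. -/
def normOn (S : Set ℝ) (f : SpectralSpace) : ℝ :=
  ‖LpToLpRestrictCLM ℝ (EuclideanSpace ℂ Sheet) ℝ volume 2 S f‖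

theorem abs_normOn_sub_le (S : Set ℝ) (f g : SpectralSpace) :
    |normOn S f - normOn S g| ≤ ‖f - g‖ := by
  refine (abs_norm_sub_norm_le _ _).trans ?_
  rw [← map_sub]
  exact norm_Lp_toLp_restrict_le S (f - g)

theorem normOn_sq (S : Set ℝ) (f : SpectralSpace) : normOn S f ^ 2 = ∫ y in S, ‖f y‖ ^ 2 := by
  have h := L2.inner_def (𝕜 := ℂ)
    (LpToLpRestrictCLM ℝ (EuclideanSpace ℂ Sheet) ℝ volume 2 S f)
    (LpToLpRestrictCLM ℝ (EuclideanSpace ℂ Sheet) ℝ volume 2 S f)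
  rw [inner_self_eq_norm_sq_to_K] at h
  have e : ∫ y in S, inner ℂ (LpToLpRestrictCLM ℝ (EuclideanSpace ℂ Sheet) ℝ volume 2 S f y)
      (LpToLpRestrictCLM ℝ (EuclideanSpace ℂ Sheet) ℝ volume 2 S f y) =
      ((∫ y in S, ‖f y‖ ^ 2 : ℝ) : ℂ) := by
    rw [← integral_complex_ofReal]
    refine integral_congr_ae ?_
    filter_upwards [LpToLpRestrictCLM_coeFn ℝ S f] with y hy
    rw [hy, inner_self_eq_norm_sq_to_K]
    push_cast; rfl
  rw [e] at h
  exact Complex.ofReal_injective (by simpa [normOn] using h)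

/-- Both sides are 1-Lipschitz in ψ, uniformly in t, so convergence extends from the dense set of
finitely supported states. Norms instead of squares make the Lipschitz bound immediate. -/
theorem tendsto_norm_restrictTo (ψ : LineSpace) (x : ℝ) :
    Tendsto (fun t : ℕ => ‖restrictTo {e | (e.1 : ℝ) / t ∈ Set.Iic x} (lineEvol^[t] ψ)‖) atTop
      (𝓝 (normOn (Set.Iic x) (spectral ψ))) := by
  rw [Metric.tendsto_nhds]
  intro ε hε
  obtain ⟨η, hη⟩ := exists_toLine_near ψ (show 0 < ε / 3 by positivity)
  have h1 : Tendsto (fun t : ℕ => ‖restrictTo {e | (e.1 : ℝ) / t ∈ Set.Iic x}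
      (lineEvol^[t] (toLine η))‖) atTop (𝓝 (normOn (Set.Iic x) (spectral (toLine η)))) := by
    have h2 := (tendsto_velocityMean_Iic η x).sqrt
    have e : ∫ y in Set.Iic x, ‖waveSum η y‖ ^ 2 =
        normOn (Set.Iic x) (spectral (toLine η)) ^ 2 := by
      rw [normOn_sq]
      refine integral_congr_ae (ae_restrict_of_ae ?_)
      filter_upwards [spectral_toLine η] with y hy
      rw [hy]
    rw [e, Real.sqrt_sq (show 0 ≤ normOn _ _ from norm_nonneg _)] at h2
    refine h2.congr fun t => ?_
    rw [velocityMean_indicator, Real.sqrt_sq (norm_nonneg _)]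
  filter_upwards [Metric.tendsto_nhds.1 h1 (ε / 3) (by positivity)] with t ht
  have h3 : |‖restrictTo {e | (e.1 : ℝ) / t ∈ Set.Iic x} (lineEvol^[t] ψ)‖ -
      ‖restrictTo {e | (e.1 : ℝ) / t ∈ Set.Iic x} (lineEvol^[t] (toLine η))‖| < ε / 3 := by
    refine ((abs_norm_sub_norm_le _ _).trans ?_).trans_lt hη
    rw [← restrictTo_sub, ← iterate_lineEvol_sub]
    exact (norm_restrictTo_le _ _).trans (norm_iterate_lineEvol _ _).le
  have h4 := (abs_normOn_sub_le (Set.Iic x) (spectral ψ) (spectral (toLine η))).trans_lt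
    (by rw [← map_sub, spectral.norm_map]; exact hη)
  rw [Real.dist_eq] at ht ⊢
  rw [abs_lt] at *
  constructor <;> linarith [h3.1, h3.2, h4.1, h4.2, ht.1, ht.2]

/-- The velocity distribution function at time `t` converges to the spectral one. -/
theorem tendsto_velocityMean_spectral (ψ : LineSpace) (x : ℝ) :
    Tendsto (velocityMean ((Set.Iic x).indicator 1) ψ) atTop
      (𝓝 (∫ y in Set.Iic x, ‖spectral ψ y‖ ^ 2)) := by
  rw [← normOn_sq]
  exact ((tendsto_norm_restrictTo ψ x).pow 2).congr fun t => (velocityMean_indicator _ _ _).symm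

theorem integrable_norm_spectral_sq (ψ : LineSpace) :
    Integrable fun y : ℝ => ‖spectral ψ y‖ ^ 2 :=
  (memLp_two_iff_integrable_sq_norm (Lp.memLp _).1).1 (Lp.memLp _)

theorem integral_norm_spectral_sq (ψ : LineSpace) :
    ∫ y : ℝ, ‖spectral ψ y‖ ^ 2 = ‖ψ‖ ^ 2 := by
  have h := L2.inner_def (𝕜 := ℂ) (spectral ψ) (spectral ψ)
  rw [inner_self_eq_norm_sq_to_K, spectral.norm_map] at h
  have e : ∫ y, inner ℂ (spectral ψ y) (spectral ψ y) = ((∫ y, ‖spectral ψ y‖ ^ 2 : ℝ) : ℂ) := by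
    rw [← integral_complex_ofReal]
    refine integral_congr_ae (Eventually.of_forall fun y => ?_)
    simp only [inner_self_eq_norm_sq_to_K]
    push_cast; rfl
  rw [e] at h
  exact Complex.ofReal_injective (by simpa using h.symm)

/-- The walker leaves every cell. -/
theorem tendsto_cell_zero (ψ : LineSpace) (j : ℤ) :
    Tendsto (fun t : ℕ => ∑ i, ‖(lineEvol^[t] ψ) (j, i)‖ ^ 2) atTop (𝓝 0) := by
  rw [tendsto_order]
  refine ⟨fun a ha => Eventually.of_forall fun t => ha.trans_le (by positivity), fun a ha => ?_⟩
  set F : ℝ → ℝ := fun x => ∫ y in Set.Iic x, ‖spectral ψ y‖ ^ 2 with hF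
  have hint := integrable_norm_spectral_sq ψ
  -- The limit distribution function is continuous at 0. Eventually j/t lies in (-δ, δ], so the mass
  -- of the cell is at most the mass of that window.
  have hcont : Tendsto (fun n : ℕ => F (1 / ((n : ℝ) + 1)) - F (-(1 / ((n : ℝ) + 1)))) atTop
      (𝓝 0) := by
    have h1 : ∀ n : ℕ, F (1 / ((n : ℝ) + 1)) - F (-(1 / ((n : ℝ) + 1))) =
        ∫ y in (-(1 / ((n : ℝ) + 1)))..(1 / ((n : ℝ) + 1)), ‖spectral ψ y‖ ^ 2 := fun n =>
      intervalIntegral.integral_Iic_sub_Iic hint.integrableOn hint.integrableOn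
    have h2 : Tendsto (fun n : ℕ => 1 / ((n : ℝ) + 1)) atTop (𝓝 0) :=
      tendsto_one_div_add_atTop_nhds_zero_nat
    have hc := intervalIntegral.continuous_primitive (fun a b => hint.intervalIntegrable
      (a := a) (b := b)) 0
    have h3 := ((hc.tendsto 0).comp h2).sub ((hc.tendsto 0).comp
      (show Tendsto (fun n : ℕ => -(1 / ((n : ℝ) + 1))) atTop (𝓝 0) by simpa using h2.neg))
    simp only [Function.comp_def, intervalIntegral.integral_same, sub_zero] at h3
    refine h3.congr fun n => ?_
    rw [h1, intervalIntegral.integral_interval_sub_left hint.intervalIntegrable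
      hint.intervalIntegrable]
  obtain ⟨n, hn⟩ := (hcont.eventually (gt_mem_nhds ha)).exists
  set δ := 1 / ((n : ℝ) + 1) with hδ
  have hδ0 : 0 < δ := by positivity
  have hlim := (tendsto_velocityMean_spectral ψ δ).sub (tendsto_velocityMean_spectral ψ (-δ))
  filter_upwards [(tendsto_order.1 hlim).2 a hn, eventually_ge_atTop 1,
    eventually_ge_atTop ⌈(|(j : ℝ)| + 1) / δ⌉₊] with t ht ht1 htj
  refine lt_of_le_of_lt ?_ ht
  have ht0 : (0 : ℝ) < t := by exact_mod_cast ht1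
  have htj' : (|(j : ℝ)| + 1) / δ ≤ t := Nat.ceil_le.1 htj
  rw [div_le_iff₀ hδ0] at htj'
  have hj1 : (j : ℝ) / t ≤ δ := by
    rw [div_le_iff₀ ht0]; nlinarith [le_abs_self (j : ℝ)]
  have hj2 : -δ < (j : ℝ) / t := by
    rw [lt_div_iff₀ ht0]; nlinarith [neg_abs_le (j : ℝ)]
  have s1 := summable_velocityMean_indicator (Set.Iic δ) ψ t
  have s2 := summable_velocityMean_indicator (Set.Iic (-δ)) ψ t
  rw [velocityMean, velocityMean, ← s1.tsum_sub s2, tsum_cells (s1.sub s2)]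
  have s3 := (s1.sub s2)
  have hnn : ∀ e : ℤ × Fin 6, 0 ≤ (Set.Iic δ).indicator (1 : ℝ → ℝ) ((e.1 : ℝ) / t) *
      ‖(lineEvol^[t] ψ) e‖ ^ 2 - (Set.Iic (-δ)).indicator (1 : ℝ → ℝ) ((e.1 : ℝ) / t) *
      ‖(lineEvol^[t] ψ) e‖ ^ 2 := fun e => by
    rw [← sub_mul]
    refine mul_nonneg (sub_nonneg.2 ?_) (by positivity)
    exact Set.indicator_le_indicator_of_subset (Set.Iic_subset_Iic.2 (by linarith))
      (fun _ => zero_le_one) _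
  rw [summable_cells hnn] at s3
  refine le_trans (le_of_eq ?_) (s3.le_tsum j fun k _ => Finset.sum_nonneg fun i _ => hnn (k, i))
  refine Finset.sum_congr rfl fun i _ => ?_
  rw [Set.indicator_of_mem (by exact hj1), Set.indicator_of_notMem (by exact not_le.2 hj2)]
  simp

/-! ### The densities of the two bands -/

/-- Clear for finitely supported states; for the others an approximating sequence has a subsequence
whose transforms converge almost everywhere. -/
theorem spectral_eq_zero (ψ : LineSpace) : ∀ᵐ y : ℝ, ∀ σ : Sheet,
    y ∉ Set.Ioo (-edge σ.1) (edge σ.1) → spectral ψ y σ = 0 := by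
  have h : ∀ n : ℕ, ∃ η, ‖ψ - toLine η‖ < 1 / ((n : ℝ) + 1) := fun n =>
    exists_toLine_near ψ (by positivity)
  choose η hη using h
  have hlim : Tendsto (fun n => spectral (toLine (η n))) atTop (𝓝 (spectral ψ)) := by
    rw [tendsto_iff_norm_sub_tendsto_zero]
    refine squeeze_zero (fun _ => norm_nonneg _) (fun n => ?_)
      tendsto_one_div_add_atTop_nhds_zero_nat
    rw [← map_sub, spectral.norm_map, norm_sub_rev]
    exact (hη n).le
  obtain ⟨φ, -, hφ⟩ := (tendstoInMeasure_of_tendsto_Lp hlim).exists_seq_tendsto_ae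
  filter_upwards [hφ, ae_all_iff.2 fun n => spectral_toLine (η n)] with y hy hw σ hσ
  have h1 : Tendsto (fun n => spectral (toLine (η (φ n))) y σ) atTop (𝓝 (spectral ψ y σ)) :=
    ((EuclideanSpace.proj (𝕜 := ℂ) σ).continuous.tendsto _).comp hy
  refine tendsto_nhds_unique h1 (tendsto_const_nhds.congr fun n => ?_)
  rw [hw, waveSum_apply, if_neg hσ]

/-- The density of the velocity carried by a band. -/
def bandDensity (b : Bool) (ψ : LineSpace) (y : ℝ) : ℝ :=
  (Set.Ioo (-edge b) (edge b)).indicator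
    (fun y => ∑ τ : Bool × Bool, ‖spectral ψ y (b, τ)‖ ^ 2) y

theorem bandDensity_nonneg (b : Bool) (ψ : LineSpace) (y : ℝ) : 0 ≤ bandDensity b ψ y :=
  Set.indicator_nonneg (fun _ _ => by positivity) _

theorem norm_spectral_sq_ae (ψ : LineSpace) :
    (fun y => ‖spectral ψ y‖ ^ 2) =ᵐ[volume]
      fun y => bandDensity true ψ y + bandDensity false ψ y := by
  filter_upwards [spectral_eq_zero ψ] with y hy
  rw [EuclideanSpace.norm_sq_eq, Fintype.sum_prod_type, Fintype.sum_bool]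
  have h : ∀ b, ∑ τ : Bool × Bool, ‖spectral ψ y (b, τ)‖ ^ 2 = bandDensity b ψ y := fun b => by
    by_cases hb : y ∈ Set.Ioo (-edge b) (edge b)
    · rw [bandDensity, Set.indicator_of_mem hb]
    · rw [bandDensity, Set.indicator_of_notMem hb]
      exact Finset.sum_eq_zero fun τ _ => by rw [hy (b, τ) hb]; simp
  rw [h, h]

theorem integrable_bandDensity (b : Bool) (ψ : LineSpace) : Integrable (bandDensity b ψ) := by
  refine IntegrableOn.integrable_indicator ?_ measurableSet_Ioo
  refine Integrable.integrableOn ((integrable_norm_spectral_sq ψ).mono ?_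
    (Eventually.of_forall fun y => ?_))
  · refine Finset.aestronglyMeasurable_fun_sum _ fun τ _ => ?_
    exact ((EuclideanSpace.proj (𝕜 := ℂ) (b, τ)).continuous.comp_aestronglyMeasurable
      (Lp.memLp (spectral ψ)).1).norm.pow 2
  · have h : ∑ σ : Sheet, ‖spectral ψ y σ‖ ^ 2 = ∑ τ : Bool × Bool, ‖spectral ψ y (true, τ)‖ ^ 2 +
        ∑ τ : Bool × Bool, ‖spectral ψ y (false, τ)‖ ^ 2 := by
      rw [Fintype.sum_prod_type, Fintype.sum_bool]
    have h1 : ∀ b, 0 ≤ ∑ τ : Bool × Bool, ‖spectral ψ y (b, τ)‖ ^ 2 := fun b => by positivity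
    rw [Real.norm_of_nonneg (by positivity), Real.norm_of_nonneg (by positivity),
      EuclideanSpace.norm_sq_eq, h]
    cases b <;> linarith [h1 true, h1 false]

/-- The density of the velocity carried by a band, for a finitely supported state. -/
def finiteBandDensity (b : Bool) (η : FiniteState) (y : ℝ) : ℝ :=
  (Set.Ioo (-edge b) (edge b)).indicator
    (fun y => bandWeight b y * ∑ τ : Bool × Bool, ‖bloch (b, τ) y η‖ ^ 2) y

theorem finiteBandDensity_ae (b : Bool) (η : FiniteState) :
    bandDensity b (toLine η) =ᵐ[volume] finiteBandDensity b η := by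
  filter_upwards [spectral_toLine η] with y hy
  by_cases hb : y ∈ Set.Ioo (-edge b) (edge b)
  · rw [bandDensity, finiteBandDensity, Set.indicator_of_mem hb, Set.indicator_of_mem hb,
      Finset.mul_sum]
    refine Finset.sum_congr rfl fun τ _ => ?_
    rw [hy, waveSum_apply, if_pos hb, norm_mul, mul_pow, Complex.norm_real, Real.norm_eq_abs,
      sq_abs, Real.sq_sqrt (bandWeight_pos (σ := (b, τ)) hb).le]
  · simp only [bandDensity, finiteBandDensity, Set.indicator_of_notMem hb]

theorem analyticAt_bloch {σ : Sheet} {y : ℝ} (hy : y ∈ Set.Ioo (-edge σ.1) (edge σ.1))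
    (η : FiniteState) : AnalyticAt ℝ (fun y => bloch σ y η) y := by
  simp only [bloch, Finsupp.linearCombination_apply, Finsupp.sum]
  -- The smoothness exponent `⊤` means real analyticity here, beyond infinite differentiability.
  exact Finset.analyticAt_fun_sum _ fun e _ =>
    AnalyticAt.fun_smul analyticAt_const (contDiffAt_amp (n := ⊤) hy e).analyticAt

theorem continuousOn_finiteBandDensity (b : Bool) (η : FiniteState) :
    ContinuousOn (finiteBandDensity b η) (Set.Ioo (-edge b) (edge b)) := by
  refine ContinuousOn.congr (f := fun y => bandWeight b y * ∑ τ : Bool × Bool,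
    ‖bloch (b, τ) y η‖ ^ 2) (fun y hy => ContinuousAt.continuousWithinAt ?_) fun y hy => by
      rw [finiteBandDensity, Set.indicator_of_mem hy]
  refine (continuousAt_bandWeight (σ := (b, true, true)) hy).mul ?_
  refine tendsto_finsetSum _ fun τ _ => ?_
  exact ((analyticAt_bloch (σ := (b, τ)) hy η).continuousAt.norm).pow 2

/-- The support of the density of a band is the full band, unless the density vanishes. -/
theorem tsupport_finiteBandDensity (b : Bool) (η : FiniteState) :
    finiteBandDensity b η = 0 ∨
      tsupport (finiteBandDensity b η) = Set.Icc (-edge b) (edge b) := by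
  by_cases h : ∀ τ, ∀ y ∈ Set.Ioo (-edge b) (edge b), bloch (b, τ) y η = 0
  · left
    ext y
    by_cases hy : y ∈ Set.Ioo (-edge b) (edge b)
    · rw [finiteBandDensity, Set.indicator_of_mem hy]
      simp [h _ y hy]
    · rw [finiteBandDensity, Set.indicator_of_notMem hy]; rfl
  · right
    push Not at h
    obtain ⟨τ, y₀, hy₀, h0⟩ := h
    have hne : -edge b ≠ edge b := by linarith [edge_pos b] |> fun h : -edge b < edge b => h.ne
    refine subset_antisymm ?_ ?_
    · rw [← closure_Ioo hne]
      exact closure_mono Set.support_indicator_subset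
    · rw [← closure_Ioo hne]
      refine closure_minimal (fun y hy => ?_) (isClosed_tsupport _)
      by_contra hn
      -- Near a point outside the closed support all summands of the density vanish, the weight
      -- being positive. The identity theorem then makes the transform zero on the whole band.
      have hev : ∀ᶠ z in 𝓝 y, bloch (b, τ) z η = 0 := by
        filter_upwards [(isClosed_tsupport _).isOpen_compl.mem_nhds hn,
          isOpen_Ioo.mem_nhds hy] with z hz hzb
        have hz0 : finiteBandDensity b η z = 0 := image_eq_zero_of_notMem_tsupport hz
        rw [finiteBandDensity, Set.indicator_of_mem hzb] at hz0
        have hw := (bandWeight_pos (σ := (b, τ)) hzb).ne'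
        have hs := (mul_eq_zero.1 hz0).resolve_left hw
        rw [Finset.sum_eq_zero_iff_of_nonneg fun _ _ => by positivity] at hs
        simpa using hs τ (Finset.mem_univ _)
      have han : AnalyticOnNhd ℝ (fun z => bloch (b, τ) z η) (Set.Ioo (-edge b) (edge b)) :=
        fun z hz => analyticAt_bloch (σ := (b, τ)) hz η
      exact h0 (han.eqOn_zero_of_preconnected_of_eventuallyEq_zero isPreconnected_Ioo hy hev hy₀)


open PeriodicC4 CycleVertex

/-! ### The arcs of the periodic graph -/

theorem adj_iff (p q : ℤ × CycleVertex) : graph.Adj p q ↔ p ≠ q ∧ (Bond p q ∨ Bond q p) := by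
  rw [graph, SimpleGraph.fromRel_adj]

theorem adj_zero (j : ℤ) (q : ℤ × CycleVertex) : graph.Adj (j, zero) q ↔
    q = (j, up) ∨ q = (j, down) ∨ q = (j + 1, zeroPrime) := by
  obtain ⟨k, v⟩ := q
  rw [adj_iff]
  cases v <;> simp [Bond, eq_comm]

theorem adj_up (j : ℤ) (q : ℤ × CycleVertex) : graph.Adj (j, up) q ↔
    q = (j, zero) ∨ q = (j, zeroPrime) := by
  obtain ⟨k, v⟩ := q
  rw [adj_iff]
  cases v <;> simp [Bond, eq_comm]

theorem adj_zeroPrime (j : ℤ) (q : ℤ × CycleVertex) : graph.Adj (j, zeroPrime) q ↔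
    q = (j, up) ∨ q = (j, down) ∨ q = (j - 1, zero) := by
  obtain ⟨k, v⟩ := q
  rw [adj_iff]
  cases v <;> simp [Bond, eq_comm, eq_sub_iff_add_eq]

theorem adj_down (j : ℤ) (q : ℤ × CycleVertex) : graph.Adj (j, down) q ↔
    q = (j, zero) ∨ q = (j, zeroPrime) := by
  obtain ⟨k, v⟩ := q
  rw [adj_iff]
  cases v <;> simp [Bond, eq_comm]

/-- The origin and the terminus of an arc. -/
def arcPair (j : ℤ) : Fin 10 → (ℤ × CycleVertex) × (ℤ × CycleVertex) :=
  ![((j, zeroPrime), (j, up)), ((j, up), (j, zero)), ((j, zero), (j, up)),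
    ((j, up), (j, zeroPrime)), ((j, zeroPrime), (j, down)), ((j, down), (j, zero)),
    ((j, zero), (j, down)), ((j, down), (j, zeroPrime)), ((j, zero), (j + 1, zeroPrime)),
    ((j, zeroPrime), (j - 1, zero))]

/-- The arcs with origin in copy `j`: first those of the upper half of the cycle, then those of the
lower half, then the two bridge arcs. -/
def arc (j : ℤ) (k : Fin 10) : graph.Dart :=
  ⟨arcPair j k, by
    fin_cases k <;> simp [arcPair, adj_zero, adj_up, adj_zeroPrime, adj_down]⟩

theorem arc_eq_iff {j j' : ℤ} {k k' : Fin 10} : arc j k = arc j' k' ↔ j = j' ∧ k = k' := by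
  refine ⟨fun h => ?_, fun h => by rw [h.1, h.2]⟩
  have h2 : arcPair j k = arcPair j' k' := congrArg SimpleGraph.Dart.toProd h
  revert h2
  fin_cases k <;> fin_cases k' <;> simp [arcPair]

theorem exists_arc (d : graph.Dart) : ∃ j k, d = arc j k := by
  obtain ⟨⟨⟨j, v⟩, q⟩, h⟩ := d
  cases v
  · rcases (adj_zero j q).1 h with rfl | rfl | rfl
    exacts [⟨j, 2, rfl⟩, ⟨j, 6, rfl⟩, ⟨j, 8, rfl⟩]
  · rcases (adj_up j q).1 h with rfl | rfl
    exacts [⟨j, 1, rfl⟩, ⟨j, 3, rfl⟩]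
  · rcases (adj_zeroPrime j q).1 h with rfl | rfl | rfl
    exacts [⟨j, 0, rfl⟩, ⟨j, 4, rfl⟩, ⟨j, 9, rfl⟩]
  · rcases (adj_down j q).1 h with rfl | rfl
    exacts [⟨j, 5, rfl⟩, ⟨j, 7, rfl⟩]

/-- The arcs of the periodic graph are indexed by the copies and ten types. -/
def arcEquiv : ℤ × Fin 10 ≃ graph.Dart :=
  Equiv.ofBijective (fun e => arc e.1 e.2)
    ⟨fun e e' h => Prod.ext (arc_eq_iff.1 h).1 (arc_eq_iff.1 h).2, fun d => by
      obtain ⟨j, k, rfl⟩ := exists_arc d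
      exact ⟨(j, k), rfl⟩⟩

/-- Converts sums over the abstract neighbour sets in the Grover step into sums over explicitly
listed arcs. -/
theorem sum_neighborSet {M : Type*} [AddCommMonoid M] {n : ℕ} {v : ℤ × CycleVertex}
    (a : Fin n → graph.Dart) (hinj : Function.Injective a) (hfst : ∀ i, (a i).fst = v)
    (hsurj : ∀ q, graph.Adj v q → ∃ i, (a i).snd = q) (F : graph.Dart → M) :
    ∑ w : graph.neighborSet v, F (graph.dartOfNeighborSet v w) = ∑ i, F (a i) := by
  have hd : ∀ i, (a i).toProd = (v, (a i).snd) := fun i => Prod.ext (hfst i) rfl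
  refine (Fintype.sum_bijective (fun i => (⟨(a i).snd, by
    rw [SimpleGraph.mem_neighborSet, ← hfst i]; exact (a i).adj⟩ : graph.neighborSet v))
    ⟨fun i i' h => hinj ?_, fun w => ?_⟩ _ _ fun i => ?_).symm
  · refine SimpleGraph.Dart.ext _ _ ?_
    rw [hd i, hd i', show (a i).snd = (a i').snd from congrArg Subtype.val h]
  · obtain ⟨i, hi⟩ := hsurj w w.2
    exact ⟨i, Subtype.ext hi⟩
  · congr 1
    exact SimpleGraph.Dart.ext _ _ (hd i)

section Sums

variable {M : Type*} [AddCommMonoid M] (j : ℤ) (F : graph.Dart → M)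

theorem sum_neighborSet_zero :
    ∑ w : graph.neighborSet (j, zero), F (graph.dartOfNeighborSet (j, zero) w) =
      F (arc j 2) + F (arc j 6) + F (arc j 8) := by
  rw [sum_neighborSet (fun i => arc j (![2, 6, 8] i)) (fun i i' h => ?_) (fun i => ?_)
    (fun q hq => ?_), Fin.sum_univ_three]
  · rfl
  · have := (arc_eq_iff.1 h).2
    clear h; revert this; revert i i'; decide
  · fin_cases i <;> rfl
  · rcases (adj_zero j q).1 hq with rfl | rfl | rfl
    exacts [⟨0, rfl⟩, ⟨1, rfl⟩, ⟨2, rfl⟩]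

theorem sum_neighborSet_up :
    ∑ w : graph.neighborSet (j, up), F (graph.dartOfNeighborSet (j, up) w) =
      F (arc j 1) + F (arc j 3) := by
  rw [sum_neighborSet (fun i => arc j (![1, 3] i)) (fun i i' h => ?_) (fun i => ?_)
    (fun q hq => ?_), Fin.sum_univ_two]
  · rfl
  · have := (arc_eq_iff.1 h).2
    clear h; revert this; revert i i'; decide
  · fin_cases i <;> rfl
  · rcases (adj_up j q).1 hq with rfl | rfl
    exacts [⟨0, rfl⟩, ⟨1, rfl⟩]

theorem sum_neighborSet_zeroPrime :
    ∑ w : graph.neighborSet (j, zeroPrime), F (graph.dartOfNeighborSet (j, zeroPrime) w) =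
      F (arc j 0) + F (arc j 4) + F (arc j 9) := by
  rw [sum_neighborSet (fun i => arc j (![0, 4, 9] i)) (fun i i' h => ?_) (fun i => ?_)
    (fun q hq => ?_), Fin.sum_univ_three]
  · rfl
  · have := (arc_eq_iff.1 h).2
    clear h; revert this; revert i i'; decide
  · fin_cases i <;> rfl
  · rcases (adj_zeroPrime j q).1 hq with rfl | rfl | rfl
    exacts [⟨0, rfl⟩, ⟨1, rfl⟩, ⟨2, rfl⟩]

theorem sum_neighborSet_down :
    ∑ w : graph.neighborSet (j, down), F (graph.dartOfNeighborSet (j, down) w) =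
      F (arc j 5) + F (arc j 7) := by
  rw [sum_neighborSet (fun i => arc j (![5, 7] i)) (fun i i' h => ?_) (fun i => ?_)
    (fun q hq => ?_), Fin.sum_univ_two]
  · rfl
  · have := (arc_eq_iff.1 h).2
    clear h; revert this; revert i i'; decide
  · fin_cases i <;> rfl
  · rcases (adj_down j q).1 hq with rfl | rfl
    exacts [⟨0, rfl⟩, ⟨1, rfl⟩]

theorem degree_eq_sum (v : ℤ × CycleVertex) :
    graph.degree v = ∑ _w : graph.neighborSet v, 1 := by
  rw [← SimpleGraph.card_neighborSet_eq_degree]; simp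

theorem degree_zero : graph.degree (j, zero) = 3 := by
  rw [degree_eq_sum]; exact sum_neighborSet_zero j fun _ => 1

theorem degree_up : graph.degree (j, up) = 2 := by
  rw [degree_eq_sum]; exact sum_neighborSet_up j fun _ => 1

theorem degree_zeroPrime : graph.degree (j, zeroPrime) = 3 := by
  rw [degree_eq_sum]; exact sum_neighborSet_zeroPrime j fun _ => 1

theorem degree_down : graph.degree (j, down) = 2 := by
  rw [degree_eq_sum]; exact sum_neighborSet_down j fun _ => 1

end Sums

theorem arc_symm (j : ℤ) (k : Fin 10) : (arc j k).symm =
    ![arc j 3, arc j 2, arc j 1, arc j 0, arc j 7, arc j 6, arc j 5, arc j 4, arc (j + 1) 9,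
      arc (j - 1) 8] k := by
  refine SimpleGraph.Dart.ext _ _ ?_
  fin_cases k <;> simp [arc, arcPair, SimpleGraph.Dart.symm]

/-! ### One step of the Grover walk -/

section Step

variable (ψ : graph.Dart → ℂ) (j : ℤ)

theorem step_apply (f : graph.Dart) : GroverWalk.step graph ψ f =
    ∑ w : graph.neighborSet f.snd, (fun e => (2 / (graph.degree f.snd : ℂ) -
      (if e = f.symm then 1 else 0)) * ψ e) (graph.dartOfNeighborSet f.snd w) := rfl

theorem step_zero {f : graph.Dart} (h : f.snd = (j, zero)) : GroverWalk.step graph ψ f =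
    (2 / 3 - (if arc j 2 = f.symm then 1 else 0)) * ψ (arc j 2) +
    (2 / 3 - (if arc j 6 = f.symm then 1 else 0)) * ψ (arc j 6) +
    (2 / 3 - (if arc j 8 = f.symm then 1 else 0)) * ψ (arc j 8) := by
  rw [step_apply, h]
  refine (sum_neighborSet_zero j fun e => (2 / (graph.degree (j, zero) : ℂ) -
    (if e = f.symm then 1 else 0)) * ψ e).trans ?_
  rw [degree_zero]; norm_num

theorem step_up {f : graph.Dart} (h : f.snd = (j, up)) : GroverWalk.step graph ψ f =
    (1 - (if arc j 1 = f.symm then 1 else 0)) * ψ (arc j 1) +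
    (1 - (if arc j 3 = f.symm then 1 else 0)) * ψ (arc j 3) := by
  rw [step_apply, h]
  refine (sum_neighborSet_up j fun e => (2 / (graph.degree (j, up) : ℂ) -
    (if e = f.symm then 1 else 0)) * ψ e).trans ?_
  rw [degree_up]; norm_num

theorem step_zeroPrime {f : graph.Dart} (h : f.snd = (j, zeroPrime)) :
    GroverWalk.step graph ψ f =
    (2 / 3 - (if arc j 0 = f.symm then 1 else 0)) * ψ (arc j 0) +
    (2 / 3 - (if arc j 4 = f.symm then 1 else 0)) * ψ (arc j 4) +
    (2 / 3 - (if arc j 9 = f.symm then 1 else 0)) * ψ (arc j 9) := by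
  rw [step_apply, h]
  refine (sum_neighborSet_zeroPrime j fun e => (2 / (graph.degree (j, zeroPrime) : ℂ) -
    (if e = f.symm then 1 else 0)) * ψ e).trans ?_
  rw [degree_zeroPrime]; norm_num

theorem step_down {f : graph.Dart} (h : f.snd = (j, down)) : GroverWalk.step graph ψ f =
    (1 - (if arc j 5 = f.symm then 1 else 0)) * ψ (arc j 5) +
    (1 - (if arc j 7 = f.symm then 1 else 0)) * ψ (arc j 7) := by
  rw [step_apply, h]
  refine (sum_neighborSet_down j fun e => (2 / (graph.degree (j, down) : ℂ) -
    (if e = f.symm then 1 else 0)) * ψ e).trans ?_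
  rw [degree_down]; norm_num

theorem step_arc (k : Fin 10) : GroverWalk.step graph ψ (arc j k) =
    ![ψ (arc j 1),
      -(1 / 3) * ψ (arc j 2) + 2 / 3 * ψ (arc j 6) + 2 / 3 * ψ (arc j 8),
      ψ (arc j 3),
      -(1 / 3) * ψ (arc j 0) + 2 / 3 * ψ (arc j 4) + 2 / 3 * ψ (arc j 9),
      ψ (arc j 5),
      2 / 3 * ψ (arc j 2) - 1 / 3 * ψ (arc j 6) + 2 / 3 * ψ (arc j 8),
      ψ (arc j 7),
      2 / 3 * ψ (arc j 0) - 1 / 3 * ψ (arc j 4) + 2 / 3 * ψ (arc j 9),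
      2 / 3 * ψ (arc (j + 1) 0) + 2 / 3 * ψ (arc (j + 1) 4) - 1 / 3 * ψ (arc (j + 1) 9),
      2 / 3 * ψ (arc (j - 1) 2) + 2 / 3 * ψ (arc (j - 1) 6) - 1 / 3 * ψ (arc (j - 1) 8)] k := by
  have hs := arc_symm j k
  fin_cases k
  · rw [step_up ψ j rfl, hs]; simp [arc_eq_iff]
  · rw [step_zero ψ j rfl, hs]; simp [arc_eq_iff]; ring
  · rw [step_up ψ j rfl, hs]; simp [arc_eq_iff]
  · rw [step_zeroPrime ψ j rfl, hs]; simp [arc_eq_iff]; ring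
  · rw [step_down ψ j rfl, hs]; simp [arc_eq_iff]
  · rw [step_zero ψ j rfl, hs]; simp [arc_eq_iff]; ring
  · rw [step_down ψ j rfl, hs]; simp [arc_eq_iff]
  · rw [step_zeroPrime ψ j rfl, hs]; simp [arc_eq_iff]; ring
  · rw [step_zeroPrime ψ (j + 1) rfl, hs]; simp [arc_eq_iff]; ring
  · rw [step_zero ψ (j - 1) rfl, hs]; simp [arc_eq_iff]; ring

/-! ### Symmetric and antisymmetric components -/

/-- The components of a state invariant under the exchange of the vertices `u` and `d`. -/
def symPart (e : ℤ × Fin 6) : ℂ :=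
  ![(ψ (arc e.1 0) + ψ (arc e.1 4)) / (√2 : ℝ), (ψ (arc e.1 1) + ψ (arc e.1 5)) / (√2 : ℝ),
    (ψ (arc e.1 2) + ψ (arc e.1 6)) / (√2 : ℝ), (ψ (arc e.1 3) + ψ (arc e.1 7)) / (√2 : ℝ),
    ψ (arc e.1 8), ψ (arc e.1 9)] e.2

/-- The components of a state which change sign under the exchange of `u` and `d`. -/
def antiPart (e : ℤ × Fin 4) : ℂ :=
  ![(ψ (arc e.1 0) - ψ (arc e.1 4)) / (√2 : ℝ), (ψ (arc e.1 1) - ψ (arc e.1 5)) / (√2 : ℝ),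
    (ψ (arc e.1 2) - ψ (arc e.1 6)) / (√2 : ℝ), (ψ (arc e.1 3) - ψ (arc e.1 7)) / (√2 : ℝ)] e.2

/-- The Grover coins are symmetric in the two cycle arcs at each vertex. The normalization by √2 on
cycle arcs only is the origin of the coin entries 2√2/3. -/
theorem symPart_step : symPart (GroverWalk.step graph ψ) = evolFun (symPart ψ) := by
  have h2 : ((√2 : ℝ) : ℂ) * ((√2 : ℝ) : ℂ) = 2 := sqrt_two_mul_self
  have h0 : ((√2 : ℝ) : ℂ) ≠ 0 := by simp
  ext ⟨j, i⟩
  fin_cases i <;>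
    simp only [symPart, evolFun, coin, rev, step_arc, Fin.zero_eta, Fin.mk_one, Fin.reduceFinMk,
      Matrix.cons_val] <;> field_simp
  · linear_combination (-2 * ψ (arc j 8)) * h2
  · linear_combination (-2 * ψ (arc j 9)) * h2

/-- Odd amplitudes cancel in every coin sum that reaches a bridge, so the four odd components of a
copy undergo a signed cyclic permutation. -/
theorem sum_norm_sq_antiPart_step :
    ∑ i, ‖antiPart (GroverWalk.step graph ψ) (j, i)‖ ^ 2 = ∑ i, ‖antiPart ψ (j, i)‖ ^ 2 := by
  have e0 : antiPart (GroverWalk.step graph ψ) (j, 0) = antiPart ψ (j, 1) := by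
    simp [antiPart, step_arc]
  have e1 : antiPart (GroverWalk.step graph ψ) (j, 1) = -antiPart ψ (j, 2) := by
    simp only [antiPart, step_arc, Matrix.cons_val]; ring
  have e2 : antiPart (GroverWalk.step graph ψ) (j, 2) = antiPart ψ (j, 3) := by
    simp [antiPart, step_arc]
  have e3 : antiPart (GroverWalk.step graph ψ) (j, 3) = -antiPart ψ (j, 0) := by
    simp only [antiPart, step_arc, Matrix.cons_val]; ring
  simp only [Fin.sum_univ_four, e0, e1, e2, e3, norm_neg]
  ring

theorem norm_sq_add_norm_sq_sub_div (a b : ℂ) :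
    ‖(a + b) / (√2 : ℝ)‖ ^ 2 + ‖(a - b) / (√2 : ℝ)‖ ^ 2 = ‖a‖ ^ 2 + ‖b‖ ^ 2 := by
  have h : ‖((√2 : ℝ) : ℂ)‖ ^ 2 = 2 := by simp
  rw [norm_div, norm_div, div_pow, div_pow, h]
  have := parallelogram_law_with_norm ℝ a b
  linarith

theorem sum_norm_sq_arc :
    ∑ k, ‖ψ (arc j k)‖ ^ 2 = ∑ i, ‖symPart ψ (j, i)‖ ^ 2 + ∑ i, ‖antiPart ψ (j, i)‖ ^ 2 := by
  have h0 := norm_sq_add_norm_sq_sub_div (ψ (arc j 0)) (ψ (arc j 4))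
  have h1 := norm_sq_add_norm_sq_sub_div (ψ (arc j 1)) (ψ (arc j 5))
  have h2 := norm_sq_add_norm_sq_sub_div (ψ (arc j 2)) (ψ (arc j 6))
  have h3 := norm_sq_add_norm_sq_sub_div (ψ (arc j 3)) (ψ (arc j 7))
  simp only [symPart, antiPart, Fin.sum_univ_succ, Fin.sum_univ_zero, Fin.succ_zero_eq_one,
    Fin.succ_one_eq_two, Fin.reduceSucc, Matrix.cons_val, add_zero]
  linarith

end Step

theorem copyProb_eq_sum (Ψ₀ : StateSpace) (t : ℕ) (j : ℤ) :
    copyProb Ψ₀ t j = ∑ k, ‖GroverWalk.state graph Ψ₀ t (arc j k)‖ ^ 2 := by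
  have hu : (Finset.univ : Finset CycleVertex) = {zero, up, zeroPrime, down} := rfl
  rw [copyProb, hu, Finset.sum_insert (by decide), Finset.sum_insert (by decide),
    Finset.sum_insert (by decide), Finset.sum_singleton]
  simp only [GroverWalk.vertexProb]
  rw [sum_neighborSet_zero j fun e => ‖GroverWalk.state graph Ψ₀ t e‖ ^ 2,
    sum_neighborSet_up j fun e => ‖GroverWalk.state graph Ψ₀ t e‖ ^ 2,
    sum_neighborSet_zeroPrime j fun e => ‖GroverWalk.state graph Ψ₀ t e‖ ^ 2,
    sum_neighborSet_down j fun e => ‖GroverWalk.state graph Ψ₀ t e‖ ^ 2]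
  simp only [Fin.sum_univ_succ, Fin.sum_univ_zero, Fin.succ_zero_eq_one,
    Fin.succ_one_eq_two, Fin.reduceSucc, add_zero]
  ring

/-- The weight of the antisymmetric components in a copy. -/
def antiWeight (Ψ : graph.Dart → ℂ) (j : ℤ) : ℝ := ∑ i, ‖antiPart Ψ (j, i)‖ ^ 2

theorem antiWeight_nonneg (Ψ : graph.Dart → ℂ) (j : ℤ) : 0 ≤ antiWeight Ψ j := by
  unfold antiWeight; positivity

theorem antiWeight_state (Ψ₀ : graph.Dart → ℂ) (t : ℕ) (j : ℤ) :
    antiWeight (GroverWalk.state graph Ψ₀ t) j = antiWeight Ψ₀ j := by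
  induction t with
  | zero => rfl
  | succ t ih =>
    rw [← ih, GroverWalk.state, Function.iterate_succ_apply']
    exact sum_norm_sq_antiPart_step _ j

theorem summable_arcs (Ψ : StateSpace) : Summable fun j => ∑ k, ‖Ψ (arc j k)‖ ^ 2 := by
  have h := (arcEquiv.summable_iff (f := fun e => ‖Ψ e‖ ^ 2)).2 (summable_norm_sq Ψ)
  rwa [summable_cells fun e => by simp only [Function.comp_apply]; positivity] at h

theorem norm_sq_eq_tsum_arcs (Ψ : StateSpace) : ‖Ψ‖ ^ 2 = ∑' j, ∑ k, ‖Ψ (arc j k)‖ ^ 2 := by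
  have h := (arcEquiv.summable_iff (f := fun e => ‖Ψ e‖ ^ 2)).2 (summable_norm_sq Ψ)
  rw [norm_sq_eq_tsum, ← arcEquiv.tsum_eq (fun e => ‖Ψ e‖ ^ 2)]
  exact tsum_cells h

theorem summable_antiWeight (Ψ : StateSpace) : Summable (antiWeight Ψ) := by
  refine (summable_arcs Ψ).of_nonneg_of_le (antiWeight_nonneg Ψ) fun j => ?_
  rw [sum_norm_sq_arc]
  exact le_add_of_nonneg_left (by positivity)

theorem summable_symPart (Ψ : StateSpace) : Summable fun e => ‖symPart Ψ e‖ ^ 2 := by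
  rw [summable_cells fun e => by positivity]
  refine (summable_arcs Ψ).of_nonneg_of_le (fun j => by positivity) fun j => ?_
  rw [sum_norm_sq_arc]
  exact le_add_of_nonneg_right (by positivity)

/-- The symmetric components as a state of the line walk. -/
def symLine (Ψ : StateSpace) : LineSpace := ⟨symPart Ψ, memℓp_two (summable_symPart Ψ)⟩

theorem norm_symLine_sq_add (Ψ : StateSpace) :
    ‖symLine Ψ‖ ^ 2 + ∑' j, antiWeight Ψ j = ‖Ψ‖ ^ 2 := by
  have h := summable_symPart Ψ
  have h2 := h
  rw [summable_cells fun e => by positivity] at h2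
  rw [norm_sq_eq_tsum_arcs, norm_sq_eq_tsum]
  change (∑' e, ‖symPart Ψ e‖ ^ 2) + _ = _
  rw [tsum_cells h, ← h2.tsum_add (summable_antiWeight Ψ)]
  exact tsum_congr fun j => (sum_norm_sq_arc Ψ j).symm

theorem iterate_lineEvol_symLine (Ψ₀ : StateSpace) (t : ℕ) (e : ℤ × Fin 6) :
    (lineEvol^[t] (symLine Ψ₀)) e = symPart (GroverWalk.state graph Ψ₀ t) e := by
  suffices h : ⇑(lineEvol^[t] (symLine Ψ₀)) = symPart (GroverWalk.state graph Ψ₀ t) from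
    congrFun h e
  induction t with
  | zero => rfl
  | succ t ih =>
    rw [GroverWalk.state, Function.iterate_succ_apply', Function.iterate_succ_apply',
      symPart_step]
    rw [GroverWalk.state] at ih
    rw [← ih]
    rfl

theorem copyProb_eq (Ψ₀ : StateSpace) (t : ℕ) (j : ℤ) : copyProb Ψ₀ t j =
    antiWeight Ψ₀ j + ∑ i, ‖(lineEvol^[t] (symLine Ψ₀)) (j, i)‖ ^ 2 := by
  simp only [iterate_lineEvol_symLine]
  rw [copyProb_eq_sum, sum_norm_sq_arc, ← antiWeight_state Ψ₀ t j, antiWeight, add_comm]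

/-! ### The homological eigenspace -/

/-- The antisymmetric unit vectors of a copy. -/
def antiVec (j : ℤ) (i : Fin 4) : StateSpace :=
  (((√2)⁻¹ : ℝ) : ℂ) • (lp.single 2 (arc j (![0, 1, 2, 3] i)) (1 : ℂ) -
    lp.single 2 (arc j (![4, 5, 6, 7] i)) (1 : ℂ))

theorem inner_antiVec (j : ℤ) (i : Fin 4) (Ψ : StateSpace) :
    inner ℂ (antiVec j i) Ψ = antiPart Ψ (j, i) := by
  rw [antiVec, inner_smul_left, inner_sub_left, lp.inner_single_left, lp.inner_single_left,
    Complex.conj_ofReal]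
  fin_cases i <;> simp [antiPart] <;> ring

theorem antiVec_apply (j : ℤ) (i : Fin 4) (k : Fin 10) : antiVec j i (arc j k) =
    (((√2)⁻¹ : ℝ) : ℂ) * ((if k = ![0, 1, 2, 3] i then 1 else 0) -
      (if k = ![4, 5, 6, 7] i then 1 else 0)) := by
  rw [antiVec, lp.coeFn_smul, Pi.smul_apply, lp.coeFn_sub, Pi.sub_apply, lp.single_apply,
    lp.single_apply, Pi.single_apply, Pi.single_apply, smul_eq_mul]
  simp only [arc_eq_iff, true_and]

theorem orthonormal_antiVec (j : ℤ) : Orthonormal ℂ (antiVec j) := by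
  rw [orthonormal_iff_ite]
  intro i i'
  have h2 : ((√2 : ℝ) : ℂ) * ((√2 : ℝ) : ℂ) = 2 := sqrt_two_mul_self
  have h0 : ((√2 : ℝ) : ℂ) ≠ 0 := by simp
  rw [inner_antiVec]
  fin_cases i <;> fin_cases i' <;>
    simp [antiPart, antiVec_apply] <;> (field_simp; linear_combination -h2)

/-- The cycle uses arc types 0, 1, 6, 7 and its inverse 4, 5, 2, 3. The r-th arcs are exchanged by u
↔ d, which gives odd vectors, with a minus sign on the second half. The phases are powers of i. -/
theorem pathWave_sub_pathWave (j : ℤ) (m : ℕ) :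
    pathWave m (cycle j) - pathWave m (revPath (cycle j)) = ((√2 : ℝ) : ℂ) •
      (Complex.I ^ m • antiVec j 0 + Complex.I ^ (2 * m) • antiVec j 1 -
        Complex.I ^ (3 * m) • antiVec j 2 - Complex.I ^ (4 * m) • antiVec j 3) := by
  have hexp : ∀ r : ℕ, Complex.exp (2 * Real.pi * Complex.I * m * ((r : ℂ) + 1) / (4 : ℕ)) =
      Complex.I ^ ((r + 1) * m) := fun r => by
    have h4 : Complex.exp (Real.pi / 2 * Complex.I) = Complex.I := Complex.exp_pi_div_two_mul_I
    rw [← h4, ← Complex.exp_nat_mul, h4]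
    congr 1
    push_cast; ring
  have hc : ∀ r, cycle j r = arc j (![0, 1, 6, 7] r) := fun r => by fin_cases r <;> rfl
  have hr : ∀ r, revPath (cycle j) r = arc j (![4, 5, 2, 3] r) := fun r => by
    rw [revPath, hc, arc_symm]; fin_cases r <;> rfl
  have h0 : ((√2 : ℝ) : ℂ) * (((√2)⁻¹ : ℝ) : ℂ) = 1 := by
    rw [← Complex.ofReal_mul, mul_inv_cancel₀ (by positivity), Complex.ofReal_one]
  have hv : ∀ i, ((√2 : ℝ) : ℂ) • antiVec j i = lp.single 2 (arc j (![0, 1, 2, 3] i)) (1 : ℂ) -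
    lp.single 2 (arc j (![4, 5, 6, 7] i)) (1 : ℂ) := fun i => by
    rw [antiVec, smul_smul, h0, one_smul]
  simp only [pathWave, hexp, hc, hr, smul_sub, smul_add, smul_comm ((√2 : ℝ) : ℂ), hv,
    Fin.sum_univ_four, Matrix.cons_val, Fin.val_zero, Fin.val_one, Fin.val_two,
    show ((3 : Fin 4) : ℕ) = 3 from rfl, zero_add, one_mul, Nat.reduceAdd]
  abel

/-- The four waves are the discrete Fourier transform of the odd unit vectors, up to signs and a
common factor, and this transform is invertible. -/
theorem homSpace_eq_span (j : ℤ) : homSpace j = Submodule.span ℂ (Set.range (antiVec j)) := by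
  have hI : ∀ n : ℕ, Complex.I ^ (4 * n) = 1 := fun n => by rw [pow_mul, Complex.I_pow_four, one_pow]
  have h0 : ((√2 : ℝ) : ℂ) ≠ 0 := by simp
  refine le_antisymm (iSup_le fun m => ?_) (Submodule.span_le.2 ?_)
  · rw [homLine, Submodule.span_le, Set.singleton_subset_iff, pathWave_sub_pathWave]
    have hm : ∀ i, antiVec j i ∈ Submodule.span ℂ (Set.range (antiVec j)) := fun i =>
      Submodule.subset_span ⟨i, rfl⟩
    exact Submodule.smul_mem _ _ (Submodule.sub_mem _ (Submodule.sub_mem _ (Submodule.add_mem _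
      (Submodule.smul_mem _ _ (hm 0)) (Submodule.smul_mem _ _ (hm 1)))
      (Submodule.smul_mem _ _ (hm 2))) (Submodule.smul_mem _ _ (hm 3)))
  · have hv : ∀ m : Fin 4, Complex.I ^ ((m : ℕ) + 1) • antiVec j 0 +
        Complex.I ^ (2 * ((m : ℕ) + 1)) • antiVec j 1 -
        Complex.I ^ (3 * ((m : ℕ) + 1)) • antiVec j 2 - antiVec j 3 ∈ homSpace j := fun m => by
      have h : pathWave ((m : ℕ) + 1) (cycle j) - pathWave ((m : ℕ) + 1) (revPath (cycle j)) ∈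
          homSpace j := Submodule.mem_iSup_of_mem m (Submodule.mem_span_singleton_self _)
      rw [pathWave_sub_pathWave, hI, one_smul] at h
      exact (Submodule.smul_mem_iff _ h0).1 h
    have hI2 := Complex.I_sq
    have hI3 := Complex.I_pow_three
    have h1 := hv 0
    have h2 := hv 1
    have h3 := hv 2
    have h4 := hv 3
    have p6 : Complex.I ^ 6 = -1 := by rw [show 6 = 4 + 2 from rfl, pow_add, Complex.I_pow_four, hI2]; ring
    have p9 : Complex.I ^ 9 = Complex.I := by
      rw [show 9 = 4 * 2 + 1 from rfl, pow_add, hI]; ring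
    have p8 : Complex.I ^ 8 = 1 := hI 2
    have p12 : Complex.I ^ 12 = 1 := hI 3
    simp only [Fin.val_zero, Fin.val_one, Fin.val_two, show ((3 : Fin 4) : ℕ) = 3 from rfl,
      Nat.reduceAdd, Nat.reduceMul, zero_add, pow_one, hI2, hI3, p6, p9, p8, p12,
      Complex.I_pow_four] at h1 h2 h3 h4
    rintro _ ⟨i, rfl⟩
    rw [SetLike.mem_coe]
    have mem : ∀ a b c d : ℂ, a • (Complex.I • antiVec j 0 + (-1 : ℂ) • antiVec j 1 -
        (-Complex.I) • antiVec j 2 - antiVec j 3) + b • ((-1 : ℂ) • antiVec j 0 +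
        (1 : ℂ) • antiVec j 1 - (-1 : ℂ) • antiVec j 2 - antiVec j 3) +
        c • ((-Complex.I) • antiVec j 0 + (-1 : ℂ) • antiVec j 1 -
        Complex.I • antiVec j 2 - antiVec j 3) + d • ((1 : ℂ) • antiVec j 0 +
        (1 : ℂ) • antiVec j 1 - (1 : ℂ) • antiVec j 2 - antiVec j 3) ∈ homSpace j :=
      fun a b c d => Submodule.add_mem _ (Submodule.add_mem _ (Submodule.add_mem _
        (Submodule.smul_mem _ _ h1) (Submodule.smul_mem _ _ h2)) (Submodule.smul_mem _ _ h3))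
        (Submodule.smul_mem _ _ h4)
    -- The coefficients are those of Fourier inversion on ℤ/4: i^(-rm)/4 for the r-th vector and m =
    -- 1, …, 4, with reversed sign for r = 3, 4.
    fin_cases i
    · change antiVec j 0 ∈ _
      convert mem (-Complex.I / 4) (-1 / 4) (Complex.I / 4) (1 / 4) using 1
      match_scalars <;> first | ring1 | linear_combination (1 / 2 : ℂ) * hI2
    · change antiVec j 1 ∈ _
      convert mem (-1 / 4) (1 / 4) (-1 / 4) (1 / 4) using 1
      match_scalars <;> ring
    · change antiVec j 2 ∈ _
      convert mem (-Complex.I / 4) (1 / 4) (Complex.I / 4) (-1 / 4) using 1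
      match_scalars <;> first | ring1 | linear_combination (1 / 2 : ℂ) * hI2
    · change antiVec j 3 ∈ _
      convert mem (-1 / 4) (-1 / 4) (-1 / 4) (-1 / 4) using 1
      match_scalars <;> ring

theorem starProjection_homSpace (Ψ : StateSpace) (j : ℤ) :
    (homSpace j).starProjection Ψ = ∑ i, antiPart Ψ (j, i) • antiVec j i := by
  refine (Submodule.eq_starProjection_of_mem_of_inner_eq_zero ?_ fun w hw => ?_)
  · rw [homSpace_eq_span]
    exact Submodule.sum_mem _ fun i _ => Submodule.smul_mem _ _ (Submodule.subset_span ⟨i, rfl⟩)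
  · rw [homSpace_eq_span] at hw
    induction hw using Submodule.span_induction with
    | mem x hx =>
      obtain ⟨i, rfl⟩ := hx
      rw [inner_sub_left, (orthonormal_antiVec j).inner_left_fintype, ← inner_conj_symm,
        inner_antiVec, sub_self]
    | zero => exact inner_zero_right _
    | add x y _ _ hx hy => rw [inner_add_right, hx, hy, add_zero]
    | smul a x _ hx => rw [inner_smul_right, hx, mul_zero]

theorem homWeight_eq (Ψ : StateSpace) (j : ℤ) : homWeight Ψ j = antiWeight Ψ j := by
  have h := (orthonormal_antiVec j).inner_sum (fun i => antiPart Ψ (j, i))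
    (fun i => antiPart Ψ (j, i)) Finset.univ
  rw [inner_self_eq_norm_sq_to_K] at h
  rw [homWeight, starProjection_homSpace, antiWeight]
  have h2 : ∀ z : ℂ, starRingEnd ℂ z * z = ((‖z‖ ^ 2 : ℝ) : ℂ) := fun z => by
    rw [Complex.conj_mul']; push_cast; rfl
  simp only [h2] at h
  exact Complex.ofReal_injective (by push_cast; simpa using h)

/-! ### Localization -/

/-- The odd weight is constant in time and the even part leaves the copy; the limsup in the
definition of localization is therefore a limit. -/
theorem tendsto_copyProb (Ψ₀ : StateSpace) (j : ℤ) :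
    Tendsto (fun t => copyProb Ψ₀ t j) atTop (𝓝 (homWeight Ψ₀ j)) := by
  simp only [copyProb_eq, homWeight_eq]
  simpa using (tendsto_cell_zero (symLine Ψ₀) j).const_add (antiWeight Ψ₀ j)

theorem localizes_iff (Ψ₀ : StateSpace) : Localizes Ψ₀ ↔ Ψ₀ ∉ periodicHomSpaceᗮ := by
  rw [periodicHomSpace, Submodule.orthogonal_closure, ← Submodule.iInf_orthogonal,
    Submodule.mem_iInf, not_forall, Localizes]
  refine exists_congr fun j => ?_
  rw [(tendsto_copyProb Ψ₀ j).limsup_eq, homWeight, ← Submodule.starProjection_apply_eq_zero_iff]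
  exact ⟨fun h h0 => by simp [h0] at h, fun h => pow_pos (norm_pos_iff.2 h) 2⟩


/-! ### The limit distribution -/

theorem scaledCDF_eq (Ψ₀ : StateSpace) (t : ℕ) (x : ℝ) : scaledCDF Ψ₀ t x =
    (∑' j : ℤ, if (j : ℝ) / t ≤ x then antiWeight Ψ₀ j else 0) +
      velocityMean ((Set.Iic x).indicator 1) (symLine Ψ₀) t := by
  have s1 : Summable fun j : ℤ => if (j : ℝ) / t ≤ x then antiWeight Ψ₀ j else 0 := by
    refine (summable_antiWeight Ψ₀).of_nonneg_of_le (fun j => ?_) fun j => ?_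
    · split_ifs
      exacts [antiWeight_nonneg _ _, le_rfl]
    · split_ifs
      exacts [le_rfl, antiWeight_nonneg _ _]
  have s2 := summable_velocityMean_indicator (Set.Iic x) (symLine Ψ₀) t
  have s3 := s2
  have hnn : ∀ e : ℤ × Fin 6, 0 ≤ (Set.Iic x).indicator (1 : ℝ → ℝ) ((e.1 : ℝ) / t) *
      ‖(lineEvol^[t] (symLine Ψ₀)) e‖ ^ 2 := fun e =>
    mul_nonneg (Set.indicator_nonneg (fun _ _ => zero_le_one) _) (by positivity)
  rw [summable_cells hnn] at s3
  rw [scaledCDF, velocityMean, tsum_cells s2, ← s1.tsum_add s3]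
  refine tsum_congr fun j => ?_
  rw [copyProb_eq]
  dsimp only
  by_cases h : (j : ℝ) / t ≤ x
  · simp only [if_pos h, Set.indicator_of_mem (show (j : ℝ) / t ∈ Set.Iic x from h), Pi.one_apply,
      one_mul]
  · simp only [if_neg h, Set.indicator_of_notMem (show (j : ℝ) / t ∉ Set.Iic x from h), zero_mul,
      Finset.sum_const_zero, add_zero]

/-- The trapped mass of copy j sits at j/t → 0. At x = 0 the copies with j > 0 stay to the right of
the threshold at every positive time, whereas the limiting atom counts fully; hence the condition.
-/
theorem tendsto_tsum_antiWeight (Ψ₀ : StateSpace) {x : ℝ}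
    (hx : x ≠ 0 ∨ ∀ j : ℤ, 0 < j → antiWeight Ψ₀ j = 0) :
    Tendsto (fun t : ℕ => ∑' j : ℤ, if (j : ℝ) / t ≤ x then antiWeight Ψ₀ j else 0) atTop
      (𝓝 (if 0 ≤ x then ∑' j : ℤ, antiWeight Ψ₀ j else 0)) := by
  have hlim : (if 0 ≤ x then ∑' j : ℤ, antiWeight Ψ₀ j else 0) =
      ∑' j : ℤ, if 0 ≤ x then antiWeight Ψ₀ j else 0 := by split_ifs <;> simp
  rw [hlim]
  refine tendsto_tsum_of_dominated_convergence (summable_antiWeight Ψ₀) (fun j => ?_)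
    (Eventually.of_forall fun t j => ?_)
  · have h0 : Tendsto (fun t : ℕ => (j : ℝ) / t) atTop (𝓝 0) :=
      tendsto_const_div_atTop_nhds_zero_nat _
    refine tendsto_const_nhds.congr' ?_
    rcases lt_trichotomy x 0 with h | h | h
    · filter_upwards [h0.eventually (lt_mem_nhds h)] with t ht
      rw [if_neg (not_le.2 h), if_neg (not_le.2 ht)]
    · subst h
      filter_upwards [eventually_gt_atTop 0] with t ht
      rw [if_pos le_rfl]
      split_ifs with hj
      · rfl
      · refine (hx.resolve_left (by simp)) j ?_
        by_contra hj0
        exact hj (div_nonpos_of_nonpos_of_nonneg (by exact_mod_cast not_lt.1 hj0) (by positivity))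
    · filter_upwards [h0.eventually (gt_mem_nhds h)] with t ht
      rw [if_pos h.le, if_pos ht.le]
  · split_ifs
    · rw [Real.norm_of_nonneg (antiWeight_nonneg _ _)]
    · rw [norm_zero]; exact antiWeight_nonneg _ _

theorem exists_finiteState (Ψ₀ : StateSpace) (h : {e | Ψ₀ e ≠ 0}.Finite) :
    ∃ η, symLine Ψ₀ = toLine η := by
  have hs : (Function.support (symPart Ψ₀)).Finite := by
    refine ((h.image fun d => d.fst.1).prod (Set.finite_univ (α := Fin 6))).subset ?_
    rintro ⟨j, i⟩ hji
    refine ⟨?_, Set.mem_univ _⟩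
    by_contra hj
    have h0 : ∀ k, Ψ₀ (arc j k) = 0 := fun k => by
      by_contra hk
      exact hj ⟨arc j k, hk, by fin_cases k <;> rfl⟩
    apply hji
    fin_cases i <;> simp [symPart, h0]
  refine ⟨Finsupp.ofSupportFinite _ hs, ?_⟩
  ext e
  rw [toLine_apply]
  rfl

/-- Each band carries a density which, for a finitely supported state, is a multiple of a function
whose support is the full band. -/
theorem exists_bandDensity (Ψ₀ : StateSpace) (b : Bool) : ∃ (c : ℝ) (g : ℝ → ℝ),
    (fun y => c * g y) =ᵐ[volume] bandDensity b (symLine Ψ₀) ∧ (∀ y, 0 ≤ c * g y) ∧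
    Integrable g ∧ Function.support g ⊆ Set.Ioo (-edge b) (edge b) ∧
    ({e | Ψ₀ e ≠ 0}.Finite → ContinuousOn g (Set.Ioo (-edge b) (edge b)) ∧
      tsupport g = Set.Icc (-edge b) (edge b)) := by
  by_cases h : {e | Ψ₀ e ≠ 0}.Finite
  · obtain ⟨η, hη⟩ := exists_finiteState Ψ₀ h
    have hae := finiteBandDensity_ae b η
    rw [hη]
    rcases tsupport_finiteBandDensity b η with h0 | hs
    · have hlt : -edge b < edge b := by linarith [edge_pos b]
      have hsup : Function.support ((Set.Ioo (-edge b) (edge b)).indicator (1 : ℝ → ℝ)) =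
          Set.Ioo (-edge b) (edge b) := by
        rw [Set.support_indicator]; simp
      -- A band with zero density still needs a function with full support: the coefficient is 0 and
      -- the indicator of the band serves.
      refine ⟨0, (Set.Ioo (-edge b) (edge b)).indicator 1, ?_, fun y => by simp, ?_, hsup.le,
        fun _ => ⟨?_, ?_⟩⟩
      · rw [h0] at hae
        filter_upwards [hae] with y hy
        rw [hy]; simp
      · exact (integrable_indicator_iff measurableSet_Ioo).2
          (integrableOn_const (by simp) (by simp))
      · exact continuousOn_const.congr fun y hy => Set.indicator_of_mem hy 1
      · rw [tsupport, hsup, closure_Ioo hlt.ne]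
    · refine ⟨1, finiteBandDensity b η, ?_, fun y => ?_, ?_, Set.support_indicator_subset,
        fun _ => ⟨continuousOn_finiteBandDensity b η, hs⟩⟩
      · simpa using hae.symm
      · rw [one_mul]
        exact Set.indicator_nonneg (fun z hz => mul_nonneg (bandWeight_pos (σ := (b, true, true)) hz).le
          (by positivity)) _
      · exact (integrable_bandDensity b (toLine η)).congr hae
  · refine ⟨1, bandDensity b (symLine Ψ₀), by simp, fun y => ?_, integrable_bandDensity _ _,
      Set.support_indicator_subset, fun h' => absurd h' h⟩
    rw [one_mul]
    exact bandDensity_nonneg _ _ _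

end LineWalk

theorem theorem2 (Ψ₀ : PeriodicC4.StateSpace) (hΨ₀ : ‖Ψ₀‖ = 1) :
    -- (1) localization
    (PeriodicC4.Localizes Ψ₀ ↔ Ψ₀ ∉ (PeriodicC4.periodicHomSpace)ᗮ) ∧
    -- (2) weak limit
    Summable (PeriodicC4.homWeight Ψ₀) ∧
    ∃ (f f₁ f₂ : ℝ → ℝ) (c₁ c₂ : ℝ),
      (∀ y, f y = c₁ * f₁ y + c₂ * f₂ y) ∧
      (∀ y, 0 ≤ f y) ∧
      Integrable f₁ ∧ Integrable f₂ ∧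
      Function.support f₁ ⊆ Set.Ioo (-(1 / Real.sqrt 10)) (1 / Real.sqrt 10) ∧
      Function.support f₂ ⊆ Set.Ioo (-(2 / 7)) (2 / 7) ∧
      -- for finitely supported initial states: continuity, and the supports are exact
      ({e | Ψ₀ e ≠ 0}.Finite →
        ContinuousOn f₁ (Set.Ioo (-(1 / Real.sqrt 10)) (1 / Real.sqrt 10)) ∧
        ContinuousOn f₂ (Set.Ioo (-(2 / 7)) (2 / 7)) ∧
        tsupport f₁ = Set.Icc (-(1 / Real.sqrt 10)) (1 / Real.sqrt 10) ∧
        tsupport f₂ = Set.Icc (-(2 / 7)) (2 / 7)) ∧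
      -- the limit has total mass one
      (∑' j : ℤ, PeriodicC4.homWeight Ψ₀ j) + ∫ y, f y = 1 ∧
      -- convergence of the distribution functions
      ∀ x : ℝ, (x ≠ 0 ∨ ∀ j : ℤ, 0 < j → PeriodicC4.homWeight Ψ₀ j = 0) →
        Tendsto (fun t : ℕ => PeriodicC4.scaledCDF Ψ₀ t x) atTop
          (𝓝 ((if 0 ≤ x then ∑' j : ℤ, PeriodicC4.homWeight Ψ₀ j else 0) +
            ∫ y in Set.Iic x, f y)) := by
  have hw : PeriodicC4.homWeight Ψ₀ = LineWalk.antiWeight Ψ₀ :=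
    funext fun j => LineWalk.homWeight_eq Ψ₀ j
  obtain ⟨c₁, f₁, h1, p1, i1, s1, t1⟩ := LineWalk.exists_bandDensity Ψ₀ true
  obtain ⟨c₂, f₂, h2, p2, i2, s2, t2⟩ := LineWalk.exists_bandDensity Ψ₀ false
  -- The representatives agree with the spectral density only almost everywhere, which is enough
  -- since they enter the limit through integrals.
  have hf : (fun y => c₁ * f₁ y + c₂ * f₂ y) =ᵐ[volume]
      fun y => ‖LineWalk.spectral (LineWalk.symLine Ψ₀) y‖ ^ 2 :=
    (h1.add h2).trans (LineWalk.norm_spectral_sq_ae _).symm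
  refine ⟨LineWalk.localizes_iff Ψ₀, hw ▸ LineWalk.summable_antiWeight Ψ₀,
    fun y => c₁ * f₁ y + c₂ * f₂ y, f₁, f₂, c₁, c₂, fun _ => rfl,
    fun y => add_nonneg (p1 y) (p2 y), i1, i2, s1, s2,
    fun h => ⟨(t1 h).1, (t2 h).1, (t1 h).2, (t2 h).2⟩, ?_, fun x hx => ?_⟩
  · rw [integral_congr_ae hf, LineWalk.integral_norm_spectral_sq, hw, add_comm,
      LineWalk.norm_symLine_sq_add, hΨ₀, one_pow]
  · rw [hw] at hx ⊢
    rw [integral_congr_ae (ae_restrict_of_ae hf)]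
    simp only [LineWalk.scaledCDF_eq]
    exact (LineWalk.tendsto_tsum_antiWeight Ψ₀ hx).add
      (LineWalk.tendsto_velocityMean_spectral _ x)
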